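/- \textbf{Setting.} An almost contact metric structure $(\varphi,\xi,\eta,g)$ on a smooth manifold $N$ consists of a smooth $(1,1)$-tensor $\varphi$, a smooth vector field $\xi$, a smooth $1$-form $\eta$ and a Riemannian metric $g$ with $\varphi^2=-\mathrm{Id}+\eta\otimes\xi$, $\eta(\xi)=1$ and $g(\varphi X,\varphi Y)=g(X,Y)-\eta(X)\eta(Y)$. It is \emph{Sasakian} if it is normal, i.e. $[\varphi,\varphi]+d\eta\otimes\xi=0$ (with $d\eta(X,Y)=X\eta(Y)-Y\eta(X)-\eta([X,Y])$), its fundamental form $\Phi(X,Y)=g(\varphi X,Y)$ is closed, and $d\eta=\Phi$. A Hermitian structure on a manifold of complex dimension $n$ is a complex structure $J$ together with a $J$-Hermitian metric $h$, with fundamental form $\Omega(X,Y)=h(JX,Y)$; it is called \emph{$1$-st Gauduchon} if $\partial\overline\partial\Omega\wedge\Omega^{n-2}=0$ and \emph{astheno-K\"ahler} if $\partial\overline\partial\Omega^{n-2}=0$. \textbf{Theorem.} Let $(M_1,\varphi_1,\xi_1,\eta_1,g_1)$ and $(M_2,\varphi_2,\xi_2,\eta_2,g_2)$ be (non-empty)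 Sasakian manifolds of dimensions $2n_1+1$ and $2n_2+1$, with fundamental forms $\Phi_1,\Phi_2$, let $n=n_1+n_2+1$ and suppose $2n>6$. Let $a,b,t\in\mathbb R$ with $b\neq 0$ and $t/b>0$. On $M=M_1\times M_2$ let $$J(X,Y)=\Big(\varphi_1(X)-\tfrac{a}{b}\eta_1(X)\xi_1-\tfrac{a^2+b^2}{b}\eta_2(Y)\xi_1,\ \varphi_2(Y)+\tfrac1b\eta_1(X)\xi_2+\tfrac ab\eta_2(Y)\xi_2\Big),\qquad \Omega=\Phi_1+\Phi_2+t\,\eta_1\wedge\eta_2 .$$ Then $J$ is a complex structure, $\Omega$ is the fundamental form of a $J$-Hermitian metric on $M$, and the following are equivalent: (i) $\Omega$ is $1$-st Gauduchon; (ii) $\Omega$ is astheno-K\"ahler; (iii) $n_1(n_1-1)+2a\,n_1n_2+(a^2+b^2)\,n_2(n_2-1)=0$. -/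

import Mathlib

open scoped Manifold ContDiff

noncomputable section

namespace SasakianProduct

/-! ### Exterior algebra of a real topological vector space -/

section Pointwise

theorem update_left {W : Type*} {k l : ℕ} (m : Fin (k + l) → W) (i : Fin k) (z : W) :
    (fun j => Function.update m (Fin.castAdd l i) z (Fin.castAdd l j)) =
        Function.update (fun j => m (Fin.castAdd l j)) i z ∧
      (fun j => Function.update m (Fin.castAdd l i) z (Fin.natAdd k j)) =
        fun j => m (Fin.natAdd k j) := by
  constructor
  · ext j
    simp [Function.update_apply]
  · ext j
    refine Function.update_of_ne (fun h => ?_) _ _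
    have := congrArg Fin.val h
    simp at this
    omega

theorem update_right {W : Type*} {k l : ℕ} (m : Fin (k + l) → W) (i : Fin l) (z : W) :
    (fun j => Function.update m (Fin.natAdd k i) z (Fin.castAdd l j)) =
        (fun j => m (Fin.castAdd l j)) ∧
      (fun j => Function.update m (Fin.natAdd k i) z (Fin.natAdd k j)) =
        Function.update (fun j => m (Fin.natAdd k j)) i z := by
  constructor
  · ext j
    refine Function.update_of_ne (fun h => ?_) _ _
    have := congrArg Fin.val h
    simp at this
    omega
  · ext j
    simp [Function.update_apply]

variable {V : Type*} [AddCommGroup V] [Module ℝ V] [TopologicalSpace V]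
variable {A : Type*} [NormedCommRing A] [NormedAlgebra ℝ A]

/-- The multilinear form `(v₁, …, vₖ, w₁, …, wₗ) ↦ α(v₁, …, vₖ) β(w₁, …, wₗ)`. -/
def tensorMul {k l : ℕ} (α : V [⋀^Fin k]→L[ℝ] A) (β : V [⋀^Fin l]→L[ℝ] A) :
    ContinuousMultilinearMap ℝ (fun _ : Fin (k + l) => V) A where
  toFun v := α (fun i => v (Fin.castAdd l i)) * β (fun j => v (Fin.natAdd k j))
  map_update_add' := by
    intro inst m i x y
    obtain rfl : inst = instDecidableEqFin _ := Subsingleton.elim _ _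
    induction i using Fin.addCases with
    | left i => simp only [update_left, ContinuousAlternatingMap.map_update_add, add_mul]
    | right i => simp only [update_right, ContinuousAlternatingMap.map_update_add, mul_add]
  map_update_smul' := by
    intro inst m i c x
    obtain rfl : inst = instDecidableEqFin _ := Subsingleton.elim _ _
    induction i using Fin.addCases with
    | left i => simp only [update_left, ContinuousAlternatingMap.map_update_smul, smul_mul_assoc]
    | right i => simp only [update_right, ContinuousAlternatingMap.map_update_smul, mul_smul_comm]
  cont := by
    refine Continuous.mul ?_ ?_
    · exact α.cont.comp (continuous_pi fun i => continuous_apply _)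
    · exact β.cont.comp (continuous_pi fun i => continuous_apply _)

/-- The wedge product
`(α ∧ β)(v₁, …, vₖ₊ₗ) = 1/(k! l!) ∑_σ sgn(σ) α(v_σ(1), …, v_σ(k)) β(v_σ(k+1), …, v_σ(k+l))`. -/
def wedge {k l : ℕ} (α : V [⋀^Fin k]→L[ℝ] A) (β : V [⋀^Fin l]→L[ℝ] A) :
    V [⋀^Fin (k + l)]→L[ℝ] A :=
  ((k.factorial : ℝ) * (l.factorial : ℝ))⁻¹ •
    ContinuousMultilinearMap.alternatization (tensorMul α β)

/-- The powers `Ω ^ m = Ω ∧ ⋯ ∧ Ω` of a `2`-form. -/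
def wedgePow (Ω : V [⋀^Fin 2]→L[ℝ] A) : (m : ℕ) → V [⋀^Fin (2 * m)]→L[ℝ] A
  | 0 => ContinuousAlternatingMap.constOfIsEmpty ℝ V (Fin 0) 1
  | m + 1 => wedge (wedgePow Ω m) Ω

/-- For a complex valued `k`-form `α`, extended complex multilinearly to `V ⊗ ℂ`, and a set `S` of
slots, the multilinear form `(v₁, …, vₖ) ↦ α(w₁, …, wₖ)`, where `wᵢ = (vᵢ - √-1 J vᵢ) / 2` is the
`(1,0)`-part of `vᵢ` if `i ∈ S` and `wᵢ = (vᵢ + √-1 J vᵢ) / 2` is its `(0,1)`-part otherwise.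
The summand of index `T` is the one with `∓ √-1 J vᵢ` chosen in the slots `i ∈ T`. -/
def typeSlots (J : V →L[ℝ] V) {k : ℕ} (S : Finset (Fin k)) (α : V [⋀^Fin k]→L[ℝ] ℂ) :
    ContinuousMultilinearMap ℝ (fun _ : Fin k => V) ℂ :=
  ((1 / 2 : ℂ) ^ k) • ∑ T : Finset (Fin k),
    (∏ i ∈ T, if i ∈ S then -Complex.I else Complex.I) •
      α.toContinuousMultilinearMap.compContinuousLinearMap
        (fun i => if i ∈ T then J else ContinuousLinearMap.id ℝ V)

theorem typeSlots_apply (J : V →L[ℝ] V) {k : ℕ} (S : Finset (Fin k)) (α : V [⋀^Fin k]→L[ℝ] ℂ)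
    (v : Fin k → V) :
    typeSlots J S α v = (1 / 2 : ℂ) ^ k * ∑ T : Finset (Fin k),
      (∏ i ∈ T, if i ∈ S then -Complex.I else Complex.I) *
        α (fun i => if i ∈ T then J (v i) else v i) := by
  have : ∀ T : Finset (Fin k),
      (fun i => (if i ∈ T then J else ContinuousLinearMap.id ℝ V) (v i)) =
        fun i => if i ∈ T then J (v i) else v i := by
    intro T; ext i; split_ifs <;> rfl
  simp [typeSlots, this]

theorem typeSlots_swap (J : V →L[ℝ] V) {k : ℕ} (S : Finset (Fin k)) (α : V [⋀^Fin k]→L[ℝ] ℂ)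
    (v : Fin k → V) {i j : Fin k} (hij : i ≠ j) :
    typeSlots J (S.map (Equiv.swap i j).toEmbedding) α (v ∘ Equiv.swap i j) =
      - typeSlots J S α v := by
  set σ := Equiv.swap i j with hσ
  rw [typeSlots_apply, typeSlots_apply, ← mul_neg, ← Finset.sum_neg_distrib]
  congr 1
  refine Fintype.sum_equiv (Equiv.finsetCongr σ) _ _ ?_
  intro T
  have h1 : (∏ x ∈ T, if x ∈ S.map σ.toEmbedding then -Complex.I else Complex.I) =
      ∏ x ∈ (Equiv.finsetCongr σ) T, if x ∈ S then -Complex.I else Complex.I := by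
    simp only [Equiv.finsetCongr_apply, Finset.prod_map]
    refine Finset.prod_congr rfl fun x _ => ?_
    simp [Finset.mem_map_equiv, hσ]
  have h2 : (fun x => if x ∈ T then J ((v ∘ σ) x) else (v ∘ σ) x) =
      (fun x => if x ∈ (Equiv.finsetCongr σ) T then J (v x) else v x) ∘ σ := by
    ext x
    simp
  have h3 : ∀ w : Fin k → V, α (w ∘ σ) = - α w := fun w => α.toAlternatingMap.map_swap w hij
  rw [h1, h2, h3]
  ring

/-- The component of type `(p, k - p)` of a complex valued `k`-form, for the complex structure `J`:
the sum over all ways to put `(1,0)`-parts in `p` slots and `(0,1)`-parts in the others. -/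
def typePart (J : V →L[ℝ] V) {k : ℕ} (p : ℕ) (α : V [⋀^Fin k]→L[ℝ] ℂ) :
    V [⋀^Fin k]→L[ℝ] ℂ where
  toContinuousMultilinearMap :=
    ∑ S ∈ Finset.powersetCard p (Finset.univ : Finset (Fin k)), typeSlots J S α
  map_eq_zero_of_eq' := by
    intro v i j hv hij
    change (∑ S ∈ Finset.powersetCard p (Finset.univ : Finset (Fin k)), typeSlots J S α) v = 0
    rw [sum_apply]
    have hvσ : v ∘ Equiv.swap i j = v := by
      ext x
      simp only [Function.comp_apply, Equiv.swap_apply_def]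
      split_ifs with h1 h2
      · rw [h1, hv]
      · rw [h2, hv]
      · rfl
    have key : ∑ S ∈ Finset.powersetCard p (Finset.univ : Finset (Fin k)), typeSlots J S α v =
        - ∑ S ∈ Finset.powersetCard p (Finset.univ : Finset (Fin k)), typeSlots J S α v := by
      conv_lhs => rw [← Finset.sum_equiv (Equiv.finsetCongr (Equiv.swap i j))
        (s := Finset.powersetCard p (Finset.univ : Finset (Fin k)))
        (f := fun S => typeSlots J ((Equiv.finsetCongr (Equiv.swap i j)) S) α v)
        (by intro S; simp [Finset.mem_powersetCard]) (by intro S _; rfl)]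
      rw [← Finset.sum_neg_distrib]
      refine Finset.sum_congr rfl fun S _ => ?_
      have := typeSlots_swap J S α v hij
      rw [hvσ] at this
      exact this
    exact self_eq_neg.mp key

end Pointwise

/-! ### Differential forms on manifolds without boundary -/

section Forms

variable {E : Type*} [NormedAddCommGroup E] [NormedSpace ℝ E]
variable {H : Type*} [TopologicalSpace H] (I : ModelWithCorners ℝ E H)
variable (M : Type*) [TopologicalSpace M] [ChartedSpace H M]

/-- (Not necessarily smooth) differential `k`-forms on `M` with values in `F`. -/
abbrev Form (k : ℕ) (F : Type*) [NormedAddCommGroup F] [NormedSpace ℝ F] :=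
  (x : M) → TangentSpace I x [⋀^Fin k]→L[ℝ] F

/-- Fields of endomorphisms of the tangent bundle, i.e. tensor fields of type `(1,1)`. -/
abbrev EndoField := (x : M) → TangentSpace I x →L[ℝ] TangentSpace I x

variable {I M}
variable {k : ℕ} {F : Type*} [NormedAddCommGroup F] [NormedSpace ℝ F]

/-- The coordinate expression of a form in the chart around `x₀`: its pullback under the inverse
of the chart. -/
def Form.inChart (α : Form I M k F) (x₀ : M) : E → E [⋀^Fin k]→L[ℝ] F := fun y =>
  (α ((extChartAt I x₀).symm y)).compContinuousLinearMap
    (mfderiv 𝓘(ℝ, E) I (extChartAt I x₀).symm y)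

/-- Smoothness of a form, read in charts. -/
def Form.IsSmooth (α : Form I M k F) : Prop :=
  ∀ x₀ : M, ContDiffOn ℝ ∞ (α.inChart x₀) (extChartAt I x₀).target

/-- The exterior derivative of a form, computed in the chart around each point. -/
def Form.d (α : Form I M k F) : Form I M (k + 1) F := fun x =>
  (extDeriv (α.inChart x) (extChartAt I x x)).compContinuousLinearMap
    (mfderiv I 𝓘(ℝ, E) (extChartAt I x) x)

/-- A `1`-form given by covectors, as a form of degree `1`. -/
def oneForm (η : (x : M) → TangentSpace I x →L[ℝ] ℝ) : Form I M 1 ℝ := fun x =>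
  ContinuousAlternatingMap.ofSubsingleton ℝ (TangentSpace I x) ℝ (0 : Fin 1) (η x)

/-- The pullback of a form under a map of manifolds. -/
def Form.pullback {E' : Type*} [NormedAddCommGroup E'] [NormedSpace ℝ E']
    {H' : Type*} [TopologicalSpace H'] {I' : ModelWithCorners ℝ E' H'}
    {M' : Type*} [TopologicalSpace M'] [ChartedSpace H' M']
    (f : M' → M) (α : Form I M k F) : Form I' M' k F := fun x =>
  (α (f x)).compContinuousLinearMap (mfderiv I' I f x)

/-- A real form, as a complex valued form. -/
def Form.toComplex (α : Form I M k ℝ) : Form I M k ℂ := fun x =>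
  Complex.ofRealCLM.compContinuousAlternatingMap (α x)

/-- The pointwise wedge product. -/
def Form.wedge {A : Type*} [NormedCommRing A] [NormedAlgebra ℝ A] {l : ℕ}
    (α : Form I M k A) (β : Form I M l A) : Form I M (k + l) A := fun x =>
  SasakianProduct.wedge (α x) (β x)

/-- The pointwise wedge powers of a `2`-form. -/
def Form.pow {A : Type*} [NormedCommRing A] [NormedAlgebra ℝ A]
    (Ω : Form I M 2 A) (m : ℕ) : Form I M (2 * m) A := fun x => wedgePow (Ω x) m

/-- The component of type `(p, k - p)` of a complex valued `k`-form. -/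
def Form.typePart (J : EndoField I M) (p : ℕ) (α : Form I M k ℂ) : Form I M k ℂ := fun x =>
  SasakianProduct.typePart (J x) p (α x)

/-- The operator `∂`: on forms of type `(p, q)` it is the component of type `(p + 1, q)` of `d`. -/
def del (J : EndoField I M) (α : Form I M k ℂ) : Form I M (k + 1) ℂ :=
  ∑ p ∈ Finset.range (k + 1), ((α.typePart J p).d).typePart J (p + 1)

/-- The operator `∂̄`: on forms of type `(p, q)` it is the component of type `(p, q + 1)` of `d`. -/
def delbar (J : EndoField I M) (α : Form I M k ℂ) : Form I M (k + 1) ℂ :=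
  ∑ p ∈ Finset.range (k + 1), ((α.typePart J p).d).typePart J p

/-! ### Complex and Hermitian structures -/

variable [IsManifold I ∞ M]

/-- Smoothness at `x` of a vector field. -/
def IsSmoothVFAt (X : (x : M) → TangentSpace I x) (x : M) : Prop :=
  ContMDiffAt I I.tangent ∞ (fun y => (⟨y, X y⟩ : TangentBundle I M)) x

/-- The coordinate expression of a field of endomorphisms in the chart around `x₀`. -/
def EndoField.inChart (φ : EndoField I M) (x₀ : M) : E → E →L[ℝ] E := fun y =>
  (mfderiv I 𝓘(ℝ, E) (extChartAt I x₀) ((extChartAt I x₀).symm y)) ∘L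
    (φ ((extChartAt I x₀).symm y)) ∘L (mfderiv 𝓘(ℝ, E) I (extChartAt I x₀).symm y)

/-- Smoothness of a field of endomorphisms, read in charts. -/
def EndoField.IsSmooth (φ : EndoField I M) : Prop :=
  ∀ x₀ : M, ContDiffOn ℝ ∞ (φ.inChart x₀) (extChartAt I x₀).target

/-- The Nijenhuis torsion
`[φ, φ](X, Y) = φ²[X, Y] + [φX, φY] - φ[φX, Y] - φ[X, φY]`. -/
def nijenhuis (φ : EndoField I M) (X Y : (x : M) → TangentSpace I x) (x : M) :
    TangentSpace I x :=
  φ x (φ x (VectorField.mlieBracket I X Y x))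
    + VectorField.mlieBracket I (fun y => φ y (X y)) (fun y => φ y (Y y)) x
    - φ x (VectorField.mlieBracket I (fun y => φ y (X y)) Y x)
    - φ x (VectorField.mlieBracket I X (fun y => φ y (Y y)) x)

/-- `J` is an (integrable) complex structure on `M`. -/
structure IsComplexStructure (J : EndoField I M) : Prop where
  smooth : J.IsSmooth
  sq : ∀ (x : M) (v : TangentSpace I x), J x (J x v) = -v
  integrable : ∀ (x : M) (X Y : (x : M) → TangentSpace I x),
    IsSmoothVFAt X x → IsSmoothVFAt Y x → nijenhuis J X Y x = 0

/-- `(J, Ω)` is a Hermitian structure on `M` with fundamental form `Ω`: `J` is a complex structure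
and `g(X, Y) = Ω(X, J Y)` is a `J`-Hermitian metric, so that `Ω(X, Y) = g(J X, Y)`. -/
structure IsHermitianStructure (J : EndoField I M) (Ω : Form I M 2 ℝ) : Prop where
  isComplexStructure : IsComplexStructure J
  smooth : Ω.IsSmooth
  invariant : ∀ (x : M) (v w : TangentSpace I x), Ω x ![J x v, J x w] = Ω x ![v, w]
  pos : ∀ (x : M) (v : TangentSpace I x), v ≠ 0 → 0 < Ω x ![v, J x v]

/-- A Hermitian structure of complex dimension `n` is `m`-th Gauduchon if
`∂∂̄ Ω ^ m ∧ Ω ^ (n - m - 1) = 0`. -/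
def IsGauduchon (n m : ℕ) (J : EndoField I M) (Ω : Form I M 2 ℝ) : Prop :=
  (del J (delbar J (Ω.toComplex.pow m))).wedge (Ω.toComplex.pow (n - m - 1)) = 0

/-- A Hermitian structure of complex dimension `n` is astheno-Kähler if `∂∂̄ Ω ^ (n - 2) = 0`. -/
def IsAsthenoKahler (n : ℕ) (J : EndoField I M) (Ω : Form I M 2 ℝ) : Prop :=
  del J (delbar J (Ω.toComplex.pow (n - 2))) = 0

end Forms

/-! ### Sasakian manifolds -/

section Sasakian

variable {E : Type*} [NormedAddCommGroup E] [NormedSpace ℝ E]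
variable {H : Type*} [TopologicalSpace H] (I : ModelWithCorners ℝ E H)
variable (M : Type*) [TopologicalSpace M] [ChartedSpace H M] [IsManifold I ∞ M]

theorem continuous_bilin (B : E →L[ℝ] E →L[ℝ] ℝ) :
    Continuous fun v : Fin 2 → E => B (v 0) (v 1) :=
  (B.continuous.comp (continuous_apply 0)).clm_apply (continuous_apply 1)

/-- Almost contact metric structures `(φ, ξ, η, g)` on `M`. -/
structure AlmostContactMetric where
  φ : EndoField I M
  ξ : (x : M) → TangentSpace I x
  η : (x : M) → TangentSpace I x →L[ℝ] ℝ
  g : Bundle.ContMDiffRiemannianMetric I ∞ E (fun x : M => TangentSpace I x)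
  smooth_φ : φ.IsSmooth
  smooth_ξ : ∀ x, IsSmoothVFAt ξ x
  smooth_η : (oneForm η).IsSmooth
  φ_sq : ∀ (x : M) (v : TangentSpace I x), φ x (φ x v) = -v + η x v • ξ x
  η_ξ : ∀ x : M, η x (ξ x) = 1
  compatible : ∀ (x : M) (v w : TangentSpace I x),
    g.inner x (φ x v) (φ x w) = g.inner x v w - η x v * η x w

variable {I M}

namespace AlmostContactMetric

variable (𝒮 : AlmostContactMetric I M)

theorem ξ_ne_zero (x : M) : 𝒮.ξ x ≠ 0 := by
  intro h
  have := 𝒮.η_ξ x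
  rw [h, map_zero] at this
  exact zero_ne_one this

theorem φ_ξ (x : M) : 𝒮.φ x (𝒮.ξ x) = 0 := by
  have h0 : 𝒮.φ x (𝒮.φ x (𝒮.ξ x)) = 0 := by
    rw [𝒮.φ_sq, 𝒮.η_ξ, one_smul, neg_add_cancel]
  have h1 := 𝒮.φ_sq x (𝒮.φ x (𝒮.ξ x))
  rw [h0, map_zero] at h1
  have h2 : 𝒮.φ x (𝒮.ξ x) = 𝒮.η x (𝒮.φ x (𝒮.ξ x)) • 𝒮.ξ x := by
    rw [eq_comm, neg_add_eq_zero] at h1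
    exact h1
  set c := 𝒮.η x (𝒮.φ x (𝒮.ξ x)) with hc
  rw [h2, map_smul, h2, smul_smul] at h0
  rcases smul_eq_zero.mp h0 with h | h
  · rw [h2, mul_self_eq_zero.mp h, zero_smul]
  · exact absurd h (𝒮.ξ_ne_zero x)

theorem η_φ (x : M) (v : TangentSpace I x) : 𝒮.η x (𝒮.φ x v) = 0 := by
  have h1 := 𝒮.φ_sq x (𝒮.φ x v)
  rw [𝒮.φ_sq x v, map_add, map_neg, map_smul, 𝒮.φ_ξ, smul_zero, add_zero] at h1
  have h2 : 𝒮.η x (𝒮.φ x v) • 𝒮.ξ x = 0 := by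
    simpa using h1.symm
  exact (smul_eq_zero.mp h2).resolve_right (𝒮.ξ_ne_zero x)

theorem inner_φ_self (x : M) (v : TangentSpace I x) : 𝒮.g.inner x (𝒮.φ x v) v = 0 := by
  have h1 := 𝒮.compatible x (𝒮.φ x v) v
  have h2 := 𝒮.compatible x (𝒮.φ x v) (𝒮.ξ x)
  rw [𝒮.φ_ξ, map_zero, 𝒮.η_φ, zero_mul, sub_zero] at h2
  rw [𝒮.φ_sq, 𝒮.η_φ, zero_mul, sub_zero, map_add, map_neg, map_smul,
    _root_.add_apply, _root_.neg_apply,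
    _root_.smul_apply, 𝒮.g.symm x (𝒮.ξ x), ← h2, smul_zero, add_zero,
    𝒮.g.symm x v] at h1
  linarith

/-- The fundamental `2`-form `Φ(X, Y) = g(φ X, Y)`. -/
def Φ : Form I M 2 ℝ := fun x =>
  { toFun := fun v => 𝒮.g.inner x (𝒮.φ x (v 0)) (v 1)
    map_update_add' := by
      intro _ m i v w
      fin_cases i <;> simp
    map_update_smul' := by
      intro _ m i c v
      fin_cases i <;> simp
    cont := by
      exact continuous_bilin (E := E) (𝒮.g.inner x ∘L 𝒮.φ x)
    map_eq_zero_of_eq' := by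
      intro v i j hv hij
      have h : v 0 = v 1 := by
        fin_cases i <;> fin_cases j <;> simp_all
      simp only [h]
      exact 𝒮.inner_φ_self x (v 1) }

/-- Normality: `[φ, φ] + dη ⊗ ξ = 0`, where `dη(X, Y) = X η(Y) - Y η(X) - η([X, Y])`. -/
def IsNormal : Prop :=
  ∀ (x : M) (X Y : (x : M) → TangentSpace I x), IsSmoothVFAt X x → IsSmoothVFAt Y x →
    nijenhuis 𝒮.φ X Y x + (oneForm 𝒮.η).d x ![X x, Y x] • 𝒮.ξ x = 0

/-- Quasi-Sasakian structures: normal, with closed fundamental form. -/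
structure IsQuasiSasakian : Prop where
  normal : 𝒮.IsNormal
  closed : 𝒮.Φ.d = 0

/-- Sasakian structures: quasi-Sasakian, with `dη = Φ`. -/
structure IsSasakian : Prop extends 𝒮.IsQuasiSasakian where
  contact : (oneForm 𝒮.η).d = 𝒮.Φ

end AlmostContactMetric

/-! ### Products -/

variable {E₁ : Type*} [NormedAddCommGroup E₁] [NormedSpace ℝ E₁]
  {H₁ : Type*} [TopologicalSpace H₁] {I₁ : ModelWithCorners ℝ E₁ H₁}
  {M₁ : Type*} [TopologicalSpace M₁] [ChartedSpace H₁ M₁] [IsManifold I₁ ∞ M₁]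
  {E₂ : Type*} [NormedAddCommGroup E₂] [NormedSpace ℝ E₂]
  {H₂ : Type*} [TopologicalSpace H₂] {I₂ : ModelWithCorners ℝ E₂ H₂}
  {M₂ : Type*} [TopologicalSpace M₂] [ChartedSpace H₂ M₂] [IsManifold I₂ ∞ M₂]

/-- The Tsukada complex structure on `M₁ × M₂`:
`J(X, Y) = (φ₁ X - (a/b) η₁(X) ξ₁ - ((a² + b²)/b) η₂(Y) ξ₁, φ₂ Y + (1/b) η₁(X) ξ₂ + (a/b) η₂(Y) ξ₂)`,
where `T_(x,y)(M₁ × M₂)` is identified with `T_x M₁ × T_y M₂`. -/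
def tsukadaJ (𝒮₁ : AlmostContactMetric I₁ M₁) (𝒮₂ : AlmostContactMetric I₂ M₂) (a b : ℝ) :
    EndoField (I₁.prod I₂) (M₁ × M₂) := fun z =>
  let X : TangentSpace (I₁.prod I₂) z →L[ℝ] TangentSpace I₁ z.1 :=
    mfderiv (I₁.prod I₂) I₁ Prod.fst z
  let Y : TangentSpace (I₁.prod I₂) z →L[ℝ] TangentSpace I₂ z.2 :=
    mfderiv (I₁.prod I₂) I₂ Prod.snd z
  let J₁ : TangentSpace (I₁.prod I₂) z →L[ℝ] TangentSpace I₁ z.1 :=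
    𝒮₁.φ z.1 ∘L X - (a / b) • (𝒮₁.η z.1 ∘L X).smulRight (𝒮₁.ξ z.1)
      - ((a ^ 2 + b ^ 2) / b) • (𝒮₂.η z.2 ∘L Y).smulRight (𝒮₁.ξ z.1)
  let J₂ : TangentSpace (I₁.prod I₂) z →L[ℝ] TangentSpace I₂ z.2 :=
    𝒮₂.φ z.2 ∘L Y + (1 / b) • (𝒮₁.η z.1 ∘L X).smulRight (𝒮₂.ξ z.2)
      + (a / b) • (𝒮₂.η z.2 ∘L Y).smulRight (𝒮₂.ξ z.2)
  J₁.prod J₂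

/-- The `2`-form `Ω = Φ₁ + Φ₂ + t η₁ ∧ η₂` on `M₁ × M₂` (with the pullbacks by the projections
understood). -/
def prodOmega (𝒮₁ : AlmostContactMetric I₁ M₁) (𝒮₂ : AlmostContactMetric I₂ M₂) (t : ℝ) :
    Form (I₁.prod I₂) (M₁ × M₂) 2 ℝ :=
  𝒮₁.Φ.pullback Prod.fst + 𝒮₂.Φ.pullback Prod.snd
    + t • ((oneForm 𝒮₁.η).pullback Prod.fst).wedge ((oneForm 𝒮₂.η).pullback Prod.snd)

end Sasakian

end SasakianProduct

end

open SasakianProduct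

/-!
Put `c = a + √-1 b`. For the structure `J`, the forms `Φ₁`, `Φ₂` and `η₁ ∧ η₂` have type `(1, 1)`,
while `η₁ + c η₂` and `η₁ + c̄ η₂` have types `(1, 0)` and `(0, 1)`. As `dηᵢ = Φᵢ` and `dΦᵢ = 0`, the
form `Ω = Φ₁ + Φ₂ + t η₁ ∧ η₂` satisfies
`(c - c̄) dΩ = -t (Φ₁ + c Φ₂) ∧ (η₁ + c̄ η₂) + t (Φ₁ + c̄ Φ₂) ∧ (η₁ + c η₂)`,
which is the decomposition of `dΩ` into types. Hence `∂̄ Ω ^ (m + 1)` is the multiple with factor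
`-(m + 1) t / (c - c̄)` of `(Φ₁ + c Φ₂) ∧ (η₁ + c̄ η₂) ∧ Ω ^ m`. Differentiating once more, the terms
that contain `η₁ ∧ η₂` cancel, and `∂∂̄ Ω ^ (m + 1)` is the same multiple of
`(Φ₁² + 2 a Φ₁ Φ₂ + (a² + b²) Φ₂²) (Φ₁ + Φ₂) ^ m` (`ringAt_del_delbar_pow`,
`ringAt_del_delbar_prodOmega_pow`).

Forms of degree two commute, and `Φ₁ ^ (n₁ + 1) = 0 = Φ₂ ^ (n₂ + 1)` for dimensional reasons. For
`m + 1 = n - 2` only the monomial `Φ₁ ^ n₁ Φ₂ ^ n₂` survives, and its coefficient is a nonzero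
multiple of the left-hand side of the numerical condition. For `m = 0`, the product with
`Ω ^ (n - 2)` is a nonzero multiple of the previous form times `η₁ ∧ η₂`. The monomial
`Φ₁ ^ n₁ Φ₂ ^ n₂ η₁ η₂` is not zero, since `Ω ^ n` is a multiple of it and `Ω` is nondegenerate
(`quadratic_mul_pow_eq_zero_iff`, `pow_complexify_ne_zero`).

These computations take place in the exterior algebra `FormRing E` of the model space, into which
forms of all degrees are embedded; this disposes of the casts between degrees. The type of an element
is read off from its pullbacks under `c + s J` (`HasType`), a description that is multiplicative.

For the integrability of `J`, the Nijenhuis torsion at a point is written in terms of the value and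
the first derivative of `J` in a chart (`nijenhuis_eq_nijenhuisJet`). In a product chart these are
given by the corresponding data of the two factors, collected in `ContactJet`, and the torsion
vanishes by normality together with `L_ξ φ = 0` (`ContactJet.lie_φ`, `nijenhuisJet_prod_eq_zero`).
-/

noncomputable section

namespace SasakianProduct

/-! ### Algebra of the wedge product -/

section WedgeAlgebra

open Equiv

variable {V : Type*} [NormedAddCommGroup V] [NormedSpace ℝ V]

theorem wedge_apply {k l : ℕ} (α : V [⋀^Fin k]→L[ℝ] ℂ) (β : V [⋀^Fin l]→L[ℝ] ℂ)
    (v : Fin (k + l) → V) :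
    wedge α β v = ((k.factorial : ℂ) * (l.factorial : ℂ))⁻¹ *
      ∑ σ : Perm (Fin (k + l)), (Perm.sign σ : ℂ) *
        (α (fun i => v (σ (Fin.castAdd l i))) * β (fun j => v (σ (Fin.natAdd k j)))) := by
  simp only [wedge, ContinuousAlternatingMap.smul_apply,
    ContinuousMultilinearMap.alternatization_apply_apply, Complex.real_smul]
  push_cast
  congr 1
  refine Finset.sum_congr rfl fun σ _ => ?_
  rw [Units.smul_def, zsmul_eq_mul]
  rfl

/-- Complex valued real-multilinear alternating `k`-forms on `V`. -/
abbrev AltForm (V : Type*) [NormedAddCommGroup V] [NormedSpace ℝ V] (k : ℕ) : Type _ :=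
  V [⋀^Fin k]→L[ℝ] ℂ

/-- Two alternating forms whose degrees are propositionally equal are equal as homogeneous elements
as soon as they agree after relabelling the arguments. -/
theorem gradedMonoid_mk_eq {k l : ℕ} (h : k = l) {α : V [⋀^Fin k]→L[ℝ] ℂ}
    {β : V [⋀^Fin l]→L[ℝ] ℂ} (H : ∀ v : Fin l → V, α (fun i => v (Fin.cast h i)) = β v) :
    (GradedMonoid.mk (A := AltForm V) k α) =
      GradedMonoid.mk (A := AltForm V) l β := by
  subst h
  congr 1
  ext v
  exact H v

/-- Translating the summation index of a signed sum over permutations. -/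
theorem sum_sign_perm_mul {N : ℕ} (τ : Perm (Fin N)) (G : Perm (Fin N) → ℂ) :
    ∑ σ : Perm (Fin N), (Perm.sign σ : ℂ) * G (σ * τ) =
      (Perm.sign τ : ℂ) * ∑ σ : Perm (Fin N), (Perm.sign σ : ℂ) * G σ := by
  rw [Finset.mul_sum]
  refine Fintype.sum_equiv (Equiv.mulRight τ) _ _ fun σ => ?_
  have h : ((Perm.sign τ : ℤˣ) : ℂ) * ((Perm.sign τ : ℤˣ) : ℂ) = 1 := by
    rcases Int.units_eq_one_or (Perm.sign τ) with h | h <;> simp [h]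
  simp only [Equiv.coe_mulRight, Perm.sign_mul, Units.val_mul, Int.cast_mul]
  linear_combination (-(Perm.sign σ : ℂ) * G (σ * τ)) * h

/-- Antisymmetrizing over a subgroup first only contributes the order of that subgroup. -/
theorem sum_sign_sum_sign {N k : ℕ} (ι : Perm (Fin k) → Perm (Fin N))
    (hι : ∀ τ, Perm.sign (ι τ) = Perm.sign τ) (G : Perm (Fin N) → ℂ) :
    ∑ σ : Perm (Fin N), (Perm.sign σ : ℂ) *
        ∑ τ : Perm (Fin k), (Perm.sign τ : ℂ) * G (σ * ι τ) =
      (k.factorial : ℂ) * ∑ σ : Perm (Fin N), (Perm.sign σ : ℂ) * G σ := by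
  have h : ∀ τ : Perm (Fin k), ((Perm.sign τ : ℤˣ) : ℂ) * ((Perm.sign τ : ℤˣ) : ℂ) = 1 := by
    intro τ
    rcases Int.units_eq_one_or (Perm.sign τ) with h | h <;> simp [h]
  calc _ = ∑ τ : Perm (Fin k), (Perm.sign τ : ℂ) *
        ∑ σ : Perm (Fin N), (Perm.sign σ : ℂ) * G (σ * ι τ) := by
        simp only [Finset.mul_sum]
        rw [Finset.sum_comm]
        refine Finset.sum_congr rfl fun τ _ => Finset.sum_congr rfl fun σ _ => ?_
        ring
    _ = ∑ τ : Perm (Fin k), ∑ σ : Perm (Fin N), (Perm.sign σ : ℂ) * G σ := by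
        refine Finset.sum_congr rfl fun τ _ => ?_
        rw [sum_sign_perm_mul, hι, ← mul_assoc, h, one_mul]
    _ = _ := by
        simp [Fintype.card_perm]

/-- The permutation of `Fin (k + l)` acting as `τ` on the first `k` and `ρ` on the last `l`
elements. -/
def blockPerm {k l : ℕ} (τ : Perm (Fin k)) (ρ : Perm (Fin l)) : Perm (Fin (k + l)) :=
  finSumFinEquiv.permCongr (Perm.sumCongr τ ρ)

theorem blockPerm_castAdd {k l : ℕ} (τ : Perm (Fin k)) (ρ : Perm (Fin l)) (i : Fin k) :
    blockPerm τ ρ (Fin.castAdd l i) = Fin.castAdd l (τ i) := by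
  simp [blockPerm, Equiv.permCongr_apply]

theorem blockPerm_natAdd {k l : ℕ} (τ : Perm (Fin k)) (ρ : Perm (Fin l)) (i : Fin l) :
    blockPerm τ ρ (Fin.natAdd k i) = Fin.natAdd k (ρ i) := by
  simp [blockPerm, Equiv.permCongr_apply]

theorem sign_blockPerm {k l : ℕ} (τ : Perm (Fin k)) (ρ : Perm (Fin l)) :
    Perm.sign (blockPerm τ ρ) = Perm.sign τ * Perm.sign ρ := by
  simp [blockPerm, Perm.sign_permCongr, Perm.sign_sumCongr]

theorem wedge_wedge_left_apply {k l m : ℕ} (α : V [⋀^Fin k]→L[ℝ] ℂ) (β : V [⋀^Fin l]→L[ℝ] ℂ)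
    (γ : V [⋀^Fin m]→L[ℝ] ℂ) (v : Fin (k + l + m) → V) :
    wedge (wedge α β) γ v =
      ((k.factorial : ℂ) * (l.factorial : ℂ) * (m.factorial : ℂ))⁻¹ *
        ∑ σ : Perm (Fin (k + l + m)), (Perm.sign σ : ℂ) *
          (α (fun i => v (σ (Fin.castAdd m (Fin.castAdd l i)))) *
            β (fun i => v (σ (Fin.castAdd m (Fin.natAdd k i)))) *
            γ (fun i => v (σ (Fin.natAdd (k + l) i)))) := by
  have key := sum_sign_sum_sign (fun τ : Perm (Fin (k + l)) => blockPerm τ (1 : Perm (Fin m)))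
    (fun τ => by simp [sign_blockPerm])
    (fun σ => α (fun i => v (σ (Fin.castAdd m (Fin.castAdd l i)))) *
            β (fun i => v (σ (Fin.castAdd m (Fin.natAdd k i)))) *
            γ (fun i => v (σ (Fin.natAdd (k + l) i))))
  simp only [Perm.mul_apply, blockPerm_castAdd, blockPerm_natAdd, Perm.one_apply] at key
  have hf : ((k + l).factorial : ℂ) ≠ 0 := by exact_mod_cast (k + l).factorial_ne_zero
  rw [wedge_apply]
  simp only [wedge_apply α β]
  rw [show ∑ σ : Perm (Fin (k + l + m)), (Perm.sign σ : ℂ) *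
          (α (fun i => v (σ (Fin.castAdd m (Fin.castAdd l i)))) *
            β (fun i => v (σ (Fin.castAdd m (Fin.natAdd k i)))) *
            γ (fun i => v (σ (Fin.natAdd (k + l) i)))) = ((k + l).factorial : ℂ)⁻¹ * _ from
        (eq_inv_mul_iff_mul_eq₀ hf).2 key.symm]
  simp only [Finset.mul_sum, Finset.sum_mul]
  refine Finset.sum_congr rfl fun σ _ => Finset.sum_congr rfl fun τ _ => ?_
  simp only [mul_inv]
  ring

theorem wedge_wedge_right_apply {k l m : ℕ} (α : V [⋀^Fin k]→L[ℝ] ℂ) (β : V [⋀^Fin l]→L[ℝ] ℂ)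
    (γ : V [⋀^Fin m]→L[ℝ] ℂ) (v : Fin (k + (l + m)) → V) :
    wedge α (wedge β γ) v =
      ((k.factorial : ℂ) * (l.factorial : ℂ) * (m.factorial : ℂ))⁻¹ *
        ∑ σ : Perm (Fin (k + (l + m))), (Perm.sign σ : ℂ) *
          (α (fun i => v (σ (Fin.castAdd (l + m) i))) *
            β (fun i => v (σ (Fin.natAdd k (Fin.castAdd m i)))) *
            γ (fun i => v (σ (Fin.natAdd k (Fin.natAdd l i))))) := by
  have key := sum_sign_sum_sign (fun τ : Perm (Fin (l + m)) => blockPerm (1 : Perm (Fin k)) τ)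
    (fun τ => by simp [sign_blockPerm])
    (fun σ => α (fun i => v (σ (Fin.castAdd (l + m) i))) *
            β (fun i => v (σ (Fin.natAdd k (Fin.castAdd m i)))) *
            γ (fun i => v (σ (Fin.natAdd k (Fin.natAdd l i)))))
  simp only [Perm.mul_apply, blockPerm_castAdd, blockPerm_natAdd, Perm.one_apply] at key
  have hf : ((l + m).factorial : ℂ) ≠ 0 := by exact_mod_cast (l + m).factorial_ne_zero
  rw [wedge_apply]
  simp only [wedge_apply β γ]
  rw [show ∑ σ : Perm (Fin (k + (l + m))), (Perm.sign σ : ℂ) *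
          (α (fun i => v (σ (Fin.castAdd (l + m) i))) *
            β (fun i => v (σ (Fin.natAdd k (Fin.castAdd m i)))) *
            γ (fun i => v (σ (Fin.natAdd k (Fin.natAdd l i))))) = ((l + m).factorial : ℂ)⁻¹ * _ from
        (eq_inv_mul_iff_mul_eq₀ hf).2 key.symm]
  simp only [Finset.mul_sum]
  refine Finset.sum_congr rfl fun σ _ => Finset.sum_congr rfl fun τ _ => ?_
  simp only [mul_inv]
  ring

/-- The index sets `Fin N` and `Fin N'` of a signed sum may be exchanged when `N = N'`; this is what
the degree casts in associativity and commutativity of the wedge product amount to. -/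
theorem sum_sign_cast {N N' : ℕ} (h : N = N') (G : (Fin N → Fin N') → ℂ) :
    ∑ σ : Perm (Fin N), (Perm.sign σ : ℂ) * G (fun i => Fin.cast h (σ i)) =
      ∑ σ : Perm (Fin N'), (Perm.sign σ : ℂ) * G (fun i => σ (Fin.cast h i)) := by
  subst h
  rfl

/-- The degrees `k + l + m` and `k + (l + m)` are only propositionally equal, so associativity is
stated for homogeneous elements. -/
theorem wedge_assoc {k l m : ℕ} (α : V [⋀^Fin k]→L[ℝ] ℂ) (β : V [⋀^Fin l]→L[ℝ] ℂ)
    (γ : V [⋀^Fin m]→L[ℝ] ℂ) :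
    (GradedMonoid.mk (A := AltForm V) _ (wedge (wedge α β) γ)) =
      GradedMonoid.mk (A := AltForm V) _ (wedge α (wedge β γ)) := by
  refine gradedMonoid_mk_eq (add_assoc k l m) fun v => ?_
  rw [wedge_wedge_left_apply, wedge_wedge_right_apply]
  congr 1
  refine (sum_sign_cast (add_assoc k l m) (fun s => α (fun i => v (s (Fin.castAdd m (Fin.castAdd l i)))) *
            β (fun i => v (s (Fin.castAdd m (Fin.natAdd k i)))) *
            γ (fun i => v (s (Fin.natAdd (k + l) i))))).trans ?_
  have e1 : ∀ i : Fin k, Fin.cast (add_assoc k l m) (Fin.castAdd m (Fin.castAdd l i)) =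
    Fin.castAdd (l + m) i := fun i => by ext; simp
  have e2 : ∀ i : Fin l, Fin.cast (add_assoc k l m) (Fin.castAdd m (Fin.natAdd k i)) =
    Fin.natAdd k (Fin.castAdd m i) := fun i => by ext; simp
  have e3 : ∀ i : Fin m, Fin.cast (add_assoc k l m) (Fin.natAdd (k + l) i) =
    Fin.natAdd k (Fin.natAdd l i) := fun i => by ext; simp [add_assoc]
  simp only [e1, e2, e3]

theorem alternating_comp_perm {k : ℕ} (α : V [⋀^Fin k]→L[ℝ] ℂ) (v : Fin k → V)
    (σ : Perm (Fin k)) : α (fun i => v (σ i)) = (Perm.sign σ : ℂ) * α v := by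
  have := α.toAlternatingMap.map_perm v σ
  rw [Units.smul_def, zsmul_eq_mul] at this
  exact this

theorem sum_sign_sign {k : ℕ} : ∑ τ : Perm (Fin k), ((Perm.sign τ : ℤˣ) : ℂ) * ((Perm.sign τ : ℤˣ) : ℂ)
    = k.factorial := by
  have h : ∀ τ : Perm (Fin k), ((Perm.sign τ : ℤˣ) : ℂ) * ((Perm.sign τ : ℤˣ) : ℂ) = 1 := by
    intro τ
    rcases Int.units_eq_one_or (Perm.sign τ) with h | h <;> simp [h]
  simp [h, Fintype.card_perm]

theorem one_wedge (c : ℂ) {k : ℕ} (α : V [⋀^Fin k]→L[ℝ] ℂ) (v : Fin (0 + k) → V) :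
    wedge (ContinuousAlternatingMap.constOfIsEmpty ℝ V (Fin 0) c) α v =
      c * α (fun i => v (Fin.natAdd 0 i)) := by
  have hf : (k.factorial : ℂ) ≠ 0 := by exact_mod_cast k.factorial_ne_zero
  have hp : ∀ σ : Perm (Fin (0 + k)), α (fun j => v (σ (Fin.natAdd 0 j))) =
      (Perm.sign σ : ℂ) * α (fun j => v (Fin.natAdd 0 j)) := by
    have e : (0 + k) = k := zero_add k
    intro σ
    have := alternating_comp_perm α (fun j => v (Fin.natAdd 0 j)) ((finCongr e).permCongr σ)
    rw [Perm.sign_permCongr] at this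
    rw [← this]
    congr 1
    ext j
    congr 1
    ext
    simp only [permCongr_apply, finCongr_symm, finCongr_apply, Fin.val_natAdd, Fin.val_cast, zero_add]
    congr 2
    ext
    simp
  rw [wedge_apply]
  simp only [hp, ContinuousAlternatingMap.constOfIsEmpty_apply]
  rw [show ∑ σ : Perm (Fin (0 + k)), (Perm.sign σ : ℂ) * (c * ((Perm.sign σ : ℂ) *
    α (fun j => v (Fin.natAdd 0 j)))) = (∑ σ : Perm (Fin (0 + k)), (Perm.sign σ : ℂ) *
      (Perm.sign σ : ℂ)) * (c * α (fun j => v (Fin.natAdd 0 j))) by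
      rw [Finset.sum_mul]; exact Finset.sum_congr rfl fun _ _ => by ring]
  rw [sum_sign_sign, zero_add]
  simp only [Nat.factorial_zero, Nat.cast_one, one_mul]
  field_simp

theorem wedge_one (c : ℂ) {k : ℕ} (α : V [⋀^Fin k]→L[ℝ] ℂ) :
    wedge α (ContinuousAlternatingMap.constOfIsEmpty ℝ V (Fin 0) c) = c • α := by
  have hf : (k.factorial : ℂ) ≠ 0 := by exact_mod_cast k.factorial_ne_zero
  ext v
  rw [wedge_apply]
  have hp : ∀ σ : Perm (Fin k), α (fun j => v (σ (Fin.castAdd 0 j))) = (Perm.sign σ : ℂ) * α v :=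
    fun σ => alternating_comp_perm α v σ
  change _ * ∑ σ : Perm (Fin k), _ = _
  simp only [hp]
  rw [show ∑ σ : Perm (Fin k), (Perm.sign σ : ℂ) * ((Perm.sign σ : ℂ) * α v * _)
    = (∑ σ : Perm (Fin k), (Perm.sign σ : ℂ) * (Perm.sign σ : ℂ)) * (c * α v) by
      rw [Finset.sum_mul]; exact Finset.sum_congr rfl fun _ _ => by
        rw [ContinuousAlternatingMap.constOfIsEmpty_apply]; ring]
  rw [sum_sign_sign]
  simp only [Nat.factorial_zero, Nat.cast_one, mul_one, ContinuousAlternatingMap.smul_apply,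
    smul_eq_mul]
  field_simp

theorem wedge_add_left {k l : ℕ} (α α' : V [⋀^Fin k]→L[ℝ] ℂ) (β : V [⋀^Fin l]→L[ℝ] ℂ) :
    wedge (α + α') β = wedge α β + wedge α' β := by
  ext v
  simp only [wedge_apply, ContinuousAlternatingMap.add_apply, add_mul, mul_add,
    Finset.sum_add_distrib]

theorem wedge_add_right {k l : ℕ} (α : V [⋀^Fin k]→L[ℝ] ℂ) (β β' : V [⋀^Fin l]→L[ℝ] ℂ) :
    wedge α (β + β') = wedge α β + wedge α β' := by
  ext v
  simp only [wedge_apply, ContinuousAlternatingMap.add_apply, mul_add,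
    Finset.sum_add_distrib]

theorem wedge_smul_left {k l : ℕ} (c : ℂ) (α : V [⋀^Fin k]→L[ℝ] ℂ) (β : V [⋀^Fin l]→L[ℝ] ℂ) :
    wedge (c • α) β = c • wedge α β := by
  ext v
  simp only [wedge_apply, ContinuousAlternatingMap.smul_apply, smul_eq_mul, Finset.mul_sum]
  exact Finset.sum_congr rfl fun _ _ => by ring

theorem wedge_smul_right {k l : ℕ} (c : ℂ) (α : V [⋀^Fin k]→L[ℝ] ℂ) (β : V [⋀^Fin l]→L[ℝ] ℂ) :
    wedge α (c • β) = c • wedge α β := by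
  ext v
  simp only [wedge_apply, ContinuousAlternatingMap.smul_apply, smul_eq_mul, Finset.mul_sum]
  exact Finset.sum_congr rfl fun _ _ => by ring

theorem wedge_zero_left {k l : ℕ} (β : V [⋀^Fin l]→L[ℝ] ℂ) :
    wedge (0 : V [⋀^Fin k]→L[ℝ] ℂ) β = 0 := by
  ext v
  simp [wedge_apply]

theorem wedge_zero_right {k l : ℕ} (α : V [⋀^Fin k]→L[ℝ] ℂ) :
    wedge α (0 : V [⋀^Fin l]→L[ℝ] ℂ) = 0 := by
  ext v
  simp [wedge_apply]

/-- A complex valued real linear functional, as a form of degree one. -/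
def covector (f : V →L[ℝ] ℂ) : V [⋀^Fin 1]→L[ℝ] ℂ :=
  ContinuousAlternatingMap.ofSubsingleton ℝ V ℂ (0 : Fin 1) f

@[simp] theorem covector_apply (f : V →L[ℝ] ℂ) (v : Fin 1 → V) : covector f v = f (v 0) := rfl

/-- Expansion of the wedge product with a `1`-form along the slot of the `1`-form. -/
theorem covector_wedge_apply (f : V →L[ℝ] ℂ) {k : ℕ} (α : V [⋀^Fin k]→L[ℝ] ℂ)
    (v : Fin (k + 1) → V) :
    wedge (covector f) α (fun i => v (Fin.cast (add_comm 1 k) i)) =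
      ∑ i : Fin (k + 1), (-1) ^ (i : ℕ) * (f (v i) * α (fun j => v (i.succAbove j))) := by
  have hf : (k.factorial : ℂ) ≠ 0 := by exact_mod_cast k.factorial_ne_zero
  have hf' : ((k + 1).factorial : ℂ) ≠ 0 := by exact_mod_cast (k + 1).factorial_ne_zero
  -- the right-hand side is alternating, so it equals its own antisymmetrization
  set T : V [⋀^Fin (k + 1)]→L[ℝ] ℂ :=
    ContinuousAlternatingMap.alternatizeUncurryFin (f.smulRight α) with hT
  have hTv : ∀ w : Fin (k + 1) → V, T w =
      ∑ i : Fin (k + 1), (-1) ^ (i : ℕ) * (f (w i) * α (fun j => w (i.succAbove j))) := by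
    intro w
    rw [hT, ContinuousAlternatingMap.alternatizeUncurryFin_apply]
    refine Finset.sum_congr rfl fun i _ => ?_
    rw [zsmul_eq_mul]
    push_cast
    rfl
  rw [← hTv, wedge_apply]
  have h1 := sum_sign_cast (add_comm 1 k) (fun s => f (v (s (Fin.castAdd k 0))) *
    α (fun j => v (s (Fin.natAdd 1 j))))
  simp only [covector_apply]
  rw [h1]
  have e1 : Fin.cast (add_comm 1 k) (Fin.castAdd k (0 : Fin 1)) = 0 := by ext; simp
  have e2 : ∀ j : Fin k, Fin.cast (add_comm 1 k) (Fin.natAdd 1 j) = j.succ := by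
    intro j; ext; simp
  simp only [e1, e2]
  set S := ∑ σ : Perm (Fin (k + 1)), (Perm.sign σ : ℂ) *
    (f (v (σ 0)) * α (fun j => v (σ j.succ))) with hS
  have key : ((k + 1).factorial : ℂ) * T v = (k + 1 : ℂ) * S := by
    calc ((k + 1).factorial : ℂ) * T v
        = ∑ σ : Perm (Fin (k + 1)), (Perm.sign σ : ℂ) * T (fun i => v (σ i)) := by
          simp only [alternating_comp_perm T v, ← mul_assoc]
          rw [← Finset.sum_mul, sum_sign_sign]
      _ = ∑ i : Fin (k + 1), ∑ σ : Perm (Fin (k + 1)), (-1) ^ (i : ℕ) * ((Perm.sign σ : ℂ) *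
            (f (v (σ i)) * α (fun j => v (σ (i.succAbove j))))) := by
          simp only [hTv, Finset.mul_sum]
          rw [Finset.sum_comm]
          exact Finset.sum_congr rfl fun _ _ => Finset.sum_congr rfl fun _ _ => by ring
      _ = ∑ i : Fin (k + 1), S := by
          refine Finset.sum_congr rfl fun i _ => ?_
          rw [← Finset.mul_sum]
          have h3 : ∑ σ : Perm (Fin (k + 1)), (Perm.sign σ : ℂ) *
            (f (v (σ i)) * α (fun j => v (σ (i.succAbove j)))) = (-1) ^ (i : ℕ) * S := by
            have h4 : ((-1 : ℂ) ^ (i : ℕ)) * (-1) ^ (i : ℕ) = 1 := by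
              rw [← mul_pow]; simp
            have h5 : S = (-1) ^ (i : ℕ) * ∑ σ : Perm (Fin (k + 1)), (Perm.sign σ : ℂ) *
              (f (v (σ i)) * α (fun j => v (σ (i.succAbove j)))) := by
              -- the cycle `(0 1 … i)` moves the slot `i` to the front and has sign `(-1) ^ i`
              rw [hS, ← Equiv.sum_comp (Equiv.mulRight i.cycleRange.symm), Finset.mul_sum]
              refine Finset.sum_congr rfl fun σ _ => ?_
              simp only [coe_mulRight, Perm.mul_apply, Perm.sign_mul, Perm.sign_symm,
                Fin.sign_cycleRange, Fin.cycleRange_symm_zero, Fin.cycleRange_symm_succ]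
              push_cast
              ring
            rw [h5, ← mul_assoc, h4, one_mul]
          rw [h3, ← mul_assoc, ← mul_pow]
          simp
      _ = (k + 1 : ℂ) * S := by simp
  rw [Nat.factorial_succ] at key
  push_cast at key
  have hk : (k + 1 : ℂ) ≠ 0 := by exact_mod_cast k.succ_ne_zero
  have : (k.factorial : ℂ) * T v = S := by
    apply mul_left_cancel₀ hk
    rw [← mul_assoc, key]
  rw [← this]
  simp only [Nat.factorial_one, Nat.cast_one, one_mul]
  field_simp

/-- Moving a covector past a `k`-form is the cyclic rotation of `k + 1` slots, of sign `(-1) ^ k`. -/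
theorem wedge_covector_anticomm (f : V →L[ℝ] ℂ) {k : ℕ} (α : V [⋀^Fin k]→L[ℝ] ℂ) :
    (GradedMonoid.mk (A := AltForm V) _ (wedge (covector f) α)) =
      GradedMonoid.mk (A := AltForm V) _ ((-1 : ℂ) ^ k • wedge α (covector f)) := by
  refine gradedMonoid_mk_eq (add_comm 1 k) fun v => ?_
  rw [ContinuousAlternatingMap.smul_apply, wedge_apply, wedge_apply]
  have h1 := sum_sign_cast (add_comm 1 k) (fun s => f (v (s (Fin.castAdd k 0))) *
    α (fun j => v (s (Fin.natAdd 1 j))))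
  simp only [covector_apply]
  rw [h1]
  have e1 : Fin.cast (add_comm 1 k) (Fin.castAdd k (0 : Fin 1)) = finRotate (k + 1) (Fin.last k) := by
    ext; simp
  have e2 : ∀ j : Fin k, Fin.cast (add_comm 1 k) (Fin.natAdd 1 j) =
      finRotate (k + 1) (Fin.castSucc j) := by
    intro j; ext; simp
  have e3 : Fin.natAdd k (0 : Fin 1) = Fin.last k := by ext; simp
  simp only [e1, e2, e3]
  have h2 := sum_sign_perm_mul (finRotate (k + 1))
    (fun σ => f (v (σ (Fin.last k))) * α (fun j => v (σ (Fin.castSucc j))))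
  simp only [Perm.mul_apply] at h2
  rw [h2, sign_finRotate]
  simp only [add_tsub_cancel_right, smul_eq_mul]
  push_cast
  rw [show (Fin.castAdd 1 : Fin k → Fin (k + 1)) = Fin.castSucc from rfl, mul_left_comm]
  simp only [mul_comm (f _)]
  rw [mul_comm ((1 : ℕ).factorial : ℂ)]

end WedgeAlgebra

/-! ### The exterior algebra as a graded ring -/

section ExteriorRing

variable {V : Type*} [NormedAddCommGroup V] [NormedSpace ℝ V]

instance : GradedMonoid.GMul (AltForm V) where
  mul α β := wedge α β

instance : GradedMonoid.GOne (AltForm V) where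
  one := ContinuousAlternatingMap.constOfIsEmpty ℝ V (Fin 0) 1

instance : DirectSum.GRing (AltForm V) where
  mul_zero α := wedge_zero_right α
  zero_mul β := wedge_zero_left β
  mul_add α β γ := wedge_add_right α β γ
  add_mul α β γ := wedge_add_left α β γ
  one_mul := by
    rintro ⟨k, α⟩
    refine gradedMonoid_mk_eq (zero_add k) fun v => ?_
    refine (one_wedge 1 α _).trans ?_
    rw [one_mul]
    congr 1
    ext i
    congr 1
    ext
    simp
  mul_one := by
    rintro ⟨k, α⟩
    refine gradedMonoid_mk_eq (add_zero k) fun v => ?_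
    refine (congrArg (fun β : AltForm V k => β v) (wedge_one 1 α)).trans ?_
    rw [one_smul]
  mul_assoc := by
    rintro ⟨k, α⟩ ⟨l, β⟩ ⟨m, γ⟩
    exact wedge_assoc α β γ
  natCast n := ContinuousAlternatingMap.constOfIsEmpty ℝ V (Fin 0) n
  natCast_zero := by ext; simp
  natCast_succ n := by
    ext v
    simp only [Nat.cast_succ, ContinuousAlternatingMap.constOfIsEmpty_apply,
      ContinuousAlternatingMap.add_apply]
    rfl
  intCast n := ContinuousAlternatingMap.constOfIsEmpty ℝ V (Fin 0) n
  intCast_ofNat n := by simp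
  intCast_negSucc_ofNat n := by
    ext v
    simp

instance : DirectSum.GAlgebra ℂ (AltForm V) where
  toFun :=
    { toFun := fun c => ContinuousAlternatingMap.constOfIsEmpty ℝ V (Fin 0) c
      map_zero' := by ext; simp
      map_add' := fun x y => by ext; simp }
  map_one := rfl
  map_mul r s := by
    refine gradedMonoid_mk_eq rfl fun v => ?_
    refine Eq.trans ?_ (congrArg (fun β : AltForm V 0 => β v) (wedge_one s _)).symm
    simp [mul_comm]
  commutes := by
    rintro r ⟨k, α⟩
    refine gradedMonoid_mk_eq ((zero_add k).trans (add_zero k).symm) fun v => ?_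
    refine (one_wedge r α _).trans ?_
    refine Eq.trans ?_ (congrArg (fun β : AltForm V k => β v) (wedge_one r _)).symm
    rw [ContinuousAlternatingMap.smul_apply, smul_eq_mul]
    congr 2
    ext i
    congr 1
    ext
    simp
  smul_def := by
    rintro r ⟨k, α⟩
    symm
    refine gradedMonoid_mk_eq (zero_add k) fun v => ?_
    refine (one_wedge r α _).trans ?_
    rw [ContinuousAlternatingMap.smul_apply, smul_eq_mul]
    congr 2
    ext i
    congr 1
    ext
    simp

/-- The exterior algebra of complex valued forms on `V`: the direct sum of the spaces of alternating
`k`-forms over all degrees `k`, with the wedge product as multiplication. -/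
def FormRing (V : Type*) [NormedAddCommGroup V] [NormedSpace ℝ V] : Type _ :=
  DirectSum ℕ (AltForm V)

instance : Ring (FormRing V) := inferInstanceAs (Ring (DirectSum ℕ (AltForm V)))

instance : Algebra ℂ (FormRing V) := inferInstanceAs (Algebra ℂ (DirectSum ℕ (AltForm V)))

/-- A form, as a homogeneous element of the exterior algebra. -/
def toRing {k : ℕ} (α : AltForm V k) : FormRing V := DirectSum.of (AltForm V) k α

@[elab_as_elim]
theorem FormRing.induction {P : FormRing V → Prop} (zero : P 0)
    (of : ∀ (k : ℕ) (α : AltForm V k), P (toRing α)) (add : ∀ x y, P x → P y → P (x + y))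
    (x : FormRing V) : P x :=
  DirectSum.induction_on (motive := P) x zero of add

theorem toRing_injective {k : ℕ} : Function.Injective (toRing : AltForm V k → FormRing V) :=
  DirectSum.of_injective (β := AltForm V) k

theorem toRing_inj {k : ℕ} {α β : AltForm V k} : toRing α = toRing β ↔ α = β :=
  toRing_injective.eq_iff

@[simp] theorem toRing_zero {k : ℕ} : toRing (0 : AltForm V k) = 0 :=
  map_zero (DirectSum.of (AltForm V) k)

theorem toRing_eq_zero {k : ℕ} {α : AltForm V k} : toRing α = 0 ↔ α = 0 := by
  rw [← toRing_inj, toRing_zero]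

theorem toRing_add {k : ℕ} (α β : AltForm V k) : toRing (α + β) = toRing α + toRing β :=
  map_add (DirectSum.of (AltForm V) k) _ _

theorem toRing_sum {ι : Type*} (s : Finset ι) {k : ℕ} (f : ι → AltForm V k) :
    toRing (∑ i ∈ s, f i) = ∑ i ∈ s, toRing (f i) :=
  map_sum (DirectSum.of (AltForm V) k) f s

theorem toRing_smul {k : ℕ} (c : ℂ) (α : AltForm V k) : toRing (c • α) = c • toRing α :=
  (DirectSum.lof ℂ ℕ (AltForm V) k).map_smul c α

theorem toRing_wedge {k l : ℕ} (α : AltForm V k) (β : AltForm V l) :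
    toRing (wedge α β) = toRing α * toRing β :=
  (DirectSum.of_mul_of α β).symm

theorem toRing_const (c : ℂ) :
    toRing (ContinuousAlternatingMap.constOfIsEmpty ℝ V (Fin 0) c : AltForm V 0) =
      algebraMap ℂ (FormRing V) c := rfl

theorem toRing_wedgePow (Ω : AltForm V 2) (m : ℕ) : toRing (wedgePow Ω m) = toRing Ω ^ m := by
  induction m with
  | zero => rw [pow_zero]; exact (toRing_const 1).trans (map_one _)
  | succ m ih => rw [pow_succ, ← ih]; exact toRing_wedge _ _

theorem toRing_eq_of_gradedMonoid_eq {k l : ℕ} {α : AltForm V k} {β : AltForm V l}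
    (h : GradedMonoid.mk (A := AltForm V) k α = GradedMonoid.mk (A := AltForm V) l β) :
    toRing α = toRing β :=
  DirectSum.of_eq_of_gradedMonoid_eq h

/-- Covectors anticommute with forms, up to the sign given by the degree. -/
theorem covector_mul (f : V →L[ℝ] ℂ) {k : ℕ} (α : AltForm V k) :
    toRing (covector f) * toRing α = (-1 : ℂ) ^ k • (toRing α * toRing (covector f)) := by
  rw [← toRing_wedge, ← toRing_wedge, ← toRing_smul]
  exact toRing_eq_of_gradedMonoid_eq (wedge_covector_anticomm f α)

theorem covector_mul_covector (f g : V →L[ℝ] ℂ) :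
    toRing (covector f) * toRing (covector g) = -(toRing (covector g) * toRing (covector f)) := by
  rw [covector_mul, pow_one]
  exact neg_one_smul ℂ _

theorem covector_mul_self (f : V →L[ℝ] ℂ) :
    toRing (covector f) * toRing (covector f) = 0 := by
  have h := covector_mul_covector f f
  have h2 : (2 : ℂ) • (toRing (covector f) * toRing (covector f)) = 0 := by
    rw [two_smul]
    nth_rewrite 1 [h]
    exact neg_add_cancel _
  exact (smul_eq_zero.mp h2).resolve_left two_ne_zero

/-- Antisymmetrizing `v ↦ f(v) α` gives the wedge product of `f` with `α`. -/
theorem toRing_alternatizeUncurryFin_smulRight (f : V →L[ℝ] ℂ) {k : ℕ} (α : AltForm V k)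
    (A : V →L[ℝ] AltForm V k) (hA : ∀ v, A v = f v • α) :
    toRing (ContinuousAlternatingMap.alternatizeUncurryFin A : AltForm V (k + 1)) =
      toRing (covector f) * toRing α := by
  rw [← toRing_wedge]
  symm
  refine toRing_eq_of_gradedMonoid_eq (gradedMonoid_mk_eq (add_comm 1 k) fun v => ?_)
  rw [covector_wedge_apply, ContinuousAlternatingMap.alternatizeUncurryFin_apply]
  refine Finset.sum_congr rfl fun i _ => ?_
  rw [zsmul_eq_mul, hA]
  push_cast
  rfl

/-- The coordinate functionals of a basis, complex valued. -/
def coordC [FiniteDimensional ℝ V] {ι : Type*} [Fintype ι] (e : Module.Basis ι ℝ V) (i : ι) :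
    V →L[ℝ] ℂ :=
  Complex.ofRealCLM ∘L (e.coord i).toContinuousLinearMap

/-- Antisymmetrization in terms of a basis. -/
theorem toRing_alternatizeUncurryFin [FiniteDimensional ℝ V] {ι : Type*} [Fintype ι]
    (e : Module.Basis ι ℝ V) {k : ℕ} (A : V →L[ℝ] AltForm V k) :
    toRing (ContinuousAlternatingMap.alternatizeUncurryFin A : AltForm V (k + 1)) =
      ∑ i, toRing (covector (coordC e i)) * toRing (A (e i)) := by
  have hA : A = ∑ i, ((e.coord i).toContinuousLinearMap).smulRight (A (e i)) := by
    ext v : 1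
    conv_lhs => rw [← e.sum_repr v, map_sum]
    simp
  have h : (ContinuousAlternatingMap.alternatizeUncurryFin A : AltForm V (k + 1)) =
      ∑ i, (ContinuousAlternatingMap.alternatizeUncurryFin
        (((e.coord i).toContinuousLinearMap).smulRight (A (e i))) : AltForm V (k + 1)) := by
    conv_lhs => rw [hA]
    exact map_sum (ContinuousAlternatingMap.alternatizeUncurryFinCLM ℝ V ℂ (n := k)) _ _
  rw [h, toRing_sum]
  refine Finset.sum_congr rfl fun i _ => ?_
  refine toRing_alternatizeUncurryFin_smulRight _ _ _ fun v => ?_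
  ext w
  simp [coordC]

/-- Every form of positive degree is a combination of products with covectors. -/
theorem toRing_eq_sum_covector_mul [FiniteDimensional ℝ V] {ι : Type*} [Fintype ι]
    (e : Module.Basis ι ℝ V) {k : ℕ} (α : AltForm V (k + 1)) :
    ((k + 1 : ℕ) : ℂ) • toRing α =
      ∑ i, toRing (covector (coordC e i)) * toRing (α.curryLeft (e i) : AltForm V k) := by
  rw [← toRing_alternatizeUncurryFin, ContinuousAlternatingMap.alternatizeUncurryFin_curryLeft,
    ← toRing_smul]
  congr 1
  ext v
  simp

theorem covector_add_smul (f g : V →L[ℝ] ℂ) (c : ℂ) :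
    toRing (covector (f + c • g)) = toRing (covector f) + c • toRing (covector g) := by
  rw [← toRing_smul, ← toRing_add]
  rfl

theorem covector_surjective (α : AltForm V 1) : ∃ f, covector f = α :=
  (ContinuousAlternatingMap.ofSubsingleton ℝ V ℂ (0 : Fin 1)).surjective α

/-- Forms of degree two commute with all forms. -/
theorem commute_toRing_two [FiniteDimensional ℝ V] (Ω : AltForm V 2) {k : ℕ} (α : AltForm V k) :
    Commute (toRing Ω) (toRing α) := by
  set e := Module.finBasis ℝ V
  have h := toRing_eq_sum_covector_mul e Ω
  have key : Commute (((1 + 1 : ℕ) : ℂ) • toRing Ω) (toRing α) := by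
    rw [h]
    refine Commute.sum_left _ _ _ fun i _ => ?_
    obtain ⟨f, hf⟩ := covector_surjective (Ω.curryLeft (e i) : AltForm V 1)
    rw [← hf]
    -- moving `α` past two covectors gives the sign `(-1) ^ k` twice
    change _ * _ * _ = _ * (_ * _)
    rw [mul_assoc, covector_mul, mul_smul_comm, ← mul_assoc, covector_mul, smul_mul_assoc, smul_smul,
      ← mul_pow, neg_one_mul, neg_neg, one_pow, one_smul, mul_assoc]
  have h2 := key.smul_left (((1 + 1 : ℕ) : ℂ)⁻¹)
  rwa [smul_smul, inv_mul_cancel₀ (by norm_num), one_smul] at h2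

theorem toRing_two_mem_center [FiniteDimensional ℝ V] (Ω : AltForm V 2) :
    toRing Ω ∈ Subalgebra.center ℂ (FormRing V) := by
  rw [Subalgebra.mem_center_iff]
  intro x
  induction x using FormRing.induction with
  | zero => rw [zero_mul, mul_zero]
  | of k α => exact ((commute_toRing_two Ω α).eq).symm
  | add x y hx hy => rw [add_mul, mul_add, hx, hy]

/-- Forms of degree above the dimension vanish. -/
theorem altForm_eq_zero_of_finrank_lt [FiniteDimensional ℝ V] {k : ℕ}
    (hk : Module.finrank ℝ V < k) (α : AltForm V k) : α = 0 := by
  ext v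
  refine α.toAlternatingMap.map_linearDependent v fun h => ?_
  have := h.fintype_card_le_finrank
  rw [Fintype.card_fin] at this
  omega

theorem toRing_pow_eq_zero [FiniteDimensional ℝ V] {m : ℕ} (hm : Module.finrank ℝ V < 2 * m)
    (Ω : AltForm V 2) : toRing Ω ^ m = 0 := by
  rw [← toRing_wedgePow, altForm_eq_zero_of_finrank_lt hm (wedgePow Ω m), toRing_zero]

variable {W : Type*} [NormedAddCommGroup W] [NormedSpace ℝ W]

theorem wedge_comp (L : W →L[ℝ] V) {k l : ℕ} (α : AltForm V k) (β : AltForm V l) :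
    (wedge α β).compContinuousLinearMap L =
      wedge (α.compContinuousLinearMap L) (β.compContinuousLinearMap L) := by
  ext v
  rw [wedge_apply, ContinuousAlternatingMap.compContinuousLinearMap_apply, wedge_apply]
  rfl

/-- Pullback of forms under a linear map, as a homomorphism of exterior algebras. -/
def pull (L : W →L[ℝ] V) : FormRing V →+* FormRing W :=
  DirectSum.toSemiring (A := AltForm V) (R := FormRing W)
    (fun k => (DirectSum.of (AltForm W) k : AltForm W k →+ FormRing W).comp
      ((ContinuousAlternatingMap.compContinuousLinearMapₗ (R := ℝ) (N := ℂ) (ι := Fin k)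
        L).toAddMonoidHom))
    (by
      change toRing _ = _
      refine Eq.trans ?_ ((toRing_const (V := W) 1).trans (map_one _))
      congr 1)
    (by
      intro i j α β
      exact (congrArg toRing (wedge_comp L α β)).trans (toRing_wedge _ _))

theorem pull_toRing (L : W →L[ℝ] V) {k : ℕ} (α : AltForm V k) :
    pull L (toRing α) = toRing (α.compContinuousLinearMap L : AltForm W k) := by
  exact DirectSum.toSemiring_of _ _ _ _ _

theorem pull_smul (L : W →L[ℝ] V) (c : ℂ) (x : FormRing V) : pull L (c • x) = c • pull L x := by
  induction x using FormRing.induction with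
  | zero => simp
  | of k α =>
    rw [← toRing_smul, pull_toRing, pull_toRing, ← toRing_smul]
    rfl
  | add x y hx hy => rw [smul_add, map_add, map_add, hx, hy, smul_add]

end ExteriorRing

/-! ### Forms of type `(p, q)` -/

section Types

variable {V : Type*} [NormedAddCommGroup V] [NormedSpace ℝ V]

/-- The operator `c + s J`, the real form of multiplication by the complex number `c + √-1 s`. -/
def complexScale (J : V →L[ℝ] V) (c s : ℝ) : V →L[ℝ] V := c • ContinuousLinearMap.id ℝ V + s • J

@[simp] theorem complexScale_apply (J : V →L[ℝ] V) (c s : ℝ) (v : V) :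
    complexScale J c s v = c • v + s • J v := by
  simp [complexScale]

theorem typePart_apply (J : V →L[ℝ] V) {k : ℕ} (p : ℕ) (α : AltForm V k) (v : Fin k → V) :
    typePart J p α v =
      ∑ S ∈ Finset.powersetCard p (Finset.univ : Finset (Fin k)), typeSlots J S α v := by
  change (∑ S ∈ Finset.powersetCard p (Finset.univ : Finset (Fin k)), typeSlots J S α) v = _
  rw [sum_apply]

/-- The pullback of a form under `c + s J` weights its component of type `(p, q)` by
`z ^ p z̄ ^ q`, where `z = c + √-1 s`. -/
theorem comp_complexScale (J : V →L[ℝ] V) (c s : ℝ) {k : ℕ} (α : AltForm V k) (v : Fin k → V) :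
    α (fun i => complexScale J c s (v i)) =
      ∑ p ∈ Finset.range (k + 1), ((c + s * Complex.I : ℂ) ^ p * (c - s * Complex.I : ℂ) ^ (k - p)) *
        typePart J p α v := by
  set z : ℂ := c + s * Complex.I with hz
  set w : ℂ := c - s * Complex.I with hw
  have h1 : ∑ p ∈ Finset.range (k + 1), (z ^ p * w ^ (k - p)) * typePart J p α v =
      ∑ S : Finset (Fin k), (z ^ S.card * w ^ (k - S.card)) * typeSlots J S α v := by
    rw [← Finset.powerset_univ, Finset.sum_powerset, Finset.card_univ, Fintype.card_fin]
    refine Finset.sum_congr rfl fun p _ => ?_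
    rw [typePart_apply, Finset.mul_sum]
    refine Finset.sum_congr rfl fun S hS => ?_
    rw [(Finset.mem_powersetCard.mp hS).2]
  -- expanding `∏ᵢ ((∓ √-1) z / 2 + (± √-1) w / 2)` over the subsets `S`, with the signs given by `T`
  have h2 : ∀ T : Finset (Fin k), ∑ S : Finset (Fin k), (z ^ S.card * w ^ (k - S.card)) *
      ((1 / 2 : ℂ) ^ k * ∏ i ∈ T, if i ∈ S then -Complex.I else Complex.I) =
      s ^ T.card * c ^ (k - T.card) := by
    intro T
    have hprod := Finset.prod_add (fun i : Fin k => (if i ∈ T then -Complex.I else 1) * (z / 2))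
      (fun i : Fin k => (if i ∈ T then Complex.I else 1) * (w / 2)) Finset.univ
    have hl : ∀ i : Fin k, (if i ∈ T then -Complex.I else 1) * (z / 2) +
        (if i ∈ T then Complex.I else 1) * (w / 2) = if i ∈ T then (s : ℂ) else c := by
      intro i
      have hI := Complex.I_mul_I
      split_ifs
      · rw [hz, hw]; linear_combination (-(s : ℂ)) * hI
      · rw [hz, hw]; ring
    simp only [hl] at hprod
    rw [Finset.prod_ite, Finset.prod_const, Finset.prod_const, Finset.filter_mem_eq_inter,
      Finset.univ_inter, Finset.filter_notMem_eq_sdiff, Finset.card_univ_sdiff, Fintype.card_fin,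
      Finset.powerset_univ] at hprod
    rw [hprod]
    refine Finset.sum_congr rfl fun S _ => ?_
    rw [Finset.prod_mul_distrib, Finset.prod_mul_distrib, Finset.prod_const, Finset.prod_const,
      Finset.card_univ_sdiff, Fintype.card_fin]
    have hc : S.card ≤ k := by simpa using Finset.card_le_univ S
    have h2k : (1 / 2 : ℂ) ^ k = (1 / 2) ^ S.card * (1 / 2) ^ (k - S.card) := by
      rw [← pow_add, Nat.add_sub_cancel' hc]
    have hT : ∏ i ∈ T, (if i ∈ S then -Complex.I else Complex.I) =
        (∏ i ∈ S, if i ∈ T then -Complex.I else 1) *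
          ∏ i ∈ Finset.univ \ S, if i ∈ T then Complex.I else 1 := by
      rw [Finset.prod_ite_mem, Finset.prod_ite_mem, Finset.prod_ite, Finset.inter_comm S T,
        Finset.filter_mem_eq_inter]
      congr 2
      ext i
      simp [and_comm]
    rw [hT, h2k]
    simp only [div_eq_mul_inv, mul_pow]
    ring
  rw [h1]
  simp only [typeSlots_apply, complexScale_apply]
  have hadd := α.map_add_univ (fun i => s • J (v i)) (fun i => c • v i)
  rw [show (fun i => c • v i + s • J (v i)) = (fun i => s • J (v i)) + fun i => c • v i by
    ext i; simp [add_comm], hadd]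
  have hpw : ∀ T : Finset (Fin k), α (T.piecewise (fun i => s • J (v i)) fun i => c • v i) =
      ((s : ℂ) ^ T.card * c ^ (k - T.card)) * α (fun i => if i ∈ T then J (v i) else v i) := by
    intro T
    have := α.map_smul_univ (fun i => if i ∈ T then s else c)
      (fun i => if i ∈ T then J (v i) else v i)
    rw [Finset.prod_ite, Finset.prod_const, Finset.prod_const, Finset.filter_mem_eq_inter,
      Finset.univ_inter, Finset.filter_notMem_eq_sdiff, Finset.card_univ_sdiff, Fintype.card_fin] at this
    rw [Complex.real_smul] at this
    push_cast at this
    rw [← this]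
    congr 1
    ext i
    by_cases hi : i ∈ T <;> simp [hi]
  simp only [hpw, ← h2, Finset.sum_mul]
  rw [Finset.sum_comm]
  refine Finset.sum_congr rfl fun S _ => ?_
  rw [Finset.mul_sum, Finset.mul_sum]
  refine Finset.sum_congr rfl fun T _ => ?_
  ring

/-- Coefficients of a homogeneous polynomial in `z` and `z̄` are determined by its values: after
division by `z̄ ^ k` it is a polynomial in `z / z̄`, which takes infinitely many values. -/
theorem eq_zero_of_sum_pow_conj (k : ℕ) (b : ℕ → ℂ)
    (h : ∀ c s : ℝ, ∑ p ∈ Finset.range (k + 1),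
      ((c + s * Complex.I : ℂ) ^ p * (c - s * Complex.I : ℂ) ^ (k - p)) * b p = 0) :
    ∀ p ∈ Finset.range (k + 1), b p = 0 := by
  set P : Polynomial ℂ := ∑ p ∈ Finset.range (k + 1), Polynomial.C (b p) * Polynomial.X ^ p with hP
  have hroot : ∀ s : ℝ, P.eval ((1 + s * Complex.I) / (1 - s * Complex.I)) = 0 := by
    intro s
    have hne : (1 - s * Complex.I : ℂ) ≠ 0 := by
      intro h0
      have := congrArg Complex.re h0
      simp at this
    have := h 1 s
    rw [hP, Polynomial.eval_finsetSum]
    have h2 : (1 - s * Complex.I : ℂ) ^ k * ∑ p ∈ Finset.range (k + 1), Polynomial.eval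
        ((1 + s * Complex.I) / (1 - s * Complex.I)) (Polynomial.C (b p) * Polynomial.X ^ p) = 0 := by
      rw [← this, Finset.mul_sum]
      refine Finset.sum_congr rfl fun p hp => ?_
      have hpk : p ≤ k := by simpa [Nat.lt_succ_iff] using hp
      rw [Polynomial.eval_mul, Polynomial.eval_C, Polynomial.eval_pow, Polynomial.eval_X, div_pow,
        ← Nat.add_sub_cancel' hpk, pow_add, Nat.add_sub_cancel_left]
      push_cast
      field_simp
    exact (mul_eq_zero.mp h2).resolve_left (pow_ne_zero _ hne)
  have hP0 : P = 0 := by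
    refine P.eq_zero_of_infinite_isRoot (Set.Infinite.mono (s := Set.range fun s : ℝ =>
      ((1 + s * Complex.I) / (1 - s * Complex.I) : ℂ)) ?_ (Set.infinite_range_of_injective ?_))
    · rintro _ ⟨s, rfl⟩
      exact hroot s
    · intro s s' hs
      have hne : ∀ s : ℝ, (1 - s * Complex.I : ℂ) ≠ 0 := by
        intro s h0
        have := congrArg Complex.re h0
        simp at this
      have hs' : (1 + s * Complex.I : ℂ) / (1 - s * Complex.I) =
        (1 + s' * Complex.I) / (1 - s' * Complex.I) := hs
      rw [div_eq_div_iff (hne s) (hne s')] at hs'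
      have := congrArg Complex.im hs'
      simp at this
      linarith
  intro p hp
  have := congrArg (fun Q => Q.coeff p) hP0
  simp only [hP, Polynomial.finsetSum_coeff, Polynomial.coeff_C_mul, Polynomial.coeff_X_pow,
    Polynomial.coeff_zero] at this
  rw [Finset.sum_eq_single p] at this
  · simpa using this
  · intro q _ hq
    simp [hq.symm]
  · intro h0
    exact absurd hp h0

theorem typePart_eq_zero_of_lt (J : V →L[ℝ] V) {k p : ℕ} (hp : k < p) (α : AltForm V k) :
    typePart J p α = 0 := by
  ext v
  rw [typePart_apply, Finset.powersetCard_eq_empty.2 (by simpa using hp)]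
  simp

/-- An element of the exterior algebra has type `(p, q)` if the pullback under `c + s J` multiplies
it by `z ^ p z̄ ^ q`, where `z = c + √-1 s`. In contrast to a definition through `typePart`, this is
visibly compatible with products. -/
def HasType (J : V →L[ℝ] V) (p q : ℕ) (x : FormRing V) : Prop :=
  ∀ c s : ℝ, pull (complexScale J c s) x =
    ((c + s * Complex.I : ℂ) ^ p * (c - s * Complex.I : ℂ) ^ q) • x

namespace HasType

variable {J : V →L[ℝ] V} {p q p' q' : ℕ} {x y : FormRing V}

theorem mul (hx : HasType J p q x) (hy : HasType J p' q' y) :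
    HasType J (p + p') (q + q') (x * y) := by
  intro c s
  rw [map_mul, hx c s, hy c s, smul_mul_smul_comm, pow_add, pow_add]
  congr 1
  ring

theorem one : HasType J 0 0 (1 : FormRing V) := by
  intro c s
  simp

theorem pow (hx : HasType J p q x) (m : ℕ) : HasType J (m * p) (m * q) (x ^ m) := by
  induction m with
  | zero => simpa using one
  | succ m ih =>
    rw [pow_succ, Nat.succ_mul, Nat.succ_mul]
    exact ih.mul hx

theorem add (hx : HasType J p q x) (hy : HasType J p q y) : HasType J p q (x + y) := by
  intro c s
  rw [map_add, hx c s, hy c s, smul_add]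

theorem smul (hx : HasType J p q x) (c : ℂ) : HasType J p q (c • x) := by
  intro c' s
  rw [pull_smul, hx c' s, smul_comm]

/-- A form of type `(p, q)` is its own component of that type, and its other components vanish. -/
theorem typePart_eq {k : ℕ} {α : AltForm V k} (h : HasType J p q (toRing α)) (hk : p + q = k)
    (r : ℕ) : typePart J r α = if r = p then α else 0 := by
  rcases lt_or_ge k r with hr | hr
  · rw [typePart_eq_zero_of_lt J hr, if_neg (by omega)]
  ext v
  have hα : ∀ c s : ℝ, α (fun i => complexScale J c s (v i)) =
      ((c + s * Complex.I : ℂ) ^ p * (c - s * Complex.I : ℂ) ^ q) * α v := by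
    intro c s
    have := h c s
    rw [pull_toRing, ← toRing_smul] at this
    exact congrArg (fun β : AltForm V k => β v) (toRing_injective this)
  have := eq_zero_of_sum_pow_conj k (fun r => typePart J r α v - if r = p then α v else 0)
    (fun c s => by
      simp only [mul_sub]
      rw [Finset.sum_sub_distrib, ← comp_complexScale, hα]
      simp only [mul_ite, mul_zero]
      rw [Finset.sum_ite_eq', if_pos (by simp; omega), show k - p = q by omega, sub_self])
    r (by simp; omega)
  rw [sub_eq_zero.mp this]
  split_ifs <;> rfl

end HasType

theorem typePart_add (J : V →L[ℝ] V) {k : ℕ} (p : ℕ) (α β : AltForm V k) :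
    typePart J p (α + β) = typePart J p α + typePart J p β := by
  ext v
  simp only [typePart_apply, typeSlots_apply, ContinuousAlternatingMap.add_apply, mul_add,
    Finset.sum_add_distrib]

theorem typePart_zero (J : V →L[ℝ] V) {k : ℕ} (p : ℕ) : typePart J p (0 : AltForm V k) = 0 := by
  ext v
  simp [typePart_apply, typeSlots_apply]

/-- The component of a sum of two forms of different pure types. -/
theorem HasType.typePart_add_eq {J : V →L[ℝ] V} {k p q p' q' : ℕ} (hk : p + q = k)
    (hk' : p' + q' = k) (hp : p' ≠ p) {α β β' : AltForm V k}
    (hα : toRing α = toRing β + toRing β') (hβ : HasType J p q (toRing β))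
    (hβ' : HasType J p' q' (toRing β')) : typePart J p α = β := by
  rw [← toRing_add] at hα
  rw [toRing_injective hα, typePart_add, hβ.typePart_eq hk, hβ'.typePart_eq hk', if_pos rfl,
    if_neg hp.symm, add_zero]

theorem hasType_covector {J : V →L[ℝ] V} {p q : ℕ} {f : V →L[ℝ] ℂ}
    (h : ∀ (c s : ℝ) (v : V), f (complexScale J c s v) =
      ((c + s * Complex.I : ℂ) ^ p * (c - s * Complex.I : ℂ) ^ q) * f v) :
    HasType J p q (toRing (covector f)) := by
  intro c s
  rw [pull_toRing, ← toRing_smul]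
  congr 1
  ext v
  exact h c s (v 0)

theorem hasType_one_zero {J : V →L[ℝ] V} {f : V →L[ℝ] ℂ} (h : ∀ v, f (J v) = Complex.I * f v) :
    HasType J 1 0 (toRing (covector f)) := by
  refine hasType_covector fun c s v => ?_
  rw [complexScale_apply, map_add, map_smul, map_smul, h, Complex.real_smul, Complex.real_smul]
  ring

theorem hasType_zero_one {J : V →L[ℝ] V} {f : V →L[ℝ] ℂ} (h : ∀ v, f (J v) = -Complex.I * f v) :
    HasType J 0 1 (toRing (covector f)) := by
  refine hasType_covector fun c s v => ?_
  rw [complexScale_apply, map_add, map_smul, map_smul, h, Complex.real_smul, Complex.real_smul]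
  ring

/-- `J`-invariant `2`-forms have type `(1, 1)`. -/
theorem hasType_two {J : V →L[ℝ] V} (hJ : ∀ v, J (J v) = -v) {Ω : AltForm V 2}
    (h : ∀ v w : V, Ω ![J v, J w] = Ω ![v, w]) : HasType J 1 1 (toRing Ω) := by
  intro c s
  rw [pull_toRing, ← toRing_smul]
  congr 1
  ext v
  have e : ∀ w : Fin 2 → V, Ω w = Ω ![w 0, w 1] := fun w => by
    congr 1; ext i; fin_cases i <;> rfl
  have hadd0 : ∀ x y z : V, Ω ![x + y, z] = Ω ![x, z] + Ω ![y, z] := fun x y z =>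
    Ω.vecCons_add ![z] x y
  have hsmul0 : ∀ (r : ℝ) (x z : V), Ω ![r • x, z] = r * Ω ![x, z] := fun r x z =>
    (Ω.vecCons_smul ![z] r x).trans Complex.real_smul
  have hsw : ∀ x y : V, Ω ![x, y] = -Ω ![y, x] := fun x y => by
    have := Ω.toAlternatingMap.map_swap ![y, x] (i := 0) (j := 1) (by decide)
    rw [← show (![x, y] : Fin 2 → V) = ![y, x] ∘ Equiv.swap 0 1 by ext i; fin_cases i <;> rfl]
      at this
    exact this
  have hadd1 : ∀ x y z : V, Ω ![z, x + y] = Ω ![z, x] + Ω ![z, y] := fun x y z => by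
    rw [hsw, hadd0, hsw x, hsw y]; ring
  have hsmul1 : ∀ (r : ℝ) (x z : V), Ω ![z, r • x] = r * Ω ![z, x] := fun r x z => by
    rw [hsw, hsmul0, hsw x]; ring
  rw [ContinuousAlternatingMap.compContinuousLinearMap_apply, ContinuousAlternatingMap.smul_apply,
    e, e v]
  simp only [Function.comp_apply, complexScale_apply, smul_eq_mul, hadd0, hadd1, hsmul0, hsmul1, h]
  have hx : Ω ![J (v 0), v 1] = -Ω ![v 0, J (v 1)] := by
    rw [← h (J (v 0)) (v 1), hJ]
    have := hsmul0 (-1) (v 0) (J (v 1))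
    simpa using this
  rw [hx]
  linear_combination ((s : ℂ) ^ 2 * Ω ![v 0, v 1]) * Complex.I_sq

end Types

/-! ### Products in top degree -/

section TopDegree

variable {R : Type*} [CommRing R]

theorem add_pow_of_sq_eq_zero {x e : R} (he : e * e = 0) (m : ℕ) :
    (x + e) ^ m = x ^ m + m * e * x ^ (m - 1) := by
  induction m with
  | zero => simp
  | succ m ih =>
    rw [pow_succ, ih]
    rcases m with _ | m
    · simp
    · simp only [Nat.add_sub_cancel]
      push_cast
      linear_combination ((m + 1 : R) * x ^ m) * he

/-- Above top degree everything vanishes. -/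
theorem pow_mul_pow_mul_add_pow_eq_zero {n₁ n₂ i j M : ℕ} {x y : R} (hx : x ^ (n₁ + 1) = 0)
    (hy : y ^ (n₂ + 1) = 0) (h : n₁ + n₂ < i + j + M) : x ^ i * y ^ j * (x + y) ^ M = 0 := by
  rw [add_pow, Finset.mul_sum]
  refine Finset.sum_eq_zero fun k hk => ?_
  have hk : k ≤ M := by simpa [Nat.lt_succ_iff] using hk
  have : x ^ i * y ^ j * (x ^ k * y ^ (M - k) * (M.choose k : R)) =
      x ^ (i + k) * y ^ (j + (M - k)) * (M.choose k : R) := by ring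
  rw [this]
  rcases lt_or_ge n₁ (i + k) with h1 | h1
  · rw [pow_eq_zero_of_le h1 hx, zero_mul, zero_mul]
  · rw [pow_eq_zero_of_le (show n₂ + 1 ≤ j + (M - k) by omega) hy, mul_zero, zero_mul]

/-- In top degree `i + j + M = n₁ + n₂` only the term `x ^ n₁ y ^ n₂` of the binomial expansion survives. -/
theorem pow_mul_pow_mul_add_pow {n₁ n₂ i j M : ℕ} {x y : R} (hx : x ^ (n₁ + 1) = 0)
    (hy : y ^ (n₂ + 1) = 0) (h : i + j + M = n₁ + n₂) :
    (n₁.factorial * n₂.factorial : R) * (x ^ i * y ^ j * (x + y) ^ M) =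
      (M.factorial * n₁.descFactorial i * n₂.descFactorial j : R) * (x ^ n₁ * y ^ n₂) := by
  rcases lt_or_ge n₁ i with hi | hi
  · rw [pow_eq_zero_of_le hi hx, Nat.descFactorial_eq_zero_iff_lt.2 hi]
    simp
  rcases lt_or_ge n₂ j with hj | hj
  · rw [pow_eq_zero_of_le hj hy, Nat.descFactorial_eq_zero_iff_lt.2 hj]
    simp
  have hsum : x ^ i * y ^ j * (x + y) ^ M = (M.choose (n₁ - i) : R) * (x ^ n₁ * y ^ n₂) := by
    rw [add_pow, Finset.mul_sum, Finset.sum_eq_single (n₁ - i)]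
    · rw [show x ^ n₁ = x ^ i * x ^ (n₁ - i) by rw [← pow_add, Nat.add_sub_cancel' hi],
        show y ^ n₂ = y ^ j * y ^ (M - (n₁ - i)) by
          rw [← pow_add, show j + (M - (n₁ - i)) = n₂ by omega]]
      ring
    · intro k hk hne
      have hk : k ≤ M := by simpa [Nat.lt_succ_iff] using hk
      have : x ^ i * y ^ j * (x ^ k * y ^ (M - k) * (M.choose k : R)) =
        x ^ (i + k) * y ^ (j + (M - k)) * (M.choose k : R) := by ring
      rw [this]
      rcases lt_or_ge n₁ (i + k) with h1 | h1
      · rw [pow_eq_zero_of_le h1 hx, zero_mul, zero_mul]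
      · rw [pow_eq_zero_of_le (show n₂ + 1 ≤ j + (M - k) by omega) hy, mul_zero, zero_mul]
    · intro hk
      simp at hk
      omega
  have hfac : n₁.factorial * n₂.factorial * M.choose (n₁ - i) =
      M.factorial * n₁.descFactorial i * n₂.descFactorial j := by
    rw [← Nat.factorial_mul_descFactorial hi, ← Nat.factorial_mul_descFactorial hj,
      ← Nat.choose_mul_factorial_mul_factorial (show n₁ - i ≤ M by omega),
      show M - (n₁ - i) = n₂ - j by omega]
    ring
  have hfac' := congrArg (Nat.cast : ℕ → R) hfac
  push_cast at hfac'
  rw [hsum]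
  linear_combination (x ^ n₁ * y ^ n₂) * hfac'

theorem descFactorial_two_cast (n : ℕ) : (n.descFactorial 2 : ℂ) = n * (n - 1) := by
  rcases n with _ | n
  · simp
  · simp [Nat.descFactorial_succ, mul_comm]

/-- The numerical criterion: in an algebra with `x ^ (n₁ + 1) = 0`,
`y ^ (n₂ + 1) = 0`, `e ^ 2 = 0` in which `(x + y + t e) ^ (n₁ + n₂ + 1)` does not vanish, the
top degree products with `x² + 2 a x y + q y²` vanish exactly if
`n₁ (n₁ - 1) + 2 a n₁ n₂ + q n₂ (n₂ - 1) = 0`. -/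
theorem quadratic_mul_pow_eq_zero_iff [Algebra ℂ R] {n₁ n₂ : ℕ} (hN : 2 ≤ n₁ + n₂) {x y e : R}
    (a q t : ℂ) (hx : x ^ (n₁ + 1) = 0) (hy : y ^ (n₂ + 1) = 0) (he : e * e = 0)
    (hΩ : (x + y + t • e) ^ (n₁ + n₂ + 1) ≠ 0) :
    ((x ^ 2 + (2 * a) • (x * y) + q • y ^ 2) * (x + y) ^ (n₁ + n₂ - 2) = 0 ↔
      (n₁ * (n₁ - 1) + 2 * a * n₁ * n₂ + q * (n₂ * (n₂ - 1)) : ℂ) = 0) ∧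
    ((x ^ 2 + (2 * a) • (x * y) + q • y ^ 2) * (x + y + t • e) ^ (n₁ + n₂ - 1) = 0 ↔
      (n₁ * (n₁ - 1) + 2 * a * n₁ * n₂ + q * (n₂ * (n₂ - 1)) : ℂ) = 0) := by
  set lam : ℂ := n₁ * (n₁ - 1) + 2 * a * n₁ * n₂ + q * (n₂ * (n₂ - 1)) with hlam
  set N := n₁ + n₂ with hNdef
  set S : R := x ^ 2 + (2 * a) • (x * y) + q • y ^ 2 with hS
  set T : R := x ^ n₁ * y ^ n₂ with hT
  have hte : (t • e) * (t • e) = 0 := by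
    rw [smul_mul_smul_comm, he, smul_zero]
  have hf : (n₁.factorial * n₂.factorial : ℂ) ≠ 0 := by
    exact_mod_cast (Nat.mul_pos n₁.factorial_pos n₂.factorial_pos).ne'
  have cancel : ∀ z : R, (n₁.factorial * n₂.factorial : R) * z =
      (n₁.factorial * n₂.factorial : ℂ) • z := by
    intro z
    rw [Algebra.smul_def]
    simp
  -- products in top degree are multiples of `x ^ n₁ y ^ n₂`
  have hFN : (x + y) ^ N = ((n₁.factorial * n₂.factorial : ℂ)⁻¹ * N.factorial) • T := by
    have := pow_mul_pow_mul_add_pow (i := 0) (j := 0) (M := N) hx hy (by omega)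
    rw [cancel] at this
    simp only [pow_zero, one_mul, Nat.descFactorial_zero, Nat.cast_one, mul_one] at this
    rw [← map_natCast (algebraMap ℂ R) N.factorial, ← Algebra.smul_def] at this
    rw [mul_smul, ← this, smul_smul, inv_mul_cancel₀ hf, one_smul]
  have hFS : (n₁.factorial * n₂.factorial : ℂ) • (S * (x + y) ^ (N - 2)) =
      (((N - 2).factorial : ℂ) * lam) • T := by
    have h20 := pow_mul_pow_mul_add_pow (i := 2) (j := 0) (M := N - 2) hx hy (by omega)
    have h11 := pow_mul_pow_mul_add_pow (i := 1) (j := 1) (M := N - 2) hx hy (by omega)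
    have h02 := pow_mul_pow_mul_add_pow (i := 0) (j := 2) (M := N - 2) hx hy (by omega)
    simp only [pow_zero, one_mul, mul_one, pow_one, Nat.descFactorial_zero, Nat.cast_one,
      Nat.descFactorial_one, ← map_natCast (algebraMap ℂ R), descFactorial_two_cast] at h20 h11 h02
    rw [hS, hlam]
    simp only [Algebra.smul_def, map_mul, map_add, map_one] at *
    linear_combination h20 + 2 * algebraMap ℂ R a * h11 + algebraMap ℂ R q * h02 +
      (algebraMap ℂ R (n₁.factorial) * algebraMap ℂ R (n₂.factorial) * algebraMap ℂ R a * x * y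
        * (x + y) ^ (N - 2) - algebraMap ℂ R ((N - 2).factorial) * algebraMap ℂ R a *
          algebraMap ℂ R n₁ * algebraMap ℂ R n₂ * T) * (map_ofNat (algebraMap ℂ R) 2)
  have hFN1 : (x + y) ^ (N + 1) = 0 := by
    have := pow_mul_pow_mul_add_pow_eq_zero (i := 0) (j := 0) (M := N + 1) hx hy (by omega)
    simpa using this
  have hFS1 : S * (x + y) ^ (N - 1) = 0 := by
    have h20 := pow_mul_pow_mul_add_pow_eq_zero (i := 2) (j := 0) (M := N - 1) hx hy (by omega)
    have h11 := pow_mul_pow_mul_add_pow_eq_zero (i := 1) (j := 1) (M := N - 1) hx hy (by omega)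
    have h02 := pow_mul_pow_mul_add_pow_eq_zero (i := 0) (j := 2) (M := N - 1) hx hy (by omega)
    rw [hS]
    simp only [Algebra.smul_def]
    linear_combination h20 + algebraMap ℂ R (2 * a) * h11 + algebraMap ℂ R q * h02
  have hΩN : (x + y + t • e) ^ (N + 1) =
      (((N + 1 : ℕ) : ℂ) * t * ((n₁.factorial * n₂.factorial : ℂ)⁻¹ * N.factorial)) • (e * T) := by
    rw [add_pow_of_sq_eq_zero hte, hFN1, zero_add, Nat.add_sub_cancel, hFN]
    simp only [Algebra.smul_def, map_mul, map_natCast]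
    ring
  rw [hΩN] at hΩ
  have hΩ' := smul_ne_zero_iff.mp hΩ
  have hT0 : T ≠ 0 := fun h => hΩ'.2 (by rw [h, mul_zero])
  have ht : t ≠ 0 := fun h => hΩ'.1 (by rw [h]; ring)
  have hfac : ((N - 2).factorial : ℂ) ≠ 0 := by exact_mod_cast (N - 2).factorial_ne_zero
  constructor
  · rw [← smul_eq_zero_iff_right hf, hFS, smul_eq_zero_iff_left hT0, mul_eq_zero]
    simp [hfac]
  · have h1 : (n₁.factorial * n₂.factorial : ℂ) • (S * (x + y + t • e) ^ (N - 1)) =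
        (((N - 1 : ℕ) : ℂ) * t * ((N - 2).factorial * lam)) • (e * T) := by
      rw [add_pow_of_sq_eq_zero hte, mul_add, hFS1, zero_add, show N - 1 - 1 = N - 2 by omega]
      calc _ = (((N - 1 : ℕ) : ℂ) * t) • (e * ((n₁.factorial * n₂.factorial : ℂ) •
            (S * (x + y) ^ (N - 2)))) := by
            simp only [Algebra.smul_def, map_mul, map_natCast]
            ring
        _ = _ := by
            rw [hFS, mul_smul_comm, smul_smul]
    have hN1 : ((N - 1 : ℕ) : ℂ) ≠ 0 := by
      exact_mod_cast (show N - 1 ≠ 0 by omega)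
    rw [← smul_eq_zero_iff_right hf, h1, smul_eq_zero_iff_left hΩ'.2, mul_eq_zero, mul_eq_zero,
      mul_eq_zero]
    simp [hfac, hN1, ht]

end TopDegree

/-! ### Top powers of nondegenerate two-forms -/

section Nondegenerate

variable {V : Type*} [NormedAddCommGroup V] [NormedSpace ℝ V]

/-- A real form, as a complex valued one. -/
def complexify {k : ℕ} (α : V [⋀^Fin k]→L[ℝ] ℝ) : AltForm V k :=
  Complex.ofRealCLM.compContinuousAlternatingMap α

@[simp] theorem complexify_apply {k : ℕ} (α : V [⋀^Fin k]→L[ℝ] ℝ) (v : Fin k → V) :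
    complexify α v = (α v : ℂ) := rfl

/-- If `f ∧ α = 0` and `f u = 1`, then `α` vanishes on the kernel of `f`. -/
theorem eq_zero_of_covector_mul_eq_zero {f : V →L[ℝ] ℂ} {k : ℕ} {α : AltForm V k}
    (h : toRing (covector f) * toRing α = 0) {u : V} (hu : f u = 1) {v : Fin k → V}
    (hv : ∀ j, f (v j) = 0) : α v = 0 := by
  rw [← toRing_wedge, toRing_eq_zero] at h
  have h1 := covector_wedge_apply f α (Fin.cons u v)
  rw [h, Fin.sum_univ_succ] at h1
  simp only [Fin.cons_zero, Fin.cons_succ, hu, hv] at h1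
  simpa using h1.symm

theorem covector_mul_apply (f g : V →L[ℝ] ℂ) (v w : V) :
    wedge (covector f) (covector g) ![v, w] = f v * g w - f w * g v := by
  have h := covector_wedge_apply f (covector g) ![v, w]
  rw [Fin.sum_univ_two] at h
  refine h.trans ?_
  simp [Fin.succAbove]
  ring

theorem covector_mul_mul_self (f g : V →L[ℝ] ℂ) :
    (toRing (covector f) * toRing (covector g)) * (toRing (covector f) * toRing (covector g)) = 0 := by
  rw [covector_mul_covector f g, neg_mul_neg, mul_assoc, ← mul_assoc (toRing (covector f)),
    covector_mul_covector f g, neg_mul, mul_assoc, covector_mul_self, mul_zero, neg_zero, mul_zero]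

/-- The top exterior power of a nondegenerate `2`-form does not vanish. A hyperbolic plane is split
off, whose contribution to the `2`-form is a product `x ∧ y` of covectors. -/
theorem pow_complexify_ne_zero {n : ℕ} : ∀ {V : Type*} [NormedAddCommGroup V] [NormedSpace ℝ V]
    [FiniteDimensional ℝ V] (_ : Module.finrank ℝ V = 2 * n) (Ω : V [⋀^Fin 2]→L[ℝ] ℝ)
    (_ : ∀ v, v ≠ 0 → ∃ w, Ω ![v, w] ≠ 0), toRing (complexify Ω) ^ n ≠ 0 := by
  induction n with
  | zero =>
    intro V _ _ _ _ Ω _ h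
    rw [pow_zero, ← map_one (algebraMap ℂ (FormRing V)), ← toRing_const, toRing_eq_zero] at h
    have := congrArg (fun β : AltForm V 0 => β 0) h
    simp at this
  | succ n ih =>
    intro V _ _ _ hV Ω hΩ
    have hadd0 : ∀ x y z : V, Ω ![x + y, z] = Ω ![x, z] + Ω ![y, z] := fun x y z =>
      Ω.vecCons_add ![z] x y
    have hsmul0 : ∀ (r : ℝ) (x z : V), Ω ![r • x, z] = r * Ω ![x, z] := fun r x z =>
      Ω.vecCons_smul ![z] r x
    have hsw : ∀ x y : V, Ω ![x, y] = -Ω ![y, x] := fun x y => by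
      have := Ω.toAlternatingMap.map_swap ![y, x] (i := 0) (j := 1) (by decide)
      rw [← show (![x, y] : Fin 2 → V) = ![y, x] ∘ Equiv.swap 0 1 by ext i; fin_cases i <;> rfl]
        at this
      exact this
    have hself : ∀ x : V, Ω ![x, x] = 0 := fun x => by have := hsw x x; linarith
    have hadd1 : ∀ x y z : V, Ω ![z, x + y] = Ω ![z, x] + Ω ![z, y] := fun x y z => by
      rw [hsw, hadd0, hsw x, hsw y]; ring
    have hsmul1 : ∀ (r : ℝ) (x z : V), Ω ![z, r • x] = r * Ω ![z, x] := fun r x z => by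
      rw [hsw, hsmul0, hsw x]; ring
    -- a hyperbolic pair `u, u'`, and the covectors `x, y` that restrict to its dual basis
    obtain ⟨u, hu⟩ : ∃ u : V, u ≠ 0 := by
      have : Nontrivial V := Module.nontrivial_of_finrank_pos (R := ℝ) (by omega)
      exact exists_ne 0
    obtain ⟨u', hu'⟩ : ∃ u', Ω ![u, u'] = 1 := by
      obtain ⟨w, hw⟩ := hΩ u hu
      exact ⟨(Ω ![u, w])⁻¹ • w, by rw [hsmul1, inv_mul_cancel₀ hw]⟩
    let x : V →L[ℝ] ℝ := LinearMap.toContinuousLinearMap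
      { toFun := fun w => Ω ![w, u']
        map_add' := fun _ _ => hadd0 _ _ _
        map_smul' := fun _ _ => hsmul0 _ _ _ }
    let y : V →L[ℝ] ℝ := LinearMap.toContinuousLinearMap
      { toFun := fun w => Ω ![u, w]
        map_add' := fun _ _ => hadd1 _ _ _
        map_smul' := fun _ _ => hsmul1 _ _ _ }
    have hxd : ∀ w, x w = Ω ![w, u'] := fun _ => rfl
    have hyd : ∀ w, y w = Ω ![u, w] := fun _ => rfl
    have hxu : x u = 1 := hu'
    have hxu' : x u' = 0 := hself u'
    have hyu : y u = 0 := hself u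
    have hyu' : y u' = 1 := hu'
    set ψ : V →ₗ[ℝ] ℝ × ℝ := (x : V →ₗ[ℝ] ℝ).prod (y : V →ₗ[ℝ] ℝ) with hψ
    set W : Submodule ℝ V := LinearMap.ker ψ with hW
    have hmem : ∀ w, w ∈ W ↔ x w = 0 ∧ y w = 0 := by
      intro w
      rw [hW, LinearMap.mem_ker, hψ, LinearMap.prod_apply, Prod.mk_eq_zero]
      rfl
    have hWfin : Module.finrank ℝ W = 2 * n := by
      have hsurj : Function.Surjective ψ := by
        rintro ⟨r, s⟩
        refine ⟨r • u + s • u', ?_⟩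
        simp [hψ, hxu, hxu', hyu, hyu']
      have h1 := ψ.finrank_range_add_finrank_ker
      rw [LinearMap.range_eq_top.2 hsurj, finrank_top, Module.finrank_prod, Module.finrank_self,
        hV] at h1
      change 1 + 1 + Module.finrank ℝ W = _ at h1
      omega
    -- the projection onto `W` along the span of `u` and `u'`
    let π : V →L[ℝ] W := LinearMap.toContinuousLinearMap
      { toFun := fun v => ⟨v - x v • u - y v • u', (hmem _).2 ⟨by simp [hxu, hxu'],
          by simp [hyu, hyu']⟩⟩
        map_add' := fun v w => by
          ext
          simp only [map_add, add_smul, Submodule.coe_add]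
          abel
        map_smul' := fun r v => by
          ext
          simp [smul_sub, smul_smul] }
    have hπ : ∀ v, v = (π v : V) + x v • u + y v • u' := by
      intro v
      change v = (v - x v • u - y v • u') + _ + _
      abel
    have hπι : ∀ w : W, π w = w := by
      intro w
      ext
      change (w : V) - x w • u - y w • u' = w
      rw [((hmem _).1 w.2).1, ((hmem _).1 w.2).2]
      simp
    set ΩW : W [⋀^Fin 2]→L[ℝ] ℝ := Ω.compContinuousLinearMap W.subtypeL with hΩW
    have hΩWapp : ∀ v w : W, ΩW ![v, w] = Ω ![(v : V), (w : V)] := by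
      intro v w
      rw [hΩW, ContinuousAlternatingMap.compContinuousLinearMap_apply]
      congr 1
      ext i
      fin_cases i <;> rfl
    have hWu : ∀ w : W, Ω ![(w : V), u] = 0 := fun w => by
      rw [hsw, ← hyd, ((hmem _).1 w.2).2, neg_zero]
    have hWu' : ∀ w : W, Ω ![(w : V), u'] = 0 := fun w => by
      rw [← hxd, ((hmem _).1 w.2).1]
    have hnd : ∀ w : W, w ≠ 0 → ∃ w', ΩW ![w, w'] ≠ 0 := by
      intro w hw
      obtain ⟨v, hv⟩ := hΩ w (fun h => hw (Subtype.ext h))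
      refine ⟨π v, fun h => hv ?_⟩
      rw [hΩWapp] at h
      rw [hπ v, hadd1, hadd1, hsmul1, hsmul1, hWu, hWu', h]
      simp
    have hih := ih hWfin ΩW hnd
    set X := toRing (covector (Complex.ofRealCLM ∘L x)) with hX
    set Y := toRing (covector (Complex.ofRealCLM ∘L y)) with hY
    set P := pull π (toRing (complexify ΩW)) with hP
    have hsplit : toRing (complexify Ω) = P + X * Y := by
      rw [hP, hX, hY, pull_toRing, ← toRing_wedge, ← toRing_add, toRing_inj]
      ext v
      have e : ∀ w : Fin 2 → V, w = ![w 0, w 1] := fun w => by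
        ext i; fin_cases i <;> rfl
      rw [e v, ContinuousAlternatingMap.add_apply, covector_mul_apply,
        ContinuousAlternatingMap.compContinuousLinearMap_apply]
      have e2 : (⇑π ∘ ![v 0, v 1]) = ![π (v 0), π (v 1)] := by
        ext i; fin_cases i <;> rfl
      rw [e2, complexify_apply, complexify_apply, hΩWapp]
      have hWu2 : ∀ w : W, Ω ![u, (w : V)] = 0 := fun w => by rw [hsw, hWu, neg_zero]
      have hWu2' : ∀ w : W, Ω ![u', (w : V)] = 0 := fun w => by rw [hsw, hWu', neg_zero]
      conv_lhs => rw [hπ (v 0), hπ (v 1)]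
      simp only [hadd0, hadd1, hsmul0, hsmul1, hWu, hWu', hWu2, hWu2', hself, hu',
        hsw u' u]
      simp
      ring
    have hP1 : P ^ (n + 1) = 0 := by
      rw [hP, ← map_pow, toRing_pow_eq_zero (by omega), map_zero]
    have hPc : P ∈ Subalgebra.center ℂ (FormRing V) := by
      rw [hP, pull_toRing]; exact toRing_two_mem_center _
    have hec : X * Y ∈ Subalgebra.center ℂ (FormRing V) := by
      rw [hX, hY, ← toRing_wedge]; exact toRing_two_mem_center _
    have hexp : (P + X * Y) ^ (n + 1) = ((n + 1 : ℕ) : ℂ) • (X * (Y * P ^ n)) := by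
      have := add_pow_of_sq_eq_zero (R := Subalgebra.center ℂ (FormRing V)) (x := ⟨P, hPc⟩)
        (e := ⟨X * Y, hec⟩) (Subtype.ext (covector_mul_mul_self _ _)) (n + 1)
      have := congrArg Subtype.val this
      simp only [Subalgebra.coe_pow, Subalgebra.coe_add, Subalgebra.coe_mul, hP1, zero_add,
        Nat.add_sub_cancel] at this
      rw [this, Algebra.smul_def, map_natCast, mul_assoc, mul_assoc]
      rfl
    rw [hsplit, hexp]
    intro h0
    have h1 := (smul_eq_zero.mp h0).resolve_left (by exact_mod_cast n.succ_ne_zero)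
    -- inserting `u` and `u'` into `x ∧ y ∧ P ^ n = 0` leaves `ΩW ^ n = 0`
    apply hih
    rw [← toRing_wedgePow, toRing_eq_zero]
    ext w
    have hPn : P ^ n = toRing ((wedgePow (complexify ΩW) n).compContinuousLinearMap π :
        AltForm V (2 * n)) := by
      rw [hP, ← map_pow, ← toRing_wedgePow, pull_toRing]
    rw [hPn, hY, ← toRing_wedge] at h1
    have h2 := eq_zero_of_covector_mul_eq_zero h1 (u := u) (by simp [hxu])
      (v := fun i => (Fin.cons u' (fun j => (w j : V)) : Fin (2 * n + 1) → V)
        (Fin.cast (add_comm 1 (2 * n)) i)) (by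
        intro j
        generalize Fin.cast (add_comm 1 (2 * n)) j = i
        refine Fin.cases ?_ (fun i => ?_) i
        · simp [hxu']
        · simp [((hmem _).1 (w i).2).1])
    rw [covector_wedge_apply, Fin.sum_univ_succ] at h2
    have hyw : ∀ j, y (w j) = 0 := fun j => ((hmem _).1 (w j).2).2
    simp only [Fin.cons_zero, Fin.cons_succ, ContinuousLinearMap.comp_apply, hyu', hyw] at h2
    simp only [Fin.val_zero, pow_zero, Complex.ofRealCLM_apply, Complex.ofReal_one, one_mul,
      Complex.ofReal_zero, zero_mul, mul_zero, Finset.sum_const_zero, add_zero,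
      Fin.succAbove_zero, Fin.cons_succ, ContinuousAlternatingMap.compContinuousLinearMap_apply] at h2
    refine Eq.trans ?_ h2
    congr 1
    ext j
    simp [hπι]

end Nondegenerate

/-! ### The Leibniz rule -/

section Leibniz

variable {V : Type*} [NormedAddCommGroup V] [NormedSpace ℝ V]

theorem norm_wedge_le {k l : ℕ} (α : AltForm V k) (β : AltForm V l) :
    ‖(wedge α β : AltForm V (k + l))‖ ≤
      ((k.factorial : ℝ) * l.factorial)⁻¹ * (k + l).factorial * ‖α‖ * ‖β‖ := by
  refine ContinuousAlternatingMap.opNorm_le_bound _ (by positivity) fun v => ?_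
  rw [wedge_apply, norm_mul, norm_inv, norm_mul, Complex.norm_natCast, Complex.norm_natCast,
    mul_assoc, mul_assoc, mul_assoc]
  refine mul_le_mul_of_nonneg_left ?_ (by positivity)
  refine (norm_sum_le _ _).trans ?_
  have hσ : ∀ σ : Equiv.Perm (Fin (k + l)), ‖((Equiv.Perm.sign σ : ℤˣ) : ℂ) *
      (α (fun i => v (σ (Fin.castAdd l i))) * β (fun j => v (σ (Fin.natAdd k j))))‖ ≤
      ‖α‖ * (‖β‖ * ∏ i, ‖v i‖) := by
    intro σ
    have h1 : ‖((Equiv.Perm.sign σ : ℤˣ) : ℂ)‖ = 1 := by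
      rcases Int.units_eq_one_or (Equiv.Perm.sign σ) with h | h <;> simp [h]
    rw [norm_mul, norm_mul, h1, one_mul]
    refine (mul_le_mul (α.le_opNorm _) (β.le_opNorm _) (norm_nonneg _) (by positivity)).trans ?_
    rw [← Equiv.prod_comp σ (fun i => ‖v i‖), Fin.prod_univ_add]
    exact le_of_eq (by ring)
  refine (Finset.sum_le_sum fun σ _ => hσ σ).trans ?_
  simp [Fintype.card_perm]

/-- The wedge product as a continuous bilinear map. -/
def wedgeCLM (k l : ℕ) : AltForm V k →L[ℝ] AltForm V l →L[ℝ] AltForm V (k + l) :=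
  LinearMap.mkContinuous₂
    (LinearMap.mk₂ ℝ (fun (α : AltForm V k) (β : AltForm V l) => (wedge α β : AltForm V (k + l)))
      (fun α α' β => wedge_add_left α α' β)
      (fun c α β => wedge_smul_left (c : ℂ) α β)
      (fun α β β' => wedge_add_right α β β')
      (fun c α β => wedge_smul_right (c : ℂ) α β))
    (((k.factorial : ℝ) * l.factorial)⁻¹ * (k + l).factorial)
    (fun α β => norm_wedge_le α β)

theorem wedgeCLM_apply {k l : ℕ} (α : AltForm V k) (β : AltForm V l) :
    wedgeCLM k l α β = wedge α β := rfl

theorem DifferentiableAt.wedge {k l : ℕ} {α : V → AltForm V k} {β : V → AltForm V l} {x : V}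
    (hα : DifferentiableAt ℝ α x) (hβ : DifferentiableAt ℝ β x) :
    DifferentiableAt ℝ (fun y => (wedge (α y) (β y) : AltForm V (k + l))) x :=
  ((wedgeCLM k l).hasFDerivAt_of_bilinear hα.hasFDerivAt hβ.hasFDerivAt).differentiableAt

/-- The Leibniz rule for the exterior derivative. -/
theorem toRing_extDeriv_wedge [FiniteDimensional ℝ V] {k l : ℕ} {α : V → AltForm V k}
    {β : V → AltForm V l} {x : V} (hα : DifferentiableAt ℝ α x) (hβ : DifferentiableAt ℝ β x) :
    toRing (extDeriv (fun y => (wedge (α y) (β y) : AltForm V (k + l))) x) =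
      toRing (extDeriv α x) * toRing (β x) +
        (-1 : ℂ) ^ k • (toRing (α x) * toRing (extDeriv β x)) := by
  have hD := ((wedgeCLM k l).hasFDerivAt_of_bilinear hα.hasFDerivAt hβ.hasFDerivAt).fderiv
  simp only [wedgeCLM_apply] at hD
  set e := Module.finBasis ℝ V
  rw [extDeriv, extDeriv, extDeriv, hD, toRing_alternatizeUncurryFin e,
    toRing_alternatizeUncurryFin e, toRing_alternatizeUncurryFin e, Finset.sum_mul, Finset.mul_sum,
    Finset.smul_sum, ← Finset.sum_add_distrib]
  refine Finset.sum_congr rfl fun i _ => ?_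
  have h1 : ((wedgeCLM k l).precompR V (α x) (fderiv ℝ β x) +
      (wedgeCLM k l).precompL V (fderiv ℝ α x) (β x)) (e i) =
      (wedge (α x) (fderiv ℝ β x (e i)) + wedge (fderiv ℝ α x (e i)) (β x) : AltForm V (k + l)) :=
    rfl
  rw [h1, toRing_add, toRing_wedge, toRing_wedge, mul_add, ← mul_assoc, ← mul_assoc,
    covector_mul _ (α x), smul_mul_assoc, add_comm, mul_assoc (toRing (α x))]

end Leibniz

/-! ### Calculus of forms on a manifold -/

section FormCalculus

variable {E : Type*} [NormedAddCommGroup E] [NormedSpace ℝ E]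
variable {H : Type*} [TopologicalSpace H] {I : ModelWithCorners ℝ E H}
variable {M : Type*} [TopologicalSpace M] [ChartedSpace H M]

/-- The value of a complex valued form at a point, in the exterior algebra of the model space. -/
def Form.ringAt {k : ℕ} (α : Form I M k ℂ) (x : M) : FormRing E := toRing (V := E) (α x)

/-- Differentiability at `x` of a form, read in the chart around `x`. -/
def Form.DiffAt {k : ℕ} {F : Type*} [NormedAddCommGroup F] [NormedSpace ℝ F]
    (α : Form I M k F) (x : M) : Prop :=
  DifferentiableAt ℝ (α.inChart x) (extChartAt I x x)

theorem Form.ext_ringAt {k : ℕ} {α β : Form I M k ℂ} (h : ∀ x, α.ringAt x = β.ringAt x) :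
    α = β :=
  funext fun x => toRing_injective (V := E) (h x)

theorem Form.ringAt_add {k : ℕ} (α β : Form I M k ℂ) (x : M) :
    (α + β).ringAt x = α.ringAt x + β.ringAt x := toRing_add (V := E) _ _

theorem Form.ringAt_smul {k : ℕ} (c : ℂ) (α : Form I M k ℂ) (x : M) :
    (c • α).ringAt x = c • α.ringAt x := toRing_smul (V := E) _ _

theorem Form.ringAt_wedge {k l : ℕ} (α : Form I M k ℂ) (β : Form I M l ℂ) (x : M) :
    (α.wedge β).ringAt x = α.ringAt x * β.ringAt x := toRing_wedge (V := E) _ _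

theorem Form.ringAt_pow (Ω : Form I M 2 ℂ) (m : ℕ) (x : M) :
    (Ω.pow m).ringAt x = Ω.ringAt x ^ m := toRing_wedgePow (V := E) _ _

theorem Form.ringAt_zero {k : ℕ} (x : M) : (0 : Form I M k ℂ).ringAt x = 0 :=
  toRing_zero (V := E)

theorem Form.ringAt_eq_zero {k : ℕ} {α : Form I M k ℂ} : α = 0 ↔ ∀ x, α.ringAt x = 0 :=
  ⟨fun h x => by rw [h, Form.ringAt_zero], fun h => Form.ext_ringAt fun x => by
    rw [h, Form.ringAt_zero]⟩

theorem Form.inChart_add {k : ℕ} {F : Type*} [NormedAddCommGroup F] [NormedSpace ℝ F]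
    (α β : Form I M k F) (x : M) : (α + β).inChart x = α.inChart x + β.inChart x := rfl

theorem Form.inChart_smul {k : ℕ} (c : ℂ) (α : Form I M k ℂ) (x : M) :
    (c • α).inChart x = c • α.inChart x := rfl

theorem Form.inChart_wedge {k l : ℕ} (α : Form I M k ℂ) (β : Form I M l ℂ) (x : M) :
    (α.wedge β).inChart x = fun y => SasakianProduct.wedge (α.inChart x y) (β.inChart x y) :=
  funext fun y => wedge_comp (V := E) (W := E)
    (mfderiv 𝓘(ℝ, E) I (extChartAt I x).symm y) (α ((extChartAt I x).symm y)) _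

theorem Form.DiffAt.add {k : ℕ} {F : Type*} [NormedAddCommGroup F] [NormedSpace ℝ F]
    {α β : Form I M k F} {x : M} (hα : α.DiffAt x) (hβ : β.DiffAt x) : (α + β).DiffAt x :=
  DifferentiableAt.add hα hβ

theorem Form.DiffAt.smul {k : ℕ} {α : Form I M k ℂ} {x : M} (hα : α.DiffAt x) (c : ℂ) :
    (c • α).DiffAt x :=
  DifferentiableAt.const_smul hα c

theorem Form.DiffAt.wedge {k l : ℕ} {α : Form I M k ℂ} {β : Form I M l ℂ} {x : M}
    (hα : α.DiffAt x) (hβ : β.DiffAt x) : (α.wedge β).DiffAt x := by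
  rw [Form.DiffAt, Form.inChart_wedge]
  exact DifferentiableAt.wedge hα hβ

theorem Form.inChart_pow_zero (Ω : Form I M 2 ℂ) (x : M) :
    (Ω.pow 0).inChart x = fun _ => ContinuousAlternatingMap.constOfIsEmpty ℝ E (Fin 0) 1 := by
  ext y v
  rfl

theorem Form.DiffAt.pow {Ω : Form I M 2 ℂ} {x : M} (hΩ : Ω.DiffAt x) (m : ℕ) :
    (Ω.pow m).DiffAt x := by
  induction m with
  | zero => rw [Form.DiffAt, Form.inChart_pow_zero]; exact differentiableAt_const _
  | succ m ih => exact Form.DiffAt.wedge ih hΩ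

theorem commute_ringAt_two [FiniteDimensional ℝ E] (Ω : Form I M 2 ℂ) (x : M) (y : FormRing E) :
    Commute (Ω.ringAt x) y :=
  ((Subalgebra.mem_center_iff (R := ℂ)).1 (toRing_two_mem_center (V := E) (Ω x)) y).symm

/-- Forms whose degrees are only propositionally equal can be compared through their values in the
exterior algebra. -/
theorem Form.ringAt_d_congr {k l : ℕ} (h : k = l) {α : Form I M k ℂ} {β : Form I M l ℂ}
    (hαβ : ∀ x, α.ringAt x = β.ringAt x) (x : M) : α.d.ringAt x = β.d.ringAt x := by
  subst h
  rw [Form.ext_ringAt hαβ]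

variable [IsManifold I ∞ M]

/-- At the centre of the chart, the derivative of the chart is the identity. -/
theorem Form.d_apply {k : ℕ} {F : Type*} [NormedAddCommGroup F] [NormedSpace ℝ F]
    (α : Form I M k F) (x : M) :
    (α.d x : E [⋀^Fin (k + 1)]→L[ℝ] F) = extDeriv (α.inChart x) (extChartAt I x x) := by
  have : IsManifold I 1 M := IsManifold.of_le (n := ∞) (by norm_cast)
  rw [Form.d, mfderiv_extChartAt_self]
  ext v
  rfl

theorem Form.ringAt_d {k : ℕ} (α : Form I M k ℂ) (x : M) :
    α.d.ringAt x = toRing (V := E) (extDeriv (α.inChart x) (extChartAt I x x)) :=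
  congrArg (toRing (V := E)) (Form.d_apply α x)

theorem Form.ringAt_d_add {k : ℕ} {α β : Form I M k ℂ} {x : M} (hα : α.DiffAt x)
    (hβ : β.DiffAt x) : (α + β).d.ringAt x = α.d.ringAt x + β.d.ringAt x := by
  rw [Form.ringAt_d, Form.ringAt_d, Form.ringAt_d, Form.inChart_add, extDeriv_add hα hβ]
  exact toRing_add (V := E) _ _

theorem Form.ringAt_d_smul {k : ℕ} {α : Form I M k ℂ} {x : M} (c : ℂ) (hα : α.DiffAt x) :
    (c • α).d.ringAt x = c • α.d.ringAt x := by
  rw [Form.ringAt_d, Form.ringAt_d, Form.inChart_smul, ← toRing_smul]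
  congr 1
  ext v
  have h := (fderiv_const_smul hα c : _)
  rw [extDeriv, extDeriv, h]
  simp only [ContinuousAlternatingMap.alternatizeUncurryFin_apply,
    ContinuousAlternatingMap.smul_apply, Finset.smul_sum]
  refine Finset.sum_congr rfl fun i _ => ?_
  exact smul_comm _ _ _

variable [I.Boundaryless]

theorem Form.inChart_self {k : ℕ} {F : Type*} [NormedAddCommGroup F] [NormedSpace ℝ F]
    (α : Form I M k F) (x : M) :
    (α.inChart x (extChartAt I x x) : E [⋀^Fin k]→L[ℝ] F) = α x := by
  have : IsManifold I 1 M := IsManifold.of_le (n := ∞) (by norm_cast)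
  have h := mfderivWithin_range_extChartAt_symm (I := I) (x := x)
  rw [I.range_eq_univ, mfderivWithin_univ] at h
  rw [Form.inChart, h, extChartAt_to_inv]
  ext v
  rfl

theorem Form.ringAt_d_wedge [FiniteDimensional ℝ E] {k l : ℕ} {α : Form I M k ℂ}
    {β : Form I M l ℂ} {x : M} (hα : α.DiffAt x) (hβ : β.DiffAt x) :
    (α.wedge β).d.ringAt x =
      α.d.ringAt x * β.ringAt x + (-1 : ℂ) ^ k • (α.ringAt x * β.d.ringAt x) := by
  rw [Form.ringAt_d, Form.inChart_wedge, toRing_extDeriv_wedge hα hβ, Form.ringAt_d, Form.ringAt_d,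
    Form.inChart_self, Form.inChart_self]
  rfl

theorem Form.ringAt_d_pow [FiniteDimensional ℝ E] {Ω : Form I M 2 ℂ} {x : M} (hΩ : Ω.DiffAt x)
    (m : ℕ) : (Ω.pow m).d.ringAt x = (m : ℂ) • (Ω.d.ringAt x * Ω.ringAt x ^ (m - 1)) := by
  induction m with
  | zero =>
    rw [Form.ringAt_d, Form.inChart_pow_zero]
    have : extDeriv (fun _ : E => (ContinuousAlternatingMap.constOfIsEmpty ℝ E (Fin 0) 1 :
        AltForm E 0)) (extChartAt I x x) = 0 := by
      ext v
      simp [extDeriv, ContinuousAlternatingMap.alternatizeUncurryFin_apply]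
    rw [this, toRing_zero]
    simp
  | succ m ih =>
    change ((Ω.pow m).wedge Ω).d.ringAt x = _
    rw [Form.ringAt_d_wedge (hΩ.pow m) hΩ, ih, Form.ringAt_pow, pow_mul, neg_one_sq, one_pow,
      one_smul, ((commute_ringAt_two Ω x (Ω.d.ringAt x)).pow_left m).eq, Nat.add_sub_cancel,
      Nat.cast_succ, add_smul, one_smul]
    rcases m with _ | m
    · simp
    · rw [Nat.add_sub_cancel, pow_succ, smul_mul_assoc, mul_assoc]

end FormCalculus

/-! ### Algebraic identities behind `∂∂̄ Ω ^ (m + 1)` -/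

section DelDelbarAlgebra

variable {R : Type*} [Ring R] [Algebra ℂ R]

theorem covector_combination_mul {x y ε : Subalgebra.center ℂ R} {h₁ h₂ : R} (c t : ℂ)
    (h11 : h₁ * h₁ = 0) (h22 : h₂ * h₂ = 0) (h12 : h₁ * h₂ = ε) (h21 : h₂ * h₁ = -ε) :
    (h₁ + c • h₂) * (t • (x * h₂ - h₁ * y)) = ((t • ((x + c • y) * ε) : Subalgebra.center ℂ R) : R) := by
  have hy : h₁ * y = y * h₁ := (Subalgebra.mem_center_iff (R := ℂ)).1 y.2 h₁
  have hx1 : h₁ * x = x * h₁ := (Subalgebra.mem_center_iff (R := ℂ)).1 x.2 h₁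
  have hx2 : h₂ * x = x * h₂ := (Subalgebra.mem_center_iff (R := ℂ)).1 x.2 h₂
  have hy2 : h₂ * y = y * h₂ := (Subalgebra.mem_center_iff (R := ℂ)).1 y.2 h₂
  have e1 : h₁ * (x * h₂) = x * ε := by rw [← mul_assoc, hx1, mul_assoc, h12]
  have e2 : h₁ * (y * h₁) = 0 := by rw [← mul_assoc, hy, mul_assoc, h11, mul_zero]
  have e3 : h₂ * (x * h₂) = 0 := by rw [← mul_assoc, hx2, mul_assoc, h22, mul_zero]
  have e4 : h₂ * (y * h₁) = -(y * ε) := by rw [← mul_assoc, hy2, mul_assoc, h21, mul_neg]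
  rw [hy, mul_smul_comm, mul_sub, add_mul, add_mul, smul_mul_assoc, smul_mul_assoc, e1, e2, e3, e4]
  simp only [Subalgebra.coe_smul, Subalgebra.coe_mul, Subalgebra.coe_add, add_mul, smul_mul_assoc]
  simp

theorem ddbar_algebra_comm {Z : Type*} [CommRing Z] {x y e : Z} (c c' t : Z) (he : e * e = 0)
    (m : ℕ) :
    (x + c * y) * (x + c' * y) * (x + y + t * e) ^ m -
      m * ((x + c * y) * (t * ((x + c' * y) * e)) * (x + y + t * e) ^ (m - 1)) =
      (x ^ 2 + (c + c') * (x * y) + c * c' * y ^ 2) * (x + y) ^ m := by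
  have hte : (t * e) * (t * e) = 0 := by rw [mul_mul_mul_comm, he, mul_zero]
  rw [add_pow_of_sq_eq_zero hte, add_pow_of_sq_eq_zero hte]
  linear_combination (-((m : Z)) * (x + c * y) * (x + c' * y) * t ^ 2 * ((m - 1 : ℕ) : Z) *
    (x + y) ^ (m - 1 - 1)) * he

/-- The exterior derivative of `(x + c y) (h₁ + c' h₂) Ω ^ m`, where `Ω = x + y + t h₁ h₂`: the two
terms of the Leibniz rule that contain `h₁ h₂` cancel. -/
theorem ddbar_algebra {x y ε : Subalgebra.center ℂ R} {h₁ h₂ : R} (c c' t : ℂ)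
    (h11 : h₁ * h₁ = 0) (h22 : h₂ * h₂ = 0) (h12 : h₁ * h₂ = ε) (h21 : h₂ * h₁ = -ε) (m : ℕ) :
    ((x + c • y : Subalgebra.center ℂ R) : R) * (x + c' • y : Subalgebra.center ℂ R)
        * (x + y + t • ε : Subalgebra.center ℂ R) ^ m -
      (x + c • y : Subalgebra.center ℂ R) * (h₁ + c' • h₂) *
        ((m : ℂ) • (t • (x * h₂ - h₁ * y) * (x + y + t • ε : Subalgebra.center ℂ R) ^ (m - 1))) =
    ((x ^ 2 + (c + c') • (x * y) + (c * c') • y ^ 2) * (x + y) ^ m : Subalgebra.center ℂ R) := by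
  have hεε : ε * ε = 0 := by
    apply Subtype.ext
    rw [Subalgebra.coe_mul, ← h12]
    calc h₁ * h₂ * (h₁ * h₂) = h₁ * (h₂ * h₁) * h₂ := by noncomm_ring
      _ = -(h₁ * h₁) * h₂ * h₂ := by rw [h21, ← h12]; noncomm_ring
      _ = 0 := by rw [h11]; simp
  have h1 : (((x + c • y : Subalgebra.center ℂ R) : R) * (h₁ + c' • h₂)) *
        ((m : ℂ) • (t • (x * h₂ - h₁ * y) * (x + y + t • ε : Subalgebra.center ℂ R) ^ (m - 1))) =
      (((m : ℂ) • ((x + c • y) * (t • ((x + c' • y) * ε)) * (x + y + t • ε) ^ (m - 1)) :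
        Subalgebra.center ℂ R) : R) := by
    rw [mul_smul_comm, mul_assoc, ← mul_assoc (h₁ + c' • h₂),
      covector_combination_mul c' t h11 h22 h12 h21, ← mul_assoc]
    rfl
  rw [h1]
  have key : (x + c • y) * (x + c' • y) * (x + y + t • ε) ^ m -
      (m : ℂ) • ((x + c • y) * (t • ((x + c' • y) * ε)) * (x + y + t • ε) ^ (m - 1)) =
      (x ^ 2 + (c + c') • (x * y) + (c * c') • y ^ 2) * (x + y) ^ m := by
    have := ddbar_algebra_comm (x := x) (y := y)
      (algebraMap ℂ (Subalgebra.center ℂ R) c) (algebraMap ℂ (Subalgebra.center ℂ R) c')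
      (algebraMap ℂ (Subalgebra.center ℂ R) t) hεε m
    simp only [Algebra.smul_def, map_mul, map_add, map_natCast]
    exact this
  rw [← key]
  rfl

/-- Splitting of `dΩ` into its components of types `(1, 2)` and `(2, 1)`. -/
theorem dOmega_split {x y : Subalgebra.center ℂ R} {h₁ h₂ : R} {c c' t : ℂ} (hc : c - c' ≠ 0) :
    t • (x * h₂ - h₁ * y) =
      -(t / (c - c')) • ((x + c • y : Subalgebra.center ℂ R) * (h₁ + c' • h₂)) +
        (t / (c - c')) • ((x + c' • y : Subalgebra.center ℂ R) * (h₁ + c • h₂)) := by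
  have hy : h₁ * y = y * h₁ := (Subalgebra.mem_center_iff (R := ℂ)).1 y.2 h₁
  rw [hy]
  obtain ⟨K, hK⟩ : ∃ K, t = K * (c - c') := ⟨t / (c - c'), by field_simp⟩
  rw [show t / (c - c') = K by rw [hK]; field_simp, hK]
  simp only [Subalgebra.coe_smul, Subalgebra.coe_add, add_mul, mul_add, smul_mul_assoc,
    mul_smul_comm]
  module

end DelDelbarAlgebra

/-! ### The form `∂∂̄ Ω ^ (m + 1)` -/

section DelDelbar

variable {E : Type*} [NormedAddCommGroup E] [NormedSpace ℝ E]
variable {H : Type*} [TopologicalSpace H] {I : ModelWithCorners ℝ E H}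
variable {M : Type*} [TopologicalSpace M] [ChartedSpace H M]

theorem Form.typePart_eq {J : EndoField I M} {k p q : ℕ} {α : Form I M k ℂ}
    (h : ∀ x, HasType (V := E) (J x) p q (α.ringAt x)) (hk : p + q = k) (r : ℕ) :
    α.typePart J r = if r = p then α else 0 := by
  ext x : 1
  have := (h x).typePart_eq (V := E) hk r
  refine Eq.trans (b := (if r = p then α x else 0)) this ?_
  split_ifs <;> rfl

theorem Form.typePart_zero (J : EndoField I M) {k : ℕ} (r : ℕ) :
    (0 : Form I M k ℂ).typePart J r = 0 := by
  exact funext fun x => SasakianProduct.typePart_zero (V := E) (J x) r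

theorem Form.ringAt_typePart_add {J : EndoField I M} {k p q p' q' : ℕ} (hk : p + q = k)
    (hk' : p' + q' = k) (hp : p' ≠ p) {x : M} {α : Form I M k ℂ} {β β' : AltForm E k}
    (hα : α.ringAt x = toRing β + toRing β') (hβ : HasType (V := E) (J x) p q (toRing β))
    (hβ' : HasType (V := E) (J x) p' q' (toRing β')) :
    (α.typePart J p).ringAt x = toRing β :=
  congrArg (toRing (V := E)) (HasType.typePart_add_eq (V := E) hk hk' hp hα hβ hβ')

theorem exists_toRing_eq {k l : ℕ} (h : k = l) (α : AltForm E k) :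
    ∃ β : AltForm E l, toRing β = toRing α := by
  subst h
  exact ⟨α, rfl⟩

variable [IsManifold I ∞ M]

theorem Form.d_zero {k : ℕ} : (0 : Form I M k ℂ).d = 0 := by
  refine Form.ringAt_eq_zero.2 fun x => ?_
  rw [Form.ringAt_d, ← toRing_zero (V := E) (k := k + 1)]
  congr 1
  have : (0 : Form I M k ℂ).inChart x = 0 := by
    ext y v
    rfl
  rw [this]
  ext v
  simp [extDeriv, ContinuousAlternatingMap.alternatizeUncurryFin_apply]

/-- On forms of pure type, `∂̄` is a single component of `d`. -/
theorem delbar_eq {J : EndoField I M} {k p q : ℕ} {α : Form I M k ℂ}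
    (h : ∀ x, HasType (V := E) (J x) p q (α.ringAt x)) (hk : p + q = k) :
    delbar J α = α.d.typePart J p := by
  rw [delbar, Finset.sum_eq_single p]
  · rw [Form.typePart_eq h hk, if_pos rfl]
  · intro r _ hr
    rw [Form.typePart_eq h hk, if_neg hr, Form.d_zero, Form.typePart_zero]
  · intro hp
    simp at hp
    omega

/-- On forms of pure type, `∂` is a single component of `d`. -/
theorem del_eq {J : EndoField I M} {k p q : ℕ} {α : Form I M k ℂ}
    (h : ∀ x, HasType (V := E) (J x) p q (α.ringAt x)) (hk : p + q = k) :
    del J α = α.d.typePart J (p + 1) := by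
  rw [del, Finset.sum_eq_single p]
  · rw [Form.typePart_eq h hk, if_pos rfl]
  · intro r _ hr
    rw [Form.typePart_eq h hk, if_neg hr, Form.d_zero, Form.typePart_zero]
  · intro hp
    simp at hp
    omega

variable [FiniteDimensional ℝ E] [I.Boundaryless]

/-- The value of `∂∂̄ Ω ^ (m + 1)` for `Ω = X + Y + t h₁ ∧ h₂`, where `dh₁ = X`, `dh₂ = Y` and
`h₁ ∧ h₂` have type `(1, 1)`, `h₁ + c h₂` has type `(1, 0)` and `h₁ + c' h₂` has type `(0, 1)`.

Here `∂̄ Ω ^ (m + 1)` is a constant times `(X + c Y) ∧ (h₁ + c' h₂) ∧ Ω ^ m`, and the exterior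
derivative of this form turns out to have pure type, so that it equals `∂` of it. -/
theorem ringAt_del_delbar_pow {J : EndoField I M} {X Y : Form I M 2 ℂ} {h₁ h₂ : Form I M 1 ℂ}
    {c c' : ℂ} (t : ℂ) (hc : c - c' ≠ 0) (dX : ∀ x, X.DiffAt x) (dY : ∀ x, Y.DiffAt x)
    (d₁ : ∀ x, h₁.DiffAt x) (d₂ : ∀ x, h₂.DiffAt x) (hX : ∀ x, X.d.ringAt x = 0)
    (hY : ∀ x, Y.d.ringAt x = 0) (hd₁ : ∀ x, h₁.d.ringAt x = X.ringAt x)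
    (hd₂ : ∀ x, h₂.d.ringAt x = Y.ringAt x)
    (tX : ∀ x, HasType (V := E) (J x) 1 1 (X.ringAt x))
    (tY : ∀ x, HasType (V := E) (J x) 1 1 (Y.ringAt x))
    (tθ : ∀ x, HasType (V := E) (J x) 1 0 (h₁.ringAt x + c • h₂.ringAt x))
    (tθ' : ∀ x, HasType (V := E) (J x) 0 1 (h₁.ringAt x + c' • h₂.ringAt x))
    (t12 : ∀ x, HasType (V := E) (J x) 1 1 ((h₁.wedge h₂).ringAt x)) (m : ℕ) (x : M) :
    (del J (delbar J ((X + Y + t • h₁.wedge h₂).pow (m + 1)))).ringAt x =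
      (-((m + 1 : ℂ) * (t / (c - c')))) •
        ((X.ringAt x ^ 2 + (c + c') • (X.ringAt x * Y.ringAt x) + (c * c') • Y.ringAt x ^ 2) *
          (X.ringAt x + Y.ringAt x) ^ m) := by
  set Ω : Form I M 2 ℂ := X + Y + t • h₁.wedge h₂ with hΩdef
  set K := t / (c - c') with hK
  have dΩ : ∀ x, Ω.DiffAt x := fun x => ((dX x).add (dY x)).add (((d₁ x).wedge (d₂ x)).smul t)
  have hΩ : ∀ x, Ω.ringAt x = X.ringAt x + Y.ringAt x + t • (h₁.wedge h₂).ringAt x := fun x => by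
    rw [hΩdef, Form.ringAt_add, Form.ringAt_add, Form.ringAt_smul]
  have tΩ : ∀ x, HasType (V := E) (J x) 1 1 (Ω.ringAt x) := fun x => by
    rw [hΩ]
    exact ((tX x).add (tY x)).add ((t12 x).smul t)
  have hdΩ : ∀ x, Ω.d.ringAt x = t • (X.ringAt x * h₂.ringAt x - h₁.ringAt x * Y.ringAt x) := by
    intro x
    rw [hΩdef, Form.ringAt_d_add ((dX x).add (dY x)) (((d₁ x).wedge (d₂ x)).smul t),
      Form.ringAt_d_add (dX x) (dY x), Form.ringAt_d_smul t ((d₁ x).wedge (d₂ x)),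
      Form.ringAt_d_wedge (d₁ x) (d₂ x), hX, hY, hd₁, hd₂, pow_one, zero_add, zero_add]
    congr 1
    rw [sub_eq_add_neg]
    congr 1
    exact neg_one_smul ℂ _
  -- two-forms as elements of the centre
  let z : Form I M 2 ℂ → M → Subalgebra.center ℂ (FormRing E) := fun α x =>
    ⟨α.ringAt x, toRing_two_mem_center (V := E) (α x)⟩
  have hsplit : ∀ x, Ω.d.ringAt x =
      -K • ((X.ringAt x + c • Y.ringAt x) * (h₁.ringAt x + c' • h₂.ringAt x)) +
        K • ((X.ringAt x + c' • Y.ringAt x) * (h₁.ringAt x + c • h₂.ringAt x)) := fun x => by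
    rw [hdΩ]
    exact dOmega_split (x := z X x) (y := z Y x) hc
  -- up to a constant, `B` is `∂̄ Ω ^ (m + 1)`, and `B₂` below is `∂ Ω ^ (m + 1)`
  set θ' : Form I M 1 ℂ := h₁ + c' • h₂ with hθ'
  set θ : Form I M 1 ℂ := h₁ + c • h₂ with hθ
  set B : Form I M (2 + 1 + 2 * m) ℂ := (((X + c • Y).wedge θ').wedge (Ω.pow m)) with hB
  have hBr : ∀ x, B.ringAt x = (X.ringAt x + c • Y.ringAt x) *
      (h₁.ringAt x + c' • h₂.ringAt x) * Ω.ringAt x ^ m := fun x => by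
    rw [hB, Form.ringAt_wedge, Form.ringAt_wedge, Form.ringAt_add, Form.ringAt_smul, hθ',
      Form.ringAt_add, Form.ringAt_smul, Form.ringAt_pow]
  have tB : ∀ x, HasType (V := E) (J x) (m + 1) (m + 2) (B.ringAt x) := fun x => by
    rw [hBr]
    have := (((tX x).add ((tY x).smul c)).mul (tθ' x)).mul ((tΩ x).pow m)
    convert this using 1 <;> ring
  have hdelbar : ∀ x, (delbar J (Ω.pow (m + 1))).ringAt x =
      ((-((m + 1 : ℂ) * K)) • B).ringAt x := by
    intro x
    have tpow : ∀ x, HasType (V := E) (J x) (m + 1) (m + 1) ((Ω.pow (m + 1)).ringAt x) := by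
      intro x
      rw [Form.ringAt_pow]
      simpa using (tΩ x).pow (m + 1)
    rw [delbar_eq tpow (by ring)]
    set B₂ : Form I M (2 + 1 + 2 * m) ℂ := (((X + c' • Y).wedge θ).wedge (Ω.pow m)) with hB₂
    have hB₂r : B₂.ringAt x = (X.ringAt x + c' • Y.ringAt x) *
        (h₁.ringAt x + c • h₂.ringAt x) * Ω.ringAt x ^ m := by
      rw [hB₂, Form.ringAt_wedge, Form.ringAt_wedge, Form.ringAt_add, Form.ringAt_smul, hθ,
        Form.ringAt_add, Form.ringAt_smul, Form.ringAt_pow]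
    have tB₂ : HasType (V := E) (J x) (m + 2) (m + 1) (B₂.ringAt x) := by
      rw [hB₂r]
      have := (((tX x).add ((tY x).smul c')).mul (tθ x)).mul ((tΩ x).pow m)
      convert this using 1 <;> ring
    obtain ⟨β, hβ⟩ := exists_toRing_eq (E := E) (show 2 + 1 + 2 * m = 2 * (m + 1) + 1 by ring)
      (((-((m + 1 : ℂ) * K)) • B) x : AltForm E (2 + 1 + 2 * m))
    obtain ⟨β', hβ'⟩ := exists_toRing_eq (E := E) (show 2 + 1 + 2 * m = 2 * (m + 1) + 1 by ring)
      ((((m + 1 : ℂ) * K) • B₂) x : AltForm E (2 + 1 + 2 * m))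
    have eβ : toRing β = (-((m + 1 : ℂ) * K)) • B.ringAt x := hβ.trans (Form.ringAt_smul _ _ _)
    have eβ' : toRing β' = ((m + 1 : ℂ) * K) • B₂.ringAt x := hβ'.trans (Form.ringAt_smul _ _ _)
    refine (Form.ringAt_typePart_add (p := m + 1) (q := m + 2) (p' := m + 2) (q' := m + 1)
      (β := β) (β' := β') (by ring) (by ring) (by omega) ?_ ?_ ?_).trans hβ
    · rw [Form.ringAt_d_pow (dΩ x), hsplit, eβ, eβ', hBr, hB₂r, Nat.add_sub_cancel, add_mul,
        smul_mul_assoc, smul_mul_assoc, smul_add, smul_smul, smul_smul]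
      push_cast
      congr 2
      ring
    · rw [eβ]
      exact (tB x).smul _
    · rw [eβ']
      exact tB₂.smul _
  have tdelbar : ∀ x, HasType (V := E) (J x) (m + 1) (m + 2)
      ((delbar J (Ω.pow (m + 1))).ringAt x) := fun x => by
    rw [hdelbar, Form.ringAt_smul]
    exact (tB x).smul _
  have dC : (X + c • Y).DiffAt x := (dX x).add ((dY x).smul c)
  have dθ' : θ'.DiffAt x := (d₁ x).add ((d₂ x).smul c')
  have dB : B.DiffAt x := (dC.wedge dθ').wedge ((dΩ x).pow m)
  have hCd : (X + c • Y).d.ringAt x = 0 := by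
    rw [Form.ringAt_d_add (dX x) ((dY x).smul c), Form.ringAt_d_smul c (dY x), hX, hY, smul_zero,
      add_zero]
  have hθd : θ'.d.ringAt x = X.ringAt x + c' • Y.ringAt x := by
    rw [hθ', Form.ringAt_d_add (d₁ x) ((d₂ x).smul c'), Form.ringAt_d_smul c' (d₂ x), hd₁, hd₂]
  have hBd : B.d.ringAt x =
      (X.ringAt x ^ 2 + (c + c') • (X.ringAt x * Y.ringAt x) + (c * c') • Y.ringAt x ^ 2) *
          (X.ringAt x + Y.ringAt x) ^ m := by
    rw [hB, Form.ringAt_d_wedge (dC.wedge dθ') ((dΩ x).pow m), Form.ringAt_d_wedge dC dθ', hCd, hθd,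
      Form.ringAt_d_pow (dΩ x), Form.ringAt_wedge, Form.ringAt_pow, hdΩ, zero_mul, zero_add]
    rw [hΩ, Form.ringAt_add, Form.ringAt_smul, hθ', Form.ringAt_add, Form.ringAt_smul]
    obtain ⟨f₁, hf₁⟩ := covector_surjective (V := E) (h₁ x)
    obtain ⟨f₂, hf₂⟩ := covector_surjective (V := E) (h₂ x)
    have e₁ : h₁.ringAt x = toRing (covector f₁) := congrArg (toRing (V := E)) hf₁.symm
    have e₂ : h₂.ringAt x = toRing (covector f₂) := congrArg (toRing (V := E)) hf₂.symm
    have e12 : (h₁.wedge h₂).ringAt x = h₁.ringAt x * h₂.ringAt x := Form.ringAt_wedge _ _ _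
    have := ddbar_algebra (x := z X x) (y := z Y x) (ε := z (h₁.wedge h₂) x) (h₁ := h₁.ringAt x)
      (h₂ := h₂.ringAt x) c c' t (by rw [e₁, covector_mul_self]) (by rw [e₂, covector_mul_self])
      e12.symm (by
        change _ = -(h₁.wedge h₂).ringAt x
        rw [e12, e₁, e₂, covector_mul_covector]) m
    refine Eq.trans (Eq.trans ?_ (sub_eq_add_neg _ _).symm) this
    congr 1
    · simp only [even_two, Even.neg_pow, one_pow, one_smul]
      rfl
    · rw [show (-1 : ℂ) ^ (2 + 1) = -1 by norm_num]
      exact neg_one_smul ℂ _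
  have hlast : (delbar J (Ω.pow (m + 1))).d.ringAt x = (-((m + 1 : ℂ) * K)) •
      ((X.ringAt x ^ 2 + (c + c') • (X.ringAt x * Y.ringAt x) + (c * c') • Y.ringAt x ^ 2) *
          (X.ringAt x + Y.ringAt x) ^ m) := by
    rw [Form.ringAt_d_congr (by ring) hdelbar, Form.ringAt_d_smul _ dB, hBd]
  rw [del_eq tdelbar (by ring), ← hlast]
  have ttop : HasType (V := E) (J x) (m + 1 + 1) (m + 2)
      ((delbar J (Ω.pow (m + 1))).d.ringAt x) := by
    rw [hlast]
    have h2 := (((((tX x).pow 2).add (((tX x).mul (tY x)).smul (c + c'))).add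
      (((tY x).pow 2).smul (c * c'))).mul (((tX x).add (tY x)).pow m)).smul (-((m + 1 : ℂ) * K))
    convert h2 using 1 <;> ring
  exact congrArg (toRing (V := E))
    ((HasType.typePart_eq (V := E) ttop (by ring) (m + 1 + 1)).trans (if_pos rfl))

end DelDelbar

/-! ### Tensor fields and the Nijenhuis torsion in charts -/

section ChartCalculus

variable {E : Type*} [NormedAddCommGroup E] [NormedSpace ℝ E]
variable {H : Type*} [TopologicalSpace H] (I : ModelWithCorners ℝ E H)
variable {M : Type*} [TopologicalSpace M] [ChartedSpace H M]

/-- The derivative of the chart around `x₀`, at the point with coordinates `y`. -/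
def chartDeriv (x₀ : M) (y : E) : E →L[ℝ] E :=
  mfderiv I 𝓘(ℝ, E) (extChartAt I x₀) ((extChartAt I x₀).symm y)

/-- The derivative of the inverse of the chart around `x₀`, at the point with coordinates `y`. -/
def symmDeriv (x₀ : M) (y : E) : E →L[ℝ] E :=
  mfderiv 𝓘(ℝ, E) I (extChartAt I x₀).symm y

variable {I}

section

variable [I.Boundaryless]

theorem EndoField.IsSmooth.contDiffAt {φ : EndoField I M} (hφ : φ.IsSmooth) {x₀ : M} {y : E}
    (hy : y ∈ (extChartAt I x₀).target) : ContDiffAt ℝ ∞ (φ.inChart x₀) y :=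
  (hφ x₀).contDiffAt ((isOpen_extChartAt_target x₀).mem_nhds hy)

theorem Form.IsSmooth.contDiffAt {k : ℕ} {F : Type*} [NormedAddCommGroup F] [NormedSpace ℝ F]
    {α : Form I M k F} (hα : α.IsSmooth) {x₀ : M} {y : E}
    (hy : y ∈ (extChartAt I x₀).target) : ContDiffAt ℝ ∞ (α.inChart x₀) y :=
  (hα x₀).contDiffAt ((isOpen_extChartAt_target x₀).mem_nhds hy)

theorem Form.IsSmooth.diffAt {k : ℕ} {F : Type*} [NormedAddCommGroup F] [NormedSpace ℝ F]
    {α : Form I M k F} (hα : α.IsSmooth) (x : M) : α.DiffAt x :=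
  (hα.contDiffAt (mem_extChartAt_target x)).differentiableAt (by simp)

end

variable [IsManifold I ∞ M]

theorem chartDeriv_self (x : M) :
    chartDeriv I x (extChartAt I x x) = ContinuousLinearMap.id ℝ E := by
  have : IsManifold I 1 M := IsManifold.of_le (n := ∞) (by norm_cast)
  rw [chartDeriv, extChartAt_to_inv]
  exact mfderiv_extChartAt_self

/-- The coordinate expression of a vector field in the chart around `x₀`. -/
def vfInChart (X : (x : M) → TangentSpace I x) (x₀ : M) (y : E) : E :=
  chartDeriv I x₀ y (X ((extChartAt I x₀).symm y))

theorem vfInChart_self (X : (x : M) → TangentSpace I x) (x : M) :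
    vfInChart X x (extChartAt I x x) = X x := by
  rw [vfInChart, chartDeriv_self, extChartAt_to_inv]
  rfl

theorem exists_smooth_vectorField (x : M) (v : TangentSpace I x) :
    ∃ X : (x : M) → TangentSpace I x, IsSmoothVFAt X x ∧ X x = v :=
  ⟨FiberBundle.extend E v, FiberBundle.contMDiffAt_extend (k := ∞) I E v, by simp⟩

variable [I.Boundaryless]

theorem chartDeriv_comp_symmDeriv {x₀ : M} {y : E} (hy : y ∈ (extChartAt I x₀).target) :
    chartDeriv I x₀ y ∘L symmDeriv I x₀ y = ContinuousLinearMap.id ℝ E := by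
  have : IsManifold I 1 M := IsManifold.of_le (n := ∞) (by norm_cast)
  have h := mfderiv_extChartAt_comp_mfderivWithin_extChartAt_symm (I := I) hy
  rw [I.range_eq_univ, mfderivWithin_univ] at h
  exact h

theorem symmDeriv_comp_chartDeriv {x₀ : M} {y : E} (hy : y ∈ (extChartAt I x₀).target) :
    symmDeriv I x₀ y ∘L chartDeriv I x₀ y = ContinuousLinearMap.id ℝ E := by
  have : IsManifold I 1 M := IsManifold.of_le (n := ∞) (by norm_cast)
  have h := mfderivWithin_extChartAt_symm_comp_mfderiv_extChartAt (I := I) hy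
  rw [I.range_eq_univ, mfderivWithin_univ] at h
  exact h

theorem chartDeriv_symmDeriv {x₀ : M} {y : E} (hy : y ∈ (extChartAt I x₀).target) (v : E) :
    chartDeriv I x₀ y (symmDeriv I x₀ y v) = v :=
  DFunLike.congr_fun (chartDeriv_comp_symmDeriv hy) v

theorem symmDeriv_chartDeriv {x₀ : M} {y : E} (hy : y ∈ (extChartAt I x₀).target) (v : E) :
    symmDeriv I x₀ y (chartDeriv I x₀ y v) = v :=
  DFunLike.congr_fun (symmDeriv_comp_chartDeriv hy) v

theorem symmDeriv_self (x : M) :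
    symmDeriv I x (extChartAt I x x) = ContinuousLinearMap.id ℝ E := by
  have h := chartDeriv_comp_symmDeriv (mem_extChartAt_target (I := I) x)
  rwa [chartDeriv_self, ContinuousLinearMap.id_comp] at h

theorem contDiffAt_vfInChart {X : (x : M) → TangentSpace I x} {x₀ : M} {y : E}
    (hy : y ∈ (extChartAt I x₀).target) (hX : IsSmoothVFAt X ((extChartAt I x₀).symm y)) :
    ContDiffAt ℝ ∞ (vfInChart X x₀) y := by
  have i1 : IsManifold I 1 M := IsManifold.of_le (n := ∞) (by norm_cast)
  have hs : (extChartAt I x₀).symm y ∈ (chartAt H x₀).source := by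
    rw [← extChartAt_source (I := I)]
    exact (extChartAt I x₀).map_target hy
  have h1 := ((trivializationAt E (TangentSpace I : M → Type _) x₀).contMDiffAt_section_iff
    (IB := I) (n := ∞) (s := X) (x₀ := (extChartAt I x₀).symm y) hs).1 hX
  have h2 : ContMDiffAt 𝓘(ℝ, E) I ∞ (extChartAt I x₀).symm y :=
    (contMDiffOn_extChartAt_symm x₀).contMDiffAt ((isOpen_extChartAt_target x₀).mem_nhds hy)
  have h3 := (h1.comp y h2).contDiffAt
  refine h3.congr_of_eventuallyEq ?_
  filter_upwards [(isOpen_extChartAt_target x₀).mem_nhds hy] with w hw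
  have hw' : (extChartAt I x₀).symm w ∈ (chartAt H x₀).source := by
    rw [← extChartAt_source (I := I)]
    exact (extChartAt I x₀).map_target hw
  have h4 := TangentBundle.continuousLinearMapAt_trivializationAt (𝕜 := ℝ) (I := I) hw'
  have h5 := (trivializationAt E (TangentSpace I : M → Type _) x₀).coe_linearMapAt_of_mem (R := ℝ)
    (b := (extChartAt I x₀).symm w) hw'
  have h6 := congrFun h5 (X ((extChartAt I x₀).symm w))
  refine Eq.trans ?_ h6
  exact (DFunLike.congr_fun h4 (X ((extChartAt I x₀).symm w))).symm

theorem mpullbackWithin_eq_vfInChart (X : (x : M) → TangentSpace I x) {x₀ : M} {y : E}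
    (hy : y ∈ (extChartAt I x₀).target) :
    VectorField.mpullbackWithin 𝓘(ℝ, E) I (extChartAt I x₀).symm X (Set.range I) y =
      vfInChart X x₀ y := by
  rw [I.range_eq_univ, VectorField.mpullbackWithin_univ, VectorField.mpullback_apply]
  have : (symmDeriv I x₀ y).inverse = chartDeriv I x₀ y :=
    ContinuousLinearMap.inverse_eq (symmDeriv_comp_chartDeriv hy) (chartDeriv_comp_symmDeriv hy)
  exact DFunLike.congr_fun this _

/-- The Lie bracket of vector fields at `x`, computed in the chart around `x`. -/
theorem mlieBracket_eq_lieBracket (X Y : (x : M) → TangentSpace I x) (x : M) :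
    VectorField.mlieBracket I X Y x =
      VectorField.lieBracket ℝ (vfInChart X x) (vfInChart Y x) (extChartAt I x x) := by
  have i1 : IsManifold I 1 M := IsManifold.of_le (n := ∞) (by norm_cast)
  rw [VectorField.mlieBracket, VectorField.mlieBracketWithin_apply, mfderiv_extChartAt_self]
  have hev : ∀ Z : (x : M) → TangentSpace I x,
      (VectorField.mpullbackWithin 𝓘(ℝ, E) I (extChartAt I x).symm Z (Set.range I)) =ᶠ[
        nhds (extChartAt I x x)] vfInChart Z x := fun Z => by
    filter_upwards [extChartAt_target_mem_nhds x] with y hy using mpullbackWithin_eq_vfInChart Z hy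
  have h := (hev X).lieBracket_vectorField_eq (𝕜 := ℝ) (hev Y)
  rw [Set.preimage_univ, Set.univ_inter]
  refine Eq.trans ?_ h
  have e := congrArg (fun s => VectorField.lieBracketWithin ℝ
      (VectorField.mpullbackWithin 𝓘(ℝ, E) I (extChartAt I x).symm X (Set.range I))
      (VectorField.mpullbackWithin 𝓘(ℝ, E) I (extChartAt I x).symm Y (Set.range I)) s
      (extChartAt I x x)) I.range_eq_univ
  have u := congrFun (VectorField.lieBracketWithin_univ (𝕜 := ℝ)
      (V := VectorField.mpullbackWithin 𝓘(ℝ, E) I (extChartAt I x).symm X (Set.range I))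
      (W := VectorField.mpullbackWithin 𝓘(ℝ, E) I (extChartAt I x).symm Y (Set.range I)))
      (extChartAt I x x)
  refine Eq.trans ?_ (e.trans u)
  exact DFunLike.congr_fun (ContinuousLinearMap.inverse_id (R := ℝ) (M := E)) _

theorem vfInChart_endo (φ : EndoField I M) (X : (x : M) → TangentSpace I x) {x₀ : M} {y : E}
    (hy : y ∈ (extChartAt I x₀).target) :
    vfInChart (fun p => φ p (X p)) x₀ y = φ.inChart x₀ y (vfInChart X x₀ y) := by
  have h := symmDeriv_chartDeriv (I := I) hy (X ((extChartAt I x₀).symm y))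
  have := congrArg (fun w : E => chartDeriv I x₀ y
    ((φ ((extChartAt I x₀).symm y) : E →L[ℝ] E) w)) h
  exact this.symm

theorem EndoField.inChart_self (φ : EndoField I M) (x : M) :
    (φ.inChart x (extChartAt I x x) : E →L[ℝ] E) = φ x := by
  have h1 := chartDeriv_self (I := I) x
  have h2 := symmDeriv_self (I := I) x
  refine ContinuousLinearMap.ext fun v : E => ?_
  change chartDeriv I x (extChartAt I x x)
    ((φ ((extChartAt I x).symm (extChartAt I x x)) : E →L[ℝ] E)
      (symmDeriv I x (extChartAt I x x) v)) = (φ x : E →L[ℝ] E) v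
  rw [h1, h2]
  exact congrArg (fun p => (φ p : E →L[ℝ] E) v) (extChartAt_to_inv x)

/-- The coordinate expression of the Nijenhuis torsion of a field of endomorphisms, in terms of its
value `P` at a point and its derivative `D` there. -/
def nijenhuisJet (P : E →L[ℝ] E) (D : E →L[ℝ] E →L[ℝ] E) (u v : E) : E :=
  D (P u) v - D (P v) u + P (D v u - D u v)

/-- The derivatives of the vector fields cancel, so the torsion is tensorial. -/
theorem nijenhuis_eq_nijenhuisJet {φ : EndoField I M} (hφ : φ.IsSmooth)
    {X Y : (x : M) → TangentSpace I x} {x : M} (hX : IsSmoothVFAt X x) (hY : IsSmoothVFAt Y x) :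
    nijenhuis φ X Y x =
      nijenhuisJet (E := E) (φ x) (fderiv ℝ (φ.inChart x) (extChartAt I x x)) (X x) (Y x) := by
  set y₀ := extChartAt I x x with hy₀
  have mem : y₀ ∈ (extChartAt I x).target := mem_extChartAt_target x
  have dφ : DifferentiableAt ℝ (φ.inChart x) y₀ := (hφ.contDiffAt mem).differentiableAt (by simp)
  have dX : DifferentiableAt ℝ (vfInChart X x) y₀ := (contDiffAt_vfInChart mem
    (by rwa [hy₀, extChartAt_to_inv])).differentiableAt (by simp)
  have dY : DifferentiableAt ℝ (vfInChart Y x) y₀ := (contDiffAt_vfInChart mem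
    (by rwa [hy₀, extChartAt_to_inv])).differentiableAt (by simp)
  have hev : ∀ Z : (x : M) → TangentSpace I x, vfInChart (fun p => φ p (Z p)) x =ᶠ[nhds y₀]
      fun y => φ.inChart x y (vfInChart Z x y) := fun Z => by
    filter_upwards [extChartAt_target_mem_nhds x] with y hy using vfInChart_endo φ Z hy
  have hd : ∀ Z : (x : M) → TangentSpace I x, DifferentiableAt ℝ (vfInChart Z x) y₀ → ∀ w : E,
      fderiv ℝ (vfInChart (fun p => φ p (Z p)) x) y₀ w =
        φ.inChart x y₀ (fderiv ℝ (vfInChart Z x) y₀ w) +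
          fderiv ℝ (φ.inChart x) y₀ w (vfInChart Z x y₀) := fun Z dZ w => by
    rw [(hev Z).fderiv_eq, fderiv_clm_apply dφ dZ]
    rfl
  have e : ∀ Z : (x : M) → TangentSpace I x, vfInChart (fun p => φ p (Z p)) x y₀ =
      φ.inChart x y₀ (vfInChart Z x y₀) := fun Z => vfInChart_endo φ Z mem
  have hP : (φ x : E →L[ℝ] E) = φ.inChart x y₀ := (EndoField.inChart_self φ x).symm
  have hXx : (X x : E) = vfInChart X x y₀ := (vfInChart_self X x).symm
  have hYx : (Y x : E) = vfInChart Y x y₀ := (vfInChart_self Y x).symm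
  have key : ∀ P : E →L[ℝ] E, P = φ.inChart x y₀ → ∀ u v : E, u = vfInChart X x y₀ →
      v = vfInChart Y x y₀ →
    P (P (VectorField.lieBracket ℝ (vfInChart X x) (vfInChart Y x) y₀)) +
      VectorField.lieBracket ℝ (vfInChart (fun p => φ p (X p)) x)
        (vfInChart (fun p => φ p (Y p)) x) y₀ -
      P (VectorField.lieBracket ℝ (vfInChart (fun p => φ p (X p)) x) (vfInChart Y x) y₀) -
      P (VectorField.lieBracket ℝ (vfInChart X x) (vfInChart (fun p => φ p (Y p)) x) y₀) =
      nijenhuisJet P (fderiv ℝ (φ.inChart x) y₀) u v := by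
    rintro P rfl u v rfl rfl
    simp only [VectorField.lieBracket, hd X dX, hd Y dY, e X, e Y, nijenhuisJet, map_sub, map_add]
    abel
  have := key (φ x) hP (X x) (Y x) hXx hYx
  rw [← this]
  simp only [nijenhuis, mlieBracket_eq_lieBracket]
  rfl

end ChartCalculus

/-! ### First order jets of Sasakian structures -/

section Jets

/-- The values and the first derivatives, at one point of a coordinate domain, of the tensors
`φ`, `ξ`, `η` of a Sasakian structure, with the relations that the axioms impose on them. The
derivative comes first: `Dφ h v` is the derivative in the direction `h` of `φ`, applied to `v`. The
relations `contact_ξ` and `contact_φ` say that `dη` is killed by `ξ` and invariant under `φ`. -/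
structure ContactJet (E : Type*) [NormedAddCommGroup E] [NormedSpace ℝ E] where
  φ : E →L[ℝ] E
  Dφ : E →L[ℝ] E →L[ℝ] E
  ξ : E
  Dξ : E →L[ℝ] E
  η : E →L[ℝ] ℝ
  Dη : E →L[ℝ] E →L[ℝ] ℝ
  φ_sq : ∀ v, φ (φ v) = -v + η v • ξ
  φ_ξ : φ ξ = 0
  η_ξ : η ξ = 1
  η_φ : ∀ v, η (φ v) = 0
  deriv_φ_ξ : ∀ h, Dφ h ξ + φ (Dξ h) = 0
  deriv_η_ξ : ∀ h, Dη h ξ + η (Dξ h) = 0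
  deriv_η_φ : ∀ h v, Dη h (φ v) + η (Dφ h v) = 0
  normal : ∀ u v, nijenhuisJet φ Dφ u v + (Dη u v - Dη v u) • ξ = 0
  contact_ξ : ∀ v, Dη ξ v - Dη v ξ = 0
  contact_φ : ∀ u v, (Dη (φ u) v - Dη v (φ u)) + (Dη u (φ v) - Dη (φ v) u) = 0

variable {E : Type*} [NormedAddCommGroup E] [NormedSpace ℝ E]
variable {E' : Type*} [NormedAddCommGroup E'] [NormedSpace ℝ E']

/-- The Lie derivative of `φ` along `ξ` vanishes: by normality `φ` kills it, and so does `η`. -/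
theorem ContactJet.lie_φ (j : ContactJet E) (v : E) :
    j.Dφ j.ξ v - j.Dξ (j.φ v) + j.φ (j.Dξ v) = 0 := by
  set L := j.Dφ j.ξ v - j.Dξ (j.φ v) + j.φ (j.Dξ v) with hL
  have h1 : j.φ L = 0 := by
    have hn := j.normal j.ξ v
    rw [j.contact_ξ, zero_smul, add_zero, nijenhuisJet, j.φ_ξ, map_zero] at hn
    have e1 := j.deriv_φ_ξ (j.φ v)
    have e2 := congrArg j.φ (j.deriv_φ_ξ v)
    rw [hL]
    simp only [map_add, map_sub, map_zero, zero_apply] at hn e2 ⊢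
    linear_combination (norm := module) -hn - e1 + e2
  have h2 : j.η L = 0 := by
    have e1 := j.deriv_η_φ j.ξ v
    have e2 := j.deriv_η_ξ (j.φ v)
    have e3 := j.contact_ξ (j.φ v)
    rw [hL]
    simp only [map_add, map_sub, j.η_φ]
    linear_combination e1 - e2 - e3
  have h3 := j.φ_sq L
  rw [h1, h2, map_zero, zero_smul, add_zero] at h3
  exact neg_eq_zero.1 h3.symm

/-- The first component of the Nijenhuis torsion of the product structure. The second one is of the
same shape with the roles of the factors exchanged, which is why the jet of `J` enters through its
components `DJ` and `DJ'`. -/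
theorem ContactJet.nijenhuis_component (j : ContactJet E) (k : ContactJet E') {p q r s : ℝ}
    (h1 : 1 + p * p + q * r = 0) (h2 : p + s = 0) (u v Ju Jv : E) (u' v' Ju' Jv' : E')
    (DJ : E → E' → E → E' → E) (DJ' : E → E' → E → E' → E')
    (hJu : Ju = j.φ u + (p * j.η u + q * k.η u') • j.ξ)
    (hJv : Jv = j.φ v + (p * j.η v + q * k.η v') • j.ξ)
    (hJu' : Ju' = k.φ u' + (s * k.η u' + r * j.η u) • k.ξ)
    (hJv' : Jv' = k.φ v' + (s * k.η v' + r * j.η v) • k.ξ)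
    (hDJ : ∀ h h' w w', DJ h h' w w' = j.Dφ h w + (p * j.Dη h w + q * k.Dη h' w') • j.ξ +
      (p * j.η w + q * k.η w') • j.Dξ h)
    (hDJ' : ∀ h h' w w', DJ' h h' w w' = k.Dφ h' w' + (s * k.Dη h' w' + r * j.Dη h w) • k.ξ +
      (s * k.η w' + r * j.η w) • k.Dξ h') :
    DJ Ju Ju' v v' - DJ Jv Jv' u u' + (j.φ (DJ v v' u u' - DJ u u' v v') +
      (p * j.η (DJ v v' u u' - DJ u u' v v') + q * k.η (DJ' v v' u u' - DJ' u u' v v')) • j.ξ)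
      = 0 := by
  have e : ∀ h h' w w', j.η (DJ h h' w w') =
      -j.Dη h (j.φ w + (p * j.η w + q * k.η w') • j.ξ) + p * j.Dη h w + q * k.Dη h' w' := by
    intro h h' w w'
    have a1 := j.deriv_η_φ h w
    have a2 := j.deriv_η_ξ h
    rw [hDJ]
    simp only [map_add, map_smul, smul_eq_mul, j.η_ξ]
    linear_combination a1 + (p * j.η w + q * k.η w') * a2
  have e' : ∀ h h' w w', k.η (DJ' h h' w w') =
      -k.Dη h' (k.φ w' + (s * k.η w' + r * j.η w) • k.ξ) + s * k.Dη h' w' + r * j.Dη h w := by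
    intro h h' w w'
    have a1 := k.deriv_η_φ h' w'
    have a2 := k.deriv_η_ξ h'
    rw [hDJ']
    simp only [map_add, map_smul, smul_eq_mul, k.η_ξ]
    linear_combination a1 + (s * k.η w' + r * j.η w) * a2
  have hs : s = -p := by linear_combination h2
  -- the total coefficient of `ξ`, up to the summand `dη(u, v)` supplied by normality
  have scal : (p * j.Dη Ju v + q * k.Dη Ju' v') - (p * j.Dη Jv u + q * k.Dη Jv' u') +
      (p * (j.η (DJ v v' u u') - j.η (DJ u u' v v')) +
        q * (k.η (DJ' v v' u u') - k.η (DJ' u u' v v'))) - (j.Dη u v - j.Dη v u) = 0 := by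
    rw [e, e, e', e', hJu, hJv, hJu', hJv', hs]
    simp only [map_add, map_smul, smul_eq_mul, add_apply, smul_apply]
    have c1 := j.contact_φ u v
    have c2 := k.contact_φ u' v'
    have c3 := j.contact_ξ u
    have c4 := j.contact_ξ v
    have c5 := k.contact_ξ u'
    have c6 := k.contact_ξ v'
    linear_combination p * c1 + q * c2 + p * (p * j.η u + q * k.η u') * c4 -
      p * (p * j.η v + q * k.η v') * c3 + q * (-p * k.η u' + r * j.η u) * c6 -
      q * (-p * k.η v' + r * j.η v) * c5 - (j.Dη u v - j.Dη v u) * h1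
  have n := j.normal u v
  have l1 := j.lie_φ u
  have l2 := j.lie_φ v
  have scal' := congrArg (fun c : ℝ => c • j.ξ) scal
  rw [nijenhuisJet] at n
  simp only [zero_smul] at scal'
  rw [map_sub j.η, map_sub k.η]
  generalize j.η (DJ v v' u u') = t1 at *
  generalize j.η (DJ u u' v v') = t2 at *
  generalize k.η (DJ' v v' u u') = t3 at *
  generalize k.η (DJ' u u' v v') = t4 at *
  simp only [hDJ]
  simp only [hJu, hJv, map_add, map_sub, map_smul, smul_eq_mul, add_apply, smul_apply, j.φ_ξ,
    smul_zero] at scal' n ⊢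
  linear_combination (norm := module) n + (p * j.η u + q * k.η u') • l2 -
    (p * j.η v + q * k.η v') • l1 + scal'

/-- The product structure built from two Sasakian structures has vanishing Nijenhuis torsion. -/
theorem nijenhuisJet_prod_eq_zero (j : ContactJet E) (k : ContactJet E') {p q r s : ℝ}
    (h1 : 1 + p * p + q * r = 0) (h2 : p + s = 0) {P : E × E' →L[ℝ] E × E'}
    {D : E × E' →L[ℝ] E × E' →L[ℝ] E × E'}
    (hP : ∀ w, P w = (j.φ w.1 + (p * j.η w.1 + q * k.η w.2) • j.ξ,
      k.φ w.2 + (s * k.η w.2 + r * j.η w.1) • k.ξ))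
    (hD : ∀ h w, D h w =
      (j.Dφ h.1 w.1 + (p * j.Dη h.1 w.1 + q * k.Dη h.2 w.2) • j.ξ +
        (p * j.η w.1 + q * k.η w.2) • j.Dξ h.1,
      k.Dφ h.2 w.2 + (s * k.Dη h.2 w.2 + r * j.Dη h.1 w.1) • k.ξ +
        (s * k.η w.2 + r * j.η w.1) • k.Dξ h.2)) (u v : E × E') :
    nijenhuisJet P D u v = 0 := by
  have hf : ∀ w, (P w).1 = j.φ w.1 + (p * j.η w.1 + q * k.η w.2) • j.ξ := fun w => by rw [hP]
  have hs : ∀ w, (P w).2 = k.φ w.2 + (s * k.η w.2 + r * j.η w.1) • k.ξ := fun w => by rw [hP]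
  have hDf : ∀ h w, (D h w).1 = j.Dφ h.1 w.1 + (p * j.Dη h.1 w.1 + q * k.Dη h.2 w.2) • j.ξ +
        (p * j.η w.1 + q * k.η w.2) • j.Dξ h.1 := fun h w => by rw [hD]
  have hDs : ∀ h w, (D h w).2 = k.Dφ h.2 w.2 + (s * k.Dη h.2 w.2 + r * j.Dη h.1 w.1) • k.ξ +
        (s * k.η w.2 + r * j.η w.1) • k.Dξ h.2 := fun h w => by rw [hD]
  have h1' : 1 + s * s + r * q = 0 := by
    rw [show s = -p by linear_combination h2]
    linear_combination h1
  apply Prod.ext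
  · have := j.nijenhuis_component k h1 h2 u.1 v.1 (P u).1 (P v).1 u.2 v.2 (P u).2 (P v).2
      (fun h h' w w' => (D (h, h') (w, w')).1) (fun h h' w w' => (D (h, h') (w, w')).2)
      (hf u) (hf v) (hs u) (hs v) (fun h h' w w' => hDf (h, h') (w, w'))
      (fun h h' w w' => hDs (h, h') (w, w'))
    rw [nijenhuisJet]
    simp only [Prod.fst_add, Prod.fst_sub, Prod.fst_zero, hf (D v u - D u v), Prod.snd_sub]
    exact this
  · have := k.nijenhuis_component j h1' ((add_comm _ _).trans h2) u.2 v.2 (P u).2 (P v).2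
      u.1 v.1 (P u).1 (P v).1
      (fun h' h w' w => (D (h, h') (w, w')).2) (fun h' h w' w => (D (h, h') (w, w')).1)
      (hs u) (hs v) (hf u) (hf v) (fun h' h w' w => hDs (h, h') (w, w'))
      (fun h' h w' w => hDf (h, h') (w, w'))
    rw [nijenhuisJet]
    simp only [Prod.snd_add, Prod.fst_sub, Prod.snd_zero, hs (D v u - D u v), Prod.snd_sub]
    exact this

end Jets

/-! ### The exterior derivative in an arbitrary chart -/

section Naturality

variable {E : Type*} [NormedAddCommGroup E] [NormedSpace ℝ E]
variable {H : Type*} [TopologicalSpace H] {I : ModelWithCorners ℝ E H}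
variable {M : Type*} [TopologicalSpace M] [ChartedSpace H M]
variable {k : ℕ} {F : Type*} [NormedAddCommGroup F] [NormedSpace ℝ F]

theorem Form.inChart_apply (α : Form I M k F) (x₀ : M) (y : E) (v : Fin k → E) :
    α.inChart x₀ y v =
      (α ((extChartAt I x₀).symm y) : E [⋀^Fin k]→L[ℝ] F) (fun i => symmDeriv I x₀ y (v i)) := rfl

variable [IsManifold I ∞ M] [I.Boundaryless]

/-- The derivative of a coordinate change. -/
theorem hasFDerivAt_coordChange {x₀ p : M} {w : E} (hw : w ∈ (extChartAt I p).target)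
    (hw₀ : (extChartAt I p).symm w ∈ (extChartAt I x₀).source) :
    HasFDerivAt (extChartAt I x₀ ∘ (extChartAt I p).symm)
      (chartDeriv I x₀ (extChartAt I x₀ ((extChartAt I p).symm w)) ∘L symmDeriv I p w) w := by
  have i1 : IsManifold I 1 M := IsManifold.of_le (n := ∞) (by norm_cast)
  have h1 : MDifferentiableAt 𝓘(ℝ, E) I (extChartAt I p).symm w :=
    mdifferentiableOn_extChartAt_symm.mdifferentiableAt
      ((isOpen_extChartAt_target p).mem_nhds hw)
  rw [extChartAt_source] at hw₀
  have h2 : MDifferentiableAt I 𝓘(ℝ, E) (extChartAt I x₀) ((extChartAt I p).symm w) :=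
    mdifferentiableAt_extChartAt hw₀
  have h3 := h2.hasMFDerivAt.comp w h1.hasMFDerivAt
  have h4 := hasMFDerivAt_iff_hasFDerivAt.1 h3
  rw [← extChartAt_source (I := I)] at hw₀
  refine h4.congr_fderiv ?_
  have e : chartDeriv I x₀ (extChartAt I x₀ ((extChartAt I p).symm w)) =
      (mfderiv I 𝓘(ℝ, E) (extChartAt I x₀) ((extChartAt I p).symm w) : E →L[ℝ] E) := by
    rw [chartDeriv, (extChartAt I x₀).left_inv hw₀]
  rw [e]
  rfl

theorem contDiffAt_coordChange {x₀ p : M} {w : E} (hw : w ∈ (extChartAt I p).target)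
    (hw₀ : (extChartAt I p).symm w ∈ (extChartAt I x₀).source) :
    ContDiffAt ℝ ∞ (extChartAt I x₀ ∘ (extChartAt I p).symm) w := by
  have h := contDiffWithinAt_ext_coord_change (I := I) (n := ∞) x₀ p (y := w)
    (by rw [PartialEquiv.trans_source, PartialEquiv.symm_source]; exact ⟨hw, hw₀⟩)
  rwa [I.range_eq_univ, contDiffWithinAt_univ] at h

/-- The exterior derivative may be computed in any chart. -/
theorem Form.inChart_d {α : Form I M k F} (hα : α.IsSmooth) {x₀ : M} {y : E}
    (hy : y ∈ (extChartAt I x₀).target) :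
    α.d.inChart x₀ y = extDeriv (α.inChart x₀) y := by
  set p := (extChartAt I x₀).symm y with hp
  set w₀ := extChartAt I p p with hw₀
  set τ := extChartAt I x₀ ∘ (extChartAt I p).symm with hτ
  have mem : w₀ ∈ (extChartAt I p).target := mem_extChartAt_target p
  have hps : (extChartAt I p).symm w₀ = p := extChartAt_to_inv p
  have hpx : p ∈ (extChartAt I x₀).source := (extChartAt I x₀).map_target hy
  have hτ₀ : τ w₀ = y := by
    rw [hτ, Function.comp_apply, hps, hp, (extChartAt I x₀).right_inv hy]
  have hev : α.inChart p =ᶠ[nhds w₀] fun w =>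
      (α.inChart x₀ (τ w)).compContinuousLinearMap (fderiv ℝ τ w) := by
    have hc : ContinuousAt (extChartAt I p).symm w₀ := continuousAt_extChartAt_symm p
    have hs : (extChartAt I x₀).source ∈ nhds ((extChartAt I p).symm w₀) := by
      rw [hps]
      exact (isOpen_extChartAt_source x₀).mem_nhds hpx
    filter_upwards [(isOpen_extChartAt_target p).mem_nhds mem, hc.preimage_mem_nhds hs]
      with w hw hw'
    have hw'' : τ w ∈ (extChartAt I x₀).target := (extChartAt I x₀).map_source hw'
    rw [(hasFDerivAt_coordChange hw hw').fderiv]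
    have e : (extChartAt I x₀).symm (τ w) = (extChartAt I p).symm w :=
      (extChartAt I x₀).left_inv hw'
    ext v
    rw [ContinuousAlternatingMap.compContinuousLinearMap_apply, Form.inChart_apply,
      Form.inChart_apply, e]
    refine congrArg (α ((extChartAt I p).symm w) : E [⋀^Fin k]→L[ℝ] F) (funext fun i => ?_)
    exact (symmDeriv_chartDeriv hw'' _).symm
  have hpy : (extChartAt I p).symm w₀ ∈ (extChartAt I x₀).source := by rwa [hps]
  have h1 : extDeriv (α.inChart p) w₀ =
      (extDeriv (α.inChart x₀) y).compContinuousLinearMap (chartDeriv I x₀ y) := by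
    rw [hev.extDeriv_eq, extDeriv_pullback (r := ∞) (f := τ)
      (by rw [hτ₀]; exact (hα.contDiffAt hy).differentiableAt (by simp))
      (contDiffAt_coordChange mem hpy) (by
        rw [minSmoothness_of_isRCLikeNormedField]
        exact WithTop.coe_le_coe.2 le_top), hτ₀,
      (hasFDerivAt_coordChange mem hpy).fderiv, symmDeriv_self, ContinuousLinearMap.comp_id]
    congr 2
  have h2 := (Form.d_apply α p).trans h1
  ext v
  rw [Form.inChart_apply]
  refine (DFunLike.congr_fun h2 _).trans ?_
  refine congrArg (extDeriv (α.inChart x₀) y) (funext fun i => ?_)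
  exact chartDeriv_symmDeriv hy _

theorem contDiffOn_extDeriv {β : E → E [⋀^Fin k]→L[ℝ] F} {s : Set E} (hs : IsOpen s)
    (hβ : ContDiffOn ℝ ∞ β s) : ContDiffOn ℝ ∞ (extDeriv β) s := by
  have h1 : ContDiffOn ℝ ∞ (fderiv ℝ β) s := hβ.fderiv_of_isOpen hs (by simp)
  have h2 := (ContinuousAlternatingMap.alternatizeUncurryFinCLM ℝ E F
    (n := k)).contDiff.comp_contDiffOn h1
  refine h2.congr fun x _ => ?_
  rw [extDeriv]
  simp

theorem Form.IsSmooth.d {α : Form I M k F} (hα : α.IsSmooth) : α.d.IsSmooth := fun x₀ =>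
  (contDiffOn_extDeriv (isOpen_extChartAt_target x₀) (hα x₀)).congr fun _ hy =>
    Form.inChart_d hα hy

end Naturality

/-! ### Covector fields in charts and the fundamental form -/

section SasakianJet

variable {E : Type*} [NormedAddCommGroup E] [NormedSpace ℝ E]
variable {H : Type*} [TopologicalSpace H] {I : ModelWithCorners ℝ E H}
variable {M : Type*} [TopologicalSpace M] [ChartedSpace H M]

/-- The coordinate expression of a field of covectors in the chart around `x₀`. -/
def covectorInChart (η : (x : M) → TangentSpace I x →L[ℝ] ℝ) (x₀ : M) (y : E) : E →L[ℝ] ℝ :=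
  (η ((extChartAt I x₀).symm y) : E →L[ℝ] ℝ) ∘L symmDeriv I x₀ y

theorem oneForm_inChart (η : (x : M) → TangentSpace I x →L[ℝ] ℝ) (x₀ : M) (y : E) :
    (oneForm η).inChart x₀ y =
      ContinuousAlternatingMap.ofSubsingletonLIE (𝕜 := ℝ) (0 : Fin 1) (covectorInChart η x₀ y) := rfl

section

variable [I.Boundaryless]

theorem contDiffAt_covectorInChart {η : (x : M) → TangentSpace I x →L[ℝ] ℝ}
    (hη : (oneForm η).IsSmooth) {x₀ : M} {y : E} (hy : y ∈ (extChartAt I x₀).target) :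
    ContDiffAt ℝ ∞ (covectorInChart η x₀) y := by
  have h := (ContinuousAlternatingMap.ofSubsingletonLIE (𝕜 := ℝ) (E := E) (F := ℝ)
    (0 : Fin 1)).symm.contDiff.comp_contDiffAt y (hη.contDiffAt hy)
  refine h.congr_of_eventuallyEq (Filter.Eventually.of_forall fun w => ?_)
  rw [Function.comp_apply, oneForm_inChart, LinearIsometryEquiv.symm_apply_apply]

end

variable [IsManifold I ∞ M]

section

variable [I.Boundaryless]

theorem covectorInChart_self (η : (x : M) → TangentSpace I x →L[ℝ] ℝ) (x : M) :
    covectorInChart η x (extChartAt I x x) = (η x : E →L[ℝ] ℝ) := by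
  rw [covectorInChart, symmDeriv_self, extChartAt_to_inv]
  rfl

theorem oneForm_d_apply {η : (x : M) → TangentSpace I x →L[ℝ] ℝ} (hη : (oneForm η).IsSmooth)
    (x : M) (u v : E) :
    ((oneForm η).d x : E [⋀^Fin 2]→L[ℝ] ℝ) ![u, v] =
      fderiv ℝ (covectorInChart η x) (extChartAt I x x) u v -
        fderiv ℝ (covectorInChart η x) (extChartAt I x x) v u := by
  have hd := hη.diffAt x
  have hc : DifferentiableAt ℝ (covectorInChart η x) (extChartAt I x x) :=
    (contDiffAt_covectorInChart hη (mem_extChartAt_target x)).differentiableAt (by simp)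
  refine (congrArg (fun β : E [⋀^Fin 2]→L[ℝ] ℝ => β ![u, v]) (Form.d_apply (oneForm η) x)).trans ?_
  refine (extDeriv_apply hd ![u, v]).trans ?_
  rw [Fin.sum_univ_two]
  have e : ∀ w : Fin 1 → E, (fun y => (oneForm η).inChart x y w) =
      fun y => covectorInChart η x y (w 0) := fun w => rfl
  rw [e, e, fderiv_clm_apply hc (differentiableAt_const _),
    fderiv_clm_apply hc (differentiableAt_const _)]
  simp [Fin.removeNth, sub_eq_add_neg]

end

namespace AlmostContactMetric

variable (𝒮 : AlmostContactMetric I M)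

theorem Φ_apply (x : M) (u v : TangentSpace I x) :
    𝒮.Φ x ![u, v] = 𝒮.g.inner x (𝒮.φ x u) v := rfl

theorem Φ_ξ_left (x : M) (v : TangentSpace I x) : 𝒮.Φ x ![𝒮.ξ x, v] = 0 := by
  rw [Φ_apply, 𝒮.φ_ξ, map_zero]
  rfl

theorem Φ_swap (x : M) (u v : TangentSpace I x) : 𝒮.Φ x ![u, v] = -𝒮.Φ x ![v, u] := by
  have := (𝒮.Φ x).map_swap ![v, u] (show (0 : Fin 2) ≠ 1 by decide)
  refine Eq.trans (congrArg (𝒮.Φ x) ?_) this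
  ext i
  fin_cases i <;> rfl

theorem Φ_ξ_right (x : M) (v : TangentSpace I x) : 𝒮.Φ x ![v, 𝒮.ξ x] = 0 := by
  rw [Φ_swap, Φ_ξ_left, neg_zero]

theorem Φ_φ_φ (x : M) (u v : TangentSpace I x) :
    𝒮.Φ x ![𝒮.φ x u, 𝒮.φ x v] = 𝒮.Φ x ![u, v] := by
  rw [Φ_apply, 𝒮.compatible, 𝒮.η_φ, zero_mul, sub_zero]
  rfl

theorem Φ_φ_add (x : M) (u v : TangentSpace I x) :
    𝒮.Φ x ![𝒮.φ x u, v] + 𝒮.Φ x ![u, 𝒮.φ x v] = 0 := by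
  rw [Φ_apply, Φ_apply, 𝒮.compatible, 𝒮.φ_sq]
  simp only [map_add, map_neg, map_smul, add_apply, neg_apply, smul_apply, smul_eq_mul]
  have h := 𝒮.compatible x (𝒮.ξ x) v
  rw [𝒮.φ_ξ, map_zero, 𝒮.η_ξ] at h
  simp only [zero_apply] at h
  linear_combination (𝒮.η x u) * (-h)

end AlmostContactMetric

end SasakianJet

/-! ### The jet of a Sasakian structure -/

section ContactJetOfSasakian

variable {E : Type*} [NormedAddCommGroup E] [NormedSpace ℝ E]
variable {H : Type*} [TopologicalSpace H] {I : ModelWithCorners ℝ E H}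
variable {M : Type*} [TopologicalSpace M] [ChartedSpace H M] [IsManifold I ∞ M] [I.Boundaryless]

theorem covectorInChart_vfInChart (η : (x : M) → TangentSpace I x →L[ℝ] ℝ)
    (X : (x : M) → TangentSpace I x) {x₀ : M} {y : E} (hy : y ∈ (extChartAt I x₀).target) :
    covectorInChart η x₀ y (vfInChart X x₀ y) =
      η ((extChartAt I x₀).symm y) (X ((extChartAt I x₀).symm y)) :=
  congrArg (η ((extChartAt I x₀).symm y) : E →L[ℝ] ℝ) (symmDeriv_chartDeriv hy _)

theorem covectorInChart_endo (η : (x : M) → TangentSpace I x →L[ℝ] ℝ)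
    (φ : EndoField I M) {x₀ : M} {y : E} (hy : y ∈ (extChartAt I x₀).target) (v : E) :
    covectorInChart η x₀ y (φ.inChart x₀ y v) =
      η ((extChartAt I x₀).symm y) (φ ((extChartAt I x₀).symm y) (symmDeriv I x₀ y v)) :=
  congrArg (η ((extChartAt I x₀).symm y) : E →L[ℝ] ℝ) (symmDeriv_chartDeriv hy _)

namespace AlmostContactMetric

variable {𝒮 : AlmostContactMetric I M}

theorem contDiffAt_ξ {x₀ : M} {y : E} (hy : y ∈ (extChartAt I x₀).target) :
    ContDiffAt ℝ ∞ (vfInChart 𝒮.ξ x₀) y :=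
  contDiffAt_vfInChart hy (𝒮.smooth_ξ _)

theorem differentiableAt_φ (x : M) :
    DifferentiableAt ℝ (𝒮.φ.inChart x) (extChartAt I x x) :=
  (𝒮.smooth_φ.contDiffAt (mem_extChartAt_target x)).differentiableAt (by simp)

theorem differentiableAt_ξ (x : M) :
    DifferentiableAt ℝ (vfInChart 𝒮.ξ x) (extChartAt I x x) :=
  (contDiffAt_ξ (mem_extChartAt_target x)).differentiableAt (by simp)

theorem differentiableAt_η (x : M) :
    DifferentiableAt ℝ (covectorInChart 𝒮.η x) (extChartAt I x x) :=
  (contDiffAt_covectorInChart 𝒮.smooth_η (mem_extChartAt_target x)).differentiableAt (by simp)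

/-- The definition of an almost contact metric structure does not mention the smoothness of `Φ`; for
Sasakian structures it follows from `Φ = dη`. -/
theorem IsSasakian.isSmooth_Φ (h : 𝒮.IsSasakian) : 𝒮.Φ.IsSmooth :=
  h.contact ▸ 𝒮.smooth_η.d

theorem IsSasakian.Φ_eq (h : 𝒮.IsSasakian) (x : M) (u v : E) :
    (𝒮.Φ x : E [⋀^Fin 2]→L[ℝ] ℝ) ![u, v] =
      fderiv ℝ (covectorInChart 𝒮.η x) (extChartAt I x x) u v -
        fderiv ℝ (covectorInChart 𝒮.η x) (extChartAt I x x) v u := by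
  rw [← oneForm_d_apply 𝒮.smooth_η, h.contact]

theorem fderiv_φ_ξ (x : M) (v : E) {P : E →L[ℝ] E} (hP : P = 𝒮.φ x) :
    fderiv ℝ (𝒮.φ.inChart x) (extChartAt I x x) v (𝒮.ξ x) +
      P (fderiv ℝ (vfInChart 𝒮.ξ x) (extChartAt I x x) v) = 0 := by
  have hev : (fun y => 𝒮.φ.inChart x y (vfInChart 𝒮.ξ x y)) =ᶠ[nhds (extChartAt I x x)]
      fun _ => 0 := by
    filter_upwards [extChartAt_target_mem_nhds x] with y hy
    rw [← vfInChart_endo 𝒮.φ 𝒮.ξ hy, vfInChart, 𝒮.φ_ξ]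
    exact map_zero (chartDeriv I x y)
  have h := hev.fderiv_eq (𝕜 := ℝ)
  rw [fderiv_clm_apply (differentiableAt_φ x) (differentiableAt_ξ x), fderiv_fun_const] at h
  have h2 := DFunLike.congr_fun h v
  have e1 : vfInChart 𝒮.ξ x (extChartAt I x x) = 𝒮.ξ x := vfInChart_self 𝒮.ξ x
  have e2 : 𝒮.φ.inChart x (extChartAt I x x) = P := (EndoField.inChart_self 𝒮.φ x).trans hP.symm
  rw [e2] at h2
  rw [← e1]
  exact (add_comm _ _).trans h2

theorem fderiv_η_ξ (x : M) (v : E) :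
    fderiv ℝ (covectorInChart 𝒮.η x) (extChartAt I x x) v (𝒮.ξ x) +
      (𝒮.η x : E →L[ℝ] ℝ) (fderiv ℝ (vfInChart 𝒮.ξ x) (extChartAt I x x) v) = 0 := by
  have hev : (fun y => covectorInChart 𝒮.η x y (vfInChart 𝒮.ξ x y)) =ᶠ[nhds (extChartAt I x x)]
      fun _ => 1 := by
    filter_upwards [extChartAt_target_mem_nhds x] with y hy
    rw [covectorInChart_vfInChart 𝒮.η 𝒮.ξ hy, 𝒮.η_ξ]
  have h := hev.fderiv_eq (𝕜 := ℝ)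
  rw [fderiv_clm_apply (differentiableAt_η x) (differentiableAt_ξ x), fderiv_fun_const] at h
  have h2 := DFunLike.congr_fun h v
  have e1 : vfInChart 𝒮.ξ x (extChartAt I x x) = 𝒮.ξ x := vfInChart_self 𝒮.ξ x
  have e2 : covectorInChart 𝒮.η x (extChartAt I x x) = 𝒮.η x := covectorInChart_self 𝒮.η x
  rw [e1, e2] at h2
  exact (add_comm _ _).trans h2

theorem fderiv_η_φ (x : M) (v w : E) :
    fderiv ℝ (covectorInChart 𝒮.η x) (extChartAt I x x) v ((𝒮.φ x : E →L[ℝ] E) w) +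
      (𝒮.η x : E →L[ℝ] ℝ) (fderiv ℝ (𝒮.φ.inChart x) (extChartAt I x x) v w) = 0 := by
  have hev : (fun y => covectorInChart 𝒮.η x y (𝒮.φ.inChart x y w)) =ᶠ[nhds (extChartAt I x x)]
      fun _ => 0 := by
    filter_upwards [extChartAt_target_mem_nhds x] with y hy
    rw [covectorInChart_endo 𝒮.η 𝒮.φ hy]
    exact 𝒮.η_φ _ _
  have h := hev.fderiv_eq (𝕜 := ℝ)
  rw [fderiv_clm_apply (differentiableAt_η x) ((differentiableAt_φ x).clm_apply
    (differentiableAt_const w)), fderiv_clm_apply (differentiableAt_φ x) (differentiableAt_const w),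
    fderiv_fun_const, fderiv_fun_const] at h
  have h2 := DFunLike.congr_fun h v
  have e1 : 𝒮.φ.inChart x (extChartAt I x x) = 𝒮.φ x := EndoField.inChart_self 𝒮.φ x
  have e2 : covectorInChart 𝒮.η x (extChartAt I x x) = 𝒮.η x := covectorInChart_self 𝒮.η x
  simp only [Pi.zero_apply, ContinuousLinearMap.comp_zero, zero_add, add_apply,
    ContinuousLinearMap.comp_apply, ContinuousLinearMap.flip_apply, zero_apply] at h2
  rw [e1, e2] at h2
  exact (add_comm _ _).trans h2

/-- The first order jet at `x` of a Sasakian structure, in the chart around `x`. -/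
def IsSasakian.contactJet (h : 𝒮.IsSasakian) (x : M) : ContactJet E where
  φ := 𝒮.φ x
  Dφ := fderiv ℝ (𝒮.φ.inChart x) (extChartAt I x x)
  ξ := 𝒮.ξ x
  Dξ := fderiv ℝ (vfInChart 𝒮.ξ x) (extChartAt I x x)
  η := 𝒮.η x
  Dη := fderiv ℝ (covectorInChart 𝒮.η x) (extChartAt I x x)
  φ_sq := 𝒮.φ_sq x
  φ_ξ := 𝒮.φ_ξ x
  η_ξ := 𝒮.η_ξ x
  η_φ := 𝒮.η_φ x
  deriv_φ_ξ v := fderiv_φ_ξ x v rfl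
  deriv_η_ξ := fderiv_η_ξ x
  deriv_η_φ := fderiv_η_φ x
  normal u v := by
    obtain ⟨X, hX, rfl⟩ := exists_smooth_vectorField (I := I) x u
    obtain ⟨Y, hY, rfl⟩ := exists_smooth_vectorField (I := I) x v
    have hn := h.normal x X Y hX hY
    rw [nijenhuis_eq_nijenhuisJet 𝒮.smooth_φ hX hY] at hn
    have e := oneForm_d_apply 𝒮.smooth_η x (X x) (Y x)
    rw [← e]
    exact hn
  contact_ξ v := (h.Φ_eq x (𝒮.ξ x) v).symm.trans (𝒮.Φ_ξ_left x v)
  contact_φ u v := (congrArg₂ (· + ·) (h.Φ_eq x (𝒮.φ x u) v) (h.Φ_eq x u (𝒮.φ x v))).symm.trans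
    (𝒮.Φ_φ_add x u v)

end AlmostContactMetric

end ContactJetOfSasakian

/-! ### Complex valued and real valued forms -/

section Complexification

variable {E : Type*} [NormedAddCommGroup E] [NormedSpace ℝ E]
variable {H : Type*} [TopologicalSpace H] {I : ModelWithCorners ℝ E H}
variable {M : Type*} [TopologicalSpace M] [ChartedSpace H M]

theorem complexify_wedge {V : Type*} [NormedAddCommGroup V] [NormedSpace ℝ V] {k l : ℕ}
    (α : V [⋀^Fin k]→L[ℝ] ℝ) (β : V [⋀^Fin l]→L[ℝ] ℝ) :
    complexify (wedge α β) = wedge (complexify α) (complexify β) := by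
  ext v
  rw [complexify_apply, wedge, wedge]
  simp only [ContinuousAlternatingMap.smul_apply,
    ContinuousMultilinearMap.alternatization_apply_apply, Units.smul_def]
  rw [Complex.real_smul, smul_eq_mul, Complex.ofReal_mul, Complex.ofReal_sum]
  congr 1
  refine Finset.sum_congr rfl fun σ _ => ?_
  rw [zsmul_eq_mul, zsmul_eq_mul, Complex.ofReal_mul, Complex.ofReal_intCast]
  congr 1
  exact Complex.ofReal_mul _ _

theorem Form.toComplex_wedge {k l : ℕ} (α : Form I M k ℝ) (β : Form I M l ℝ) :
    (α.wedge β).toComplex = α.toComplex.wedge β.toComplex :=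
  funext fun x => complexify_wedge (V := E) (α x) (β x)

theorem Form.IsSmooth.toComplex {k : ℕ} {α : Form I M k ℝ} (hα : α.IsSmooth) :
    α.toComplex.IsSmooth := fun x₀ =>
  ((ContinuousLinearMap.compContinuousAlternatingMapCLM ℝ E ℝ ℂ (ι := Fin k) Complex.ofRealCLM).contDiff).comp_contDiffOn (hα x₀)

theorem Form.IsSmooth.of_toComplex {k : ℕ} {α : Form I M k ℝ} (hα : α.toComplex.IsSmooth) :
    α.IsSmooth := fun x₀ =>
  (((ContinuousLinearMap.compContinuousAlternatingMapCLM ℝ E ℂ ℝ (ι := Fin k) Complex.reCLM).contDiff).comp_contDiffOn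
    (hα x₀)).congr fun _ _ => rfl

theorem Form.IsSmooth.add {k : ℕ} {α β : Form I M k ℂ} (hα : α.IsSmooth) (hβ : β.IsSmooth) :
    (α + β).IsSmooth := fun x₀ => (hα x₀).add (hβ x₀)

theorem Form.IsSmooth.smul {k : ℕ} {α : Form I M k ℂ} (c : ℂ) (hα : α.IsSmooth) :
    (c • α).IsSmooth := fun x₀ => (hα x₀).const_smul c

theorem Form.IsSmooth.wedge {k l : ℕ} {α : Form I M k ℂ} {β : Form I M l ℂ} (hα : α.IsSmooth)
    (hβ : β.IsSmooth) : (α.wedge β).IsSmooth := fun x₀ => by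
  rw [Form.inChart_wedge]
  exact ((wedgeCLM k l).isBoundedBilinearMap.contDiff).comp_contDiffOn ((hα x₀).prodMk (hβ x₀))

theorem extDeriv_complexify {V : Type*} [NormedAddCommGroup V] [NormedSpace ℝ V] {k : ℕ}
    {α : V → V [⋀^Fin k]→L[ℝ] ℝ} {x : V} (hα : DifferentiableAt ℝ α x) :
    extDeriv (fun y => complexify (α y)) x = complexify (extDeriv α x) := by
  have h : fderiv ℝ (fun y => complexify (α y)) x =
      (ContinuousLinearMap.compContinuousAlternatingMapCLM ℝ V ℝ ℂ (ι := Fin k) Complex.ofRealCLM) ∘L fderiv ℝ α x :=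
    ((ContinuousLinearMap.compContinuousAlternatingMapCLM ℝ V ℝ ℂ (ι := Fin k) Complex.ofRealCLM).hasFDerivAt.comp x
      hα.hasFDerivAt).fderiv
  ext v
  rw [complexify_apply, extDeriv, extDeriv, h]
  simp [ContinuousAlternatingMap.alternatizeUncurryFin_apply]

variable [IsManifold I ∞ M]

theorem Form.toComplex_d {k : ℕ} {α : Form I M k ℝ} (hα : ∀ x, α.DiffAt x) :
    α.toComplex.d = α.d.toComplex := funext fun x =>
  ((Form.d_apply α.toComplex x).trans (extDeriv_complexify (hα x))).trans
    (congrArg (complexify (V := E)) (Form.d_apply α x)).symm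

end Complexification

/-! ### Pullback along maps that are linear in charts -/

section ChartLinear

variable {E : Type*} [NormedAddCommGroup E] [NormedSpace ℝ E]
variable {H : Type*} [TopologicalSpace H] {I : ModelWithCorners ℝ E H}
variable {M : Type*} [TopologicalSpace M] [ChartedSpace H M]
variable {E' : Type*} [NormedAddCommGroup E'] [NormedSpace ℝ E']
variable {H' : Type*} [TopologicalSpace H'] {I' : ModelWithCorners ℝ E' H'}
variable {M' : Type*} [TopologicalSpace M'] [ChartedSpace H' M']
variable {k : ℕ} {F : Type*} [NormedAddCommGroup F] [NormedSpace ℝ F]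

/-- A map of manifolds that is given by the same linear map in the preferred charts around all
points, like the projections of a product. -/
structure IsChartLinear (I : ModelWithCorners ℝ E H) (I' : ModelWithCorners ℝ E' H')
    (f : M' → M) (L : E' →L[ℝ] E) : Prop where
  map_chart : ∀ z, L (extChartAt I' z z) = extChartAt I (f z) (f z)
  map_target : ∀ z, ∀ y ∈ (extChartAt I' z).target, L y ∈ (extChartAt I (f z)).target
  map_symm : ∀ z, ∀ y ∈ (extChartAt I' z).target,
    f ((extChartAt I' z).symm y) = (extChartAt I (f z)).symm (L y)
  map_deriv : ∀ z, ∀ y ∈ (extChartAt I' z).target, ∀ v : E',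
    (mfderiv I' I f ((extChartAt I' z).symm y) : E' →L[ℝ] E) (symmDeriv I' z y v) =
      symmDeriv I (f z) (L y) (L v)

variable {f : M' → M} {L : E' →L[ℝ] E}

theorem IsChartLinear.inChart_pullback (h : IsChartLinear I I' f L) (α : Form I M k F) {z : M'}
    {y : E'} (hy : y ∈ (extChartAt I' z).target) :
    (α.pullback f : Form I' M' k F).inChart z y =
      (α.inChart (f z) (L y)).compContinuousLinearMap L := by
  ext v
  have e : ∀ p, p = (extChartAt I (f z)).symm (L y) →
      (α p : E [⋀^Fin k]→L[ℝ] F) (fun i => symmDeriv I (f z) (L y) (L (v i))) =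
        (α.inChart (f z) (L y)).compContinuousLinearMap L v := by
    rintro p rfl
    rfl
  rw [← e _ (h.map_symm z y hy)]
  exact congrArg (α (f ((extChartAt I' z).symm y)) : E [⋀^Fin k]→L[ℝ] F)
    (funext fun i => h.map_deriv z y hy (v i))

theorem IsChartLinear.isSmooth_pullback (h : IsChartLinear I I' f L) {α : Form I M k F}
    (hα : α.IsSmooth) : (α.pullback f : Form I' M' k F).IsSmooth := fun z => by
  have h1 : ContDiffOn ℝ ∞ (fun y => α.inChart (f z) (L y)) (extChartAt I' z).target :=
    (hα (f z)).comp L.contDiff.contDiffOn (h.map_target z)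
  exact ((ContinuousAlternatingMap.compContinuousLinearMapCLM (ι := Fin k) (F := F)
    L).contDiff.comp_contDiffOn h1).congr fun y hy => h.inChart_pullback α hy

variable [I.Boundaryless] [IsManifold I' ∞ M'] [I'.Boundaryless]

theorem IsChartLinear.d_pullback (h : IsChartLinear I I' f L) {α : Form I M k F}
    (hα : α.IsSmooth) (z : M') :
    ((α.pullback f : Form I' M' k F).d z : E' [⋀^Fin (k + 1)]→L[ℝ] F) =
      ContinuousAlternatingMap.compContinuousLinearMap (extDeriv (α.inChart (f z))
        (extChartAt I (f z) (f z))) L := by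
  rw [← h.map_chart]
  refine (Form.d_apply _ z).trans ?_
  have hev : (α.pullback f : Form I' M' k F).inChart z =ᶠ[nhds (extChartAt I' z z)]
      fun y => (α.inChart (f z) (L y)).compContinuousLinearMap (fderiv ℝ L y) := by
    filter_upwards [extChartAt_target_mem_nhds z] with y hy
    rw [L.fderiv]
    exact h.inChart_pullback α hy
  rw [hev.extDeriv_eq, extDeriv_pullback (r := ∞) ?_ L.contDiff.contDiffAt ?_, L.fderiv]
  · rw [h.map_chart]
    exact hα.diffAt (f z)
  · rw [minSmoothness_of_isRCLikeNormedField]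
    exact WithTop.coe_le_coe.2 le_top

variable [IsManifold I ∞ M]

theorem IsChartLinear.mfderiv_apply (h : IsChartLinear I I' f L) (z : M') (v : E') :
    (mfderiv I' I f z : E' →L[ℝ] E) v = L v := by
  have h1 := h.map_deriv z _ (mem_extChartAt_target z) v
  rw [symmDeriv_self, h.map_chart, symmDeriv_self, extChartAt_to_inv] at h1
  exact h1

theorem IsChartLinear.pullback_apply (h : IsChartLinear I I' f L) (α : Form I M k F) (z : M')
    (v : Fin k → E') : ((α.pullback f : Form I' M' k F) z : E' [⋀^Fin k]→L[ℝ] F) v =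
      (α (f z) : E [⋀^Fin k]→L[ℝ] F) (fun i => L (v i)) :=
  congrArg (α (f z) : E [⋀^Fin k]→L[ℝ] F) (funext fun i => h.mfderiv_apply z (v i))

/-- The exterior derivative commutes with pullback. -/
theorem IsChartLinear.pullback_d (h : IsChartLinear I I' f L) {α : Form I M k F}
    (hα : α.IsSmooth) : (α.pullback f : Form I' M' k F).d = α.d.pullback f := by
  funext z
  refine ContinuousAlternatingMap.ext fun v : Fin (k + 1) → E' => ?_
  refine (DFunLike.congr_fun (h.d_pullback hα z) v).trans ?_
  refine Eq.trans ?_ (h.pullback_apply α.d z v).symm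
  exact (DFunLike.congr_fun (Form.d_apply α (f z)) _).symm

end ChartLinear

/-! ### Charts of a product -/

section ProductCharts

theorem mdifferentiableAt_extChartAt_symm {E : Type*} [NormedAddCommGroup E] [NormedSpace ℝ E]
    {H : Type*} [TopologicalSpace H] {I : ModelWithCorners ℝ E H} [I.Boundaryless]
    {M : Type*} [TopologicalSpace M] [ChartedSpace H M] [IsManifold I ∞ M] {x : M} {y : E}
    (hy : y ∈ (extChartAt I x).target) :
    MDifferentiableAt 𝓘(ℝ, E) I (extChartAt I x).symm y := by
  have : IsManifold I 1 M := IsManifold.of_le (n := ∞) (by norm_cast)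
  exact mdifferentiableOn_extChartAt_symm.mdifferentiableAt
    ((isOpen_extChartAt_target x).mem_nhds hy)

variable {E₁ : Type*} [NormedAddCommGroup E₁] [NormedSpace ℝ E₁]
  {H₁ : Type*} [TopologicalSpace H₁] {I₁ : ModelWithCorners ℝ E₁ H₁}
  {M₁ : Type*} [TopologicalSpace M₁] [ChartedSpace H₁ M₁]
  {E₂ : Type*} [NormedAddCommGroup E₂] [NormedSpace ℝ E₂]
  {H₂ : Type*} [TopologicalSpace H₂] {I₂ : ModelWithCorners ℝ E₂ H₂}
  {M₂ : Type*} [TopologicalSpace M₂] [ChartedSpace H₂ M₂]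

theorem extChartAt_prod_target {z : M₁ × M₂} {y : E₁ × E₂} :
    y ∈ (extChartAt (I₁.prod I₂) z).target ↔
      y.1 ∈ (extChartAt I₁ z.1).target ∧ y.2 ∈ (extChartAt I₂ z.2).target := by
  rw [extChartAt_prod]
  rfl

theorem extChartAt_prod_symm (z : M₁ × M₂) (y : E₁ × E₂) :
    (extChartAt (I₁.prod I₂) z).symm y =
      ((extChartAt I₁ z.1).symm y.1, (extChartAt I₂ z.2).symm y.2) := by
  rw [extChartAt_prod]
  rfl

theorem extChartAt_prod_apply (z : M₁ × M₂) :
    extChartAt (I₁.prod I₂) z z = (extChartAt I₁ z.1 z.1, extChartAt I₂ z.2 z.2) := by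
  rw [extChartAt_prod]
  rfl

variable [IsManifold I₁ ∞ M₁] [IsManifold I₂ ∞ M₂]

section

variable (𝒮₁ : AlmostContactMetric I₁ M₁) (𝒮₂ : AlmostContactMetric I₂ M₂) (a b : ℝ)

theorem tsukadaJ_apply (z : M₁ × M₂) (w : E₁ × E₂) :
    (tsukadaJ 𝒮₁ 𝒮₂ a b z : E₁ × E₂ →L[ℝ] E₁ × E₂) w =
      ((𝒮₁.φ z.1 : E₁ →L[ℝ] E₁) w.1 + (-(a / b) * (𝒮₁.η z.1 : E₁ →L[ℝ] ℝ) w.1 +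
          -((a ^ 2 + b ^ 2) / b) * (𝒮₂.η z.2 : E₂ →L[ℝ] ℝ) w.2) • 𝒮₁.ξ z.1,
        (𝒮₂.φ z.2 : E₂ →L[ℝ] E₂) w.2 + (a / b * (𝒮₂.η z.2 : E₂ →L[ℝ] ℝ) w.2 +
          1 / b * (𝒮₁.η z.1 : E₁ →L[ℝ] ℝ) w.1) • 𝒮₂.ξ z.2) := by
  have h : (tsukadaJ 𝒮₁ 𝒮₂ a b z : E₁ × E₂ →L[ℝ] E₁ × E₂) w =
      ((𝒮₁.φ z.1 : E₁ →L[ℝ] E₁) w.1 - (a / b) • (𝒮₁.η z.1 : E₁ →L[ℝ] ℝ) w.1 • 𝒮₁.ξ z.1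
          - ((a ^ 2 + b ^ 2) / b) • (𝒮₂.η z.2 : E₂ →L[ℝ] ℝ) w.2 • 𝒮₁.ξ z.1,
        (𝒮₂.φ z.2 : E₂ →L[ℝ] E₂) w.2 + (1 / b) • (𝒮₁.η z.1 : E₁ →L[ℝ] ℝ) w.1 • 𝒮₂.ξ z.2
          + (a / b) • (𝒮₂.η z.2 : E₂ →L[ℝ] ℝ) w.2 • 𝒮₂.ξ z.2) := by
    have h1 := mfderiv_fst (I := I₁) (I' := I₂) (x := z)
    have h2 := mfderiv_snd (I := I₁) (I' := I₂) (x := z)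
    rw [tsukadaJ, h1, h2]
    rfl
  rw [h]
  refine Prod.ext ?_ ?_
  · module
  · module

end

variable [I₁.Boundaryless] [I₂.Boundaryless]

theorem symmDeriv_prod {z : M₁ × M₂} {y : E₁ × E₂}
    (hy : y ∈ (extChartAt (I₁.prod I₂) z).target) (w : E₁ × E₂) :
    symmDeriv (I₁.prod I₂) z y w = (symmDeriv I₁ z.1 y.1 w.1, symmDeriv I₂ z.2 y.2 w.2) := by
  rw [extChartAt_prod_target] at hy
  have h₁ := (mdifferentiableAt_extChartAt_symm hy.1).hasMFDerivAt.comp y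
    ((hasFDerivAt_fst (𝕜 := ℝ) (p := y)).hasMFDerivAt)
  have h₂ := (mdifferentiableAt_extChartAt_symm hy.2).hasMFDerivAt.comp y
    ((hasFDerivAt_snd (𝕜 := ℝ) (p := y)).hasMFDerivAt)
  have h := (h₁.prodMk h₂).mfderiv
  have e : (extChartAt (I₁.prod I₂) z).symm = fun y : E₁ × E₂ =>
      ((extChartAt I₁ z.1).symm y.1, (extChartAt I₂ z.2).symm y.2) :=
    funext fun y => extChartAt_prod_symm z y
  rw [symmDeriv, e]
  exact DFunLike.congr_fun h w

theorem chartDeriv_prod {z : M₁ × M₂} {y : E₁ × E₂}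
    (hy : y ∈ (extChartAt (I₁.prod I₂) z).target) (w : E₁ × E₂) :
    chartDeriv (I₁.prod I₂) z y w = (chartDeriv I₁ z.1 y.1 w.1, chartDeriv I₂ z.2 y.2 w.2) := by
  have hy' := extChartAt_prod_target.1 hy
  have h := symmDeriv_prod hy (chartDeriv I₁ z.1 y.1 w.1, chartDeriv I₂ z.2 y.2 w.2)
  simp only [symmDeriv_chartDeriv hy'.1, symmDeriv_chartDeriv hy'.2] at h
  rw [← chartDeriv_symmDeriv hy (chartDeriv I₁ z.1 y.1 w.1, chartDeriv I₂ z.2 y.2 w.2), h]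

theorem isChartLinear_fst : IsChartLinear I₁ (I₁.prod I₂) (Prod.fst : M₁ × M₂ → M₁)
    (ContinuousLinearMap.fst ℝ E₁ E₂) where
  map_chart z := by rw [extChartAt_prod_apply]; rfl
  map_target z y hy := (extChartAt_prod_target.1 hy).1
  map_symm z y _ := by rw [extChartAt_prod_symm]; rfl
  map_deriv z y hy v := by
    have h := congrArg Prod.fst (symmDeriv_prod hy v)
    rw [mfderiv_fst]
    exact h

theorem isChartLinear_snd : IsChartLinear I₂ (I₁.prod I₂) (Prod.snd : M₁ × M₂ → M₂)
    (ContinuousLinearMap.snd ℝ E₁ E₂) where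
  map_chart z := by rw [extChartAt_prod_apply]; rfl
  map_target z y hy := (extChartAt_prod_target.1 hy).2
  map_symm z y _ := by rw [extChartAt_prod_symm]; rfl
  map_deriv z y hy v := by
    have h := congrArg Prod.snd (symmDeriv_prod hy v)
    rw [mfderiv_snd]
    exact h

end ProductCharts

/-! ### Smoothness and derivative of the product structure -/

section ProductComplexStructure

theorem ContactJet.product_sq {E E' : Type*} [NormedAddCommGroup E] [NormedSpace ℝ E]
    [NormedAddCommGroup E'] [NormedSpace ℝ E'] (j : ContactJet E) (k : ContactJet E')
    {p q r s : ℝ} (h1 : 1 + p * p + q * r = 0) (h2 : p + s = 0) {P : E × E' →L[ℝ] E × E'}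
    (hP : ∀ w, P w = (j.φ w.1 + (p * j.η w.1 + q * k.η w.2) • j.ξ,
      k.φ w.2 + (s * k.η w.2 + r * j.η w.1) • k.ξ)) (w : E × E') : P (P w) = -w := by
  have hs : s = -p := by linear_combination h2
  subst hs
  have hη : ∀ w, j.η (P w).1 = p * j.η w.1 + q * k.η w.2 := fun w => by
    rw [hP, map_add, map_smul, j.η_φ, j.η_ξ, zero_add, smul_eq_mul, mul_one]
  have hη' : ∀ w, k.η (P w).2 = -p * k.η w.2 + r * j.η w.1 := fun w => by
    rw [hP, map_add, map_smul, k.η_φ, k.η_ξ, zero_add, smul_eq_mul, mul_one]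
  rw [hP (P w), hη, hη', hP w]
  refine Prod.ext ?_ ?_
  · simp only [map_add, map_smul, j.φ_sq, j.φ_ξ, smul_zero, add_zero, Prod.fst_neg]
    have := congrArg (fun c : ℝ => (c * j.η w.1) • j.ξ) h1
    simp only [zero_mul, zero_smul] at this
    linear_combination (norm := module) this
  · simp only [map_add, map_smul, k.φ_sq, k.φ_ξ, smul_zero, add_zero, Prod.snd_neg]
    have := congrArg (fun c : ℝ => (c * k.η w.2) • k.ξ) h1
    simp only [zero_mul, zero_smul] at this
    linear_combination (norm := module) this

theorem hasFDerivAt_comp_fst {E E' G : Type*} [NormedAddCommGroup E] [NormedSpace ℝ E]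
    [NormedAddCommGroup E'] [NormedSpace ℝ E'] [NormedAddCommGroup G] [NormedSpace ℝ G]
    {f : E → G} {f' : E →L[ℝ] G} {y : E × E'} (h : HasFDerivAt f f' y.1) :
    HasFDerivAt (fun y : E × E' => f y.1) (f' ∘L .fst ℝ E E') y :=
  h.comp y hasFDerivAt_fst

theorem hasFDerivAt_comp_snd {E E' G : Type*} [NormedAddCommGroup E] [NormedSpace ℝ E]
    [NormedAddCommGroup E'] [NormedSpace ℝ E'] [NormedAddCommGroup G] [NormedSpace ℝ G]
    {f : E' → G} {f' : E' →L[ℝ] G} {y : E × E'} (h : HasFDerivAt f f' y.2) :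
    HasFDerivAt (fun y : E × E' => f y.2) (f' ∘L .snd ℝ E E') y :=
  h.comp y hasFDerivAt_snd

variable {E₁ : Type*} [NormedAddCommGroup E₁] [NormedSpace ℝ E₁]
  {H₁ : Type*} [TopologicalSpace H₁] {I₁ : ModelWithCorners ℝ E₁ H₁}
  {M₁ : Type*} [TopologicalSpace M₁] [ChartedSpace H₁ M₁] [IsManifold I₁ ∞ M₁] [I₁.Boundaryless]
  {E₂ : Type*} [NormedAddCommGroup E₂] [NormedSpace ℝ E₂]
  {H₂ : Type*} [TopologicalSpace H₂] {I₂ : ModelWithCorners ℝ E₂ H₂}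
  {M₂ : Type*} [TopologicalSpace M₂] [ChartedSpace H₂ M₂] [IsManifold I₂ ∞ M₂] [I₂.Boundaryless]
  {𝒮₁ : AlmostContactMetric I₁ M₁} {𝒮₂ : AlmostContactMetric I₂ M₂} (a b : ℝ)

/-- In a product chart, `J` is given by the formula that defines it, with the coordinate expressions
of the tensors of the two factors. -/
theorem tsukadaJ_inChart_apply {z : M₁ × M₂} {y : E₁ × E₂}
    (hy : y ∈ (extChartAt (I₁.prod I₂) z).target) (w : E₁ × E₂) :
    (tsukadaJ 𝒮₁ 𝒮₂ a b).inChart z y w =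
      (𝒮₁.φ.inChart z.1 y.1 w.1 + (-(a / b) * covectorInChart 𝒮₁.η z.1 y.1 w.1 +
          -((a ^ 2 + b ^ 2) / b) * covectorInChart 𝒮₂.η z.2 y.2 w.2) • vfInChart 𝒮₁.ξ z.1 y.1,
        𝒮₂.φ.inChart z.2 y.2 w.2 + (a / b * covectorInChart 𝒮₂.η z.2 y.2 w.2 +
          1 / b * covectorInChart 𝒮₁.η z.1 y.1 w.1) • vfInChart 𝒮₂.ξ z.2 y.2) := by
  have h1 := tsukadaJ_apply 𝒮₁ 𝒮₂ a b ((extChartAt (I₁.prod I₂) z).symm y)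
    (symmDeriv (I₁.prod I₂) z y w)
  have h2 := congrArg (chartDeriv (I₁.prod I₂) z y) h1
  refine h2.trans ((chartDeriv_prod hy _).trans (Prod.ext ?_ ?_))
  · have e : ∀ p, p = ((extChartAt I₁ z.1).symm y.1, (extChartAt I₂ z.2).symm y.2) →
        chartDeriv I₁ z.1 y.1 ((𝒮₁.φ p.1 : E₁ →L[ℝ] E₁) (symmDeriv (I₁.prod I₂) z y w).1 +
          (-(a / b) * (𝒮₁.η p.1 : E₁ →L[ℝ] ℝ) (symmDeriv (I₁.prod I₂) z y w).1 +
          -((a ^ 2 + b ^ 2) / b) * (𝒮₂.η p.2 : E₂ →L[ℝ] ℝ) (symmDeriv (I₁.prod I₂) z y w).2) •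
            𝒮₁.ξ p.1) =
        𝒮₁.φ.inChart z.1 y.1 w.1 + (-(a / b) * covectorInChart 𝒮₁.η z.1 y.1 w.1 +
          -((a ^ 2 + b ^ 2) / b) * covectorInChart 𝒮₂.η z.2 y.2 w.2) •
            vfInChart 𝒮₁.ξ z.1 y.1 := by
      rintro p rfl
      rw [symmDeriv_prod hy]
      exact (map_add (chartDeriv I₁ z.1 y.1) _ _).trans
        (congrArg (fun u : E₁ => 𝒮₁.φ.inChart z.1 y.1 w.1 + u)
          (map_smul (chartDeriv I₁ z.1 y.1) _ _))
    exact e _ (extChartAt_prod_symm z y)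
  · have e : ∀ p, p = ((extChartAt I₁ z.1).symm y.1, (extChartAt I₂ z.2).symm y.2) →
        chartDeriv I₂ z.2 y.2 ((𝒮₂.φ p.2 : E₂ →L[ℝ] E₂) (symmDeriv (I₁.prod I₂) z y w).2 +
          (a / b * (𝒮₂.η p.2 : E₂ →L[ℝ] ℝ) (symmDeriv (I₁.prod I₂) z y w).2 +
          1 / b * (𝒮₁.η p.1 : E₁ →L[ℝ] ℝ) (symmDeriv (I₁.prod I₂) z y w).1) •
            𝒮₂.ξ p.2) =
        𝒮₂.φ.inChart z.2 y.2 w.2 + (a / b * covectorInChart 𝒮₂.η z.2 y.2 w.2 +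
          1 / b * covectorInChart 𝒮₁.η z.1 y.1 w.1) • vfInChart 𝒮₂.ξ z.2 y.2 := by
      rintro p rfl
      rw [symmDeriv_prod hy]
      exact (map_add (chartDeriv I₂ z.2 y.2) _ _).trans
        (congrArg (fun u : E₂ => 𝒮₂.φ.inChart z.2 y.2 w.2 + u)
          (map_smul (chartDeriv I₂ z.2 y.2) _ _))
    exact e _ (extChartAt_prod_symm z y)

theorem isSmooth_tsukadaJ [FiniteDimensional ℝ E₁] [FiniteDimensional ℝ E₂] :
    (tsukadaJ 𝒮₁ 𝒮₂ a b).IsSmooth := fun z => by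
  refine contDiffOn_clm_apply.2 fun w => ?_
  refine ContDiffOn.congr ?_ fun y hy => tsukadaJ_inChart_apply a b hy w
  have hφ₁ : ContDiffOn ℝ ∞ (fun y : E₁ × E₂ => 𝒮₁.φ.inChart z.1 y.1)
      (extChartAt (I₁.prod I₂) z).target :=
    (𝒮₁.smooth_φ z.1).comp contDiffOn_fst fun y hy => (extChartAt_prod_target.1 hy).1
  have hφ₂ : ContDiffOn ℝ ∞ (fun y : E₁ × E₂ => 𝒮₂.φ.inChart z.2 y.2)
      (extChartAt (I₁.prod I₂) z).target :=
    (𝒮₂.smooth_φ z.2).comp contDiffOn_snd fun y hy => (extChartAt_prod_target.1 hy).2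
  have hη₁ : ContDiffOn ℝ ∞ (fun y : E₁ × E₂ => covectorInChart 𝒮₁.η z.1 y.1)
      (extChartAt (I₁.prod I₂) z).target := fun y hy =>
    ((contDiffAt_covectorInChart 𝒮₁.smooth_η (extChartAt_prod_target.1 hy).1).comp y
      contDiffAt_fst).contDiffWithinAt
  have hη₂ : ContDiffOn ℝ ∞ (fun y : E₁ × E₂ => covectorInChart 𝒮₂.η z.2 y.2)
      (extChartAt (I₁.prod I₂) z).target := fun y hy =>
    ((contDiffAt_covectorInChart 𝒮₂.smooth_η (extChartAt_prod_target.1 hy).2).comp y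
      contDiffAt_snd).contDiffWithinAt
  have hξ₁ : ContDiffOn ℝ ∞ (fun y : E₁ × E₂ => vfInChart 𝒮₁.ξ z.1 y.1)
      (extChartAt (I₁.prod I₂) z).target := fun y hy =>
    ((AlmostContactMetric.contDiffAt_ξ (extChartAt_prod_target.1 hy).1).comp y
      contDiffAt_fst).contDiffWithinAt
  have hξ₂ : ContDiffOn ℝ ∞ (fun y : E₁ × E₂ => vfInChart 𝒮₂.ξ z.2 y.2)
      (extChartAt (I₁.prod I₂) z).target := fun y hy =>
    ((AlmostContactMetric.contDiffAt_ξ (extChartAt_prod_target.1 hy).2).comp y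
      contDiffAt_snd).contDiffWithinAt
  have hη₁w := hη₁.clm_apply (contDiffOn_const (c := w.1))
  have hη₂w := hη₂.clm_apply (contDiffOn_const (c := w.2))
  refine ContDiffOn.prodMk ?_ ?_
  · exact (hφ₁.clm_apply contDiffOn_const).add
      (((contDiffOn_const.mul hη₁w).add (contDiffOn_const.mul hη₂w)).smul hξ₁)
  · exact (hφ₂.clm_apply contDiffOn_const).add
      (((contDiffOn_const.mul hη₂w).add (contDiffOn_const.mul hη₁w)).smul hξ₂)

theorem fderiv_tsukadaJ_inChart [FiniteDimensional ℝ E₁] [FiniteDimensional ℝ E₂]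
    (h₁ : 𝒮₁.IsSasakian) (h₂ : 𝒮₂.IsSasakian) (z : M₁ × M₂)
    {j : ContactJet E₁} {k : ContactJet E₂} (hj : j = h₁.contactJet z.1)
    (hk : k = h₂.contactJet z.2) (h w : E₁ × E₂) :
    fderiv ℝ ((tsukadaJ 𝒮₁ 𝒮₂ a b).inChart z) (extChartAt (I₁.prod I₂) z z) h w =
      (j.Dφ h.1 w.1 + (-(a / b) * j.Dη h.1 w.1 + -((a ^ 2 + b ^ 2) / b) * k.Dη h.2 w.2) • j.ξ +
        (-(a / b) * j.η w.1 + -((a ^ 2 + b ^ 2) / b) * k.η w.2) • j.Dξ h.1,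
      k.Dφ h.2 w.2 + (a / b * k.Dη h.2 w.2 + 1 / b * j.Dη h.1 w.1) • k.ξ +
        (a / b * k.η w.2 + 1 / b * j.η w.1) • k.Dξ h.2) := by
  set y₀ := extChartAt (I₁.prod I₂) z z with hy₀
  have hz : y₀ = (extChartAt I₁ z.1 z.1, extChartAt I₂ z.2 z.2) := extChartAt_prod_apply z
  have hz₁ : y₀.1 = extChartAt I₁ z.1 z.1 := congrArg Prod.fst hz
  have hz₂ : y₀.2 = extChartAt I₂ z.2 z.2 := congrArg Prod.snd hz
  have dJ : DifferentiableAt ℝ ((tsukadaJ 𝒮₁ 𝒮₂ a b).inChart z) y₀ :=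
    ((isSmooth_tsukadaJ a b).contDiffAt (mem_extChartAt_target z)).differentiableAt (by simp)
  have hφ₁ : HasFDerivAt (fun y : E₁ × E₂ => 𝒮₁.φ.inChart z.1 y.1) (j.Dφ ∘L .fst ℝ E₁ E₂) y₀ :=
    hasFDerivAt_comp_fst (by rw [hz₁, hj]; exact
      (AlmostContactMetric.differentiableAt_φ z.1).hasFDerivAt)
  have hφ₂ : HasFDerivAt (fun y : E₁ × E₂ => 𝒮₂.φ.inChart z.2 y.2) (k.Dφ ∘L .snd ℝ E₁ E₂) y₀ :=
    hasFDerivAt_comp_snd (by rw [hz₂, hk]; exact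
      (AlmostContactMetric.differentiableAt_φ z.2).hasFDerivAt)
  have hη₁ : HasFDerivAt (fun y : E₁ × E₂ => covectorInChart 𝒮₁.η z.1 y.1)
      (j.Dη ∘L .fst ℝ E₁ E₂) y₀ :=
    hasFDerivAt_comp_fst (by rw [hz₁, hj]; exact
      (AlmostContactMetric.differentiableAt_η z.1).hasFDerivAt)
  have hη₂ : HasFDerivAt (fun y : E₁ × E₂ => covectorInChart 𝒮₂.η z.2 y.2)
      (k.Dη ∘L .snd ℝ E₁ E₂) y₀ :=
    hasFDerivAt_comp_snd (by rw [hz₂, hk]; exact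
      (AlmostContactMetric.differentiableAt_η z.2).hasFDerivAt)
  have hξ₁ : HasFDerivAt (fun y : E₁ × E₂ => vfInChart 𝒮₁.ξ z.1 y.1)
      (j.Dξ ∘L .fst ℝ E₁ E₂) y₀ :=
    hasFDerivAt_comp_fst (by rw [hz₁, hj]; exact
      (AlmostContactMetric.differentiableAt_ξ z.1).hasFDerivAt)
  have hξ₂ : HasFDerivAt (fun y : E₁ × E₂ => vfInChart 𝒮₂.ξ z.2 y.2)
      (k.Dξ ∘L .snd ℝ E₁ E₂) y₀ :=
    hasFDerivAt_comp_snd (by rw [hz₂, hk]; exact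
      (AlmostContactMetric.differentiableAt_ξ z.2).hasFDerivAt)
  have eξ₁ : vfInChart 𝒮₁.ξ z.1 y₀.1 = j.ξ := by rw [hz₁, hj]; exact vfInChart_self 𝒮₁.ξ z.1
  have eξ₂ : vfInChart 𝒮₂.ξ z.2 y₀.2 = k.ξ := by rw [hz₂, hk]; exact vfInChart_self 𝒮₂.ξ z.2
  have eη₁ : covectorInChart 𝒮₁.η z.1 y₀.1 = j.η := by
    rw [hz₁, hj]; exact covectorInChart_self 𝒮₁.η z.1
  have eη₂ : covectorInChart 𝒮₂.η z.2 y₀.2 = k.η := by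
    rw [hz₂, hk]; exact covectorInChart_self 𝒮₂.η z.2
  have cw₁ := hasFDerivAt_const (𝕜 := ℝ) w.1 y₀
  have cw₂ := hasFDerivAt_const (𝕜 := ℝ) w.2 y₀
  have hη₁w := hη₁.clm_apply cw₁
  have hη₂w := hη₂.clm_apply cw₂
  have H := ((hφ₁.clm_apply cw₁).add
    (((hη₁w.const_mul (-(a / b))).add (hη₂w.const_mul (-((a ^ 2 + b ^ 2) / b)))).smul hξ₁)).prodMk
    ((hφ₂.clm_apply cw₂).add
      (((hη₂w.const_mul (a / b)).add (hη₁w.const_mul (1 / b))).smul hξ₂))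
  have hev : (fun y => (tsukadaJ 𝒮₁ 𝒮₂ a b).inChart z y w) =ᶠ[nhds y₀] _ :=
    Filter.eventually_of_mem (extChartAt_target_mem_nhds z) fun y hy =>
      tsukadaJ_inChart_apply a b hy w
  have h3 := DFunLike.congr_fun (hev.fderiv_eq.trans H.fderiv) h
  rw [fderiv_clm_apply dJ (differentiableAt_const _), fderiv_fun_const] at h3
  simp only [Pi.add_apply, eξ₁, eξ₂, eη₁, eη₂] at h3
  refine Eq.trans ?_ (h3.trans ?_)
  · simp
  · refine Prod.ext ?_ ?_
    · simp only [ContinuousLinearMap.prod_apply, add_apply, smul_apply,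
        ContinuousLinearMap.comp_apply, ContinuousLinearMap.flip_apply,
        ContinuousLinearMap.smulRight_apply, ContinuousLinearMap.coe_fst', smul_eq_mul, zero_apply,
        map_zero]
      module
    · simp only [ContinuousLinearMap.prod_apply, add_apply, smul_apply,
        ContinuousLinearMap.comp_apply, ContinuousLinearMap.flip_apply,
        ContinuousLinearMap.smulRight_apply, ContinuousLinearMap.coe_snd', smul_eq_mul, zero_apply,
        map_zero]
      module

end ProductComplexStructure

/-! ### The Hermitian structure of the product -/

section ProductHermitian

theorem ContactJet.η_φ_add {E : Type*} [NormedAddCommGroup E] [NormedSpace ℝ E] (j : ContactJet E)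
    (u : E) (c : ℝ) : j.η (j.φ u + c • j.ξ) = c := by
  rw [map_add, map_smul, j.η_φ, j.η_ξ, zero_add, smul_eq_mul, mul_one]

theorem Φ_add_ξ {E H M : Type*} [NormedAddCommGroup E] [NormedSpace ℝ E]
    [TopologicalSpace H] {I : ModelWithCorners ℝ E H}
    [TopologicalSpace M] [ChartedSpace H M] [IsManifold I ∞ M] {𝒮 : AlmostContactMetric I M}
    (x : M) (u v : TangentSpace I x) (c d : ℝ) :
    𝒮.Φ x ![u + c • 𝒮.ξ x, v + d • 𝒮.ξ x] = 𝒮.Φ x ![u, v] := by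
  have h := 𝒮.Φ_ξ_right x (u + c • 𝒮.ξ x)
  have h' := 𝒮.Φ_ξ_left x v
  rw [AlmostContactMetric.Φ_apply] at h h' ⊢
  rw [map_add, map_smul, h, smul_zero, add_zero, map_add, map_add, add_apply, map_smul, map_smul,
    smul_apply, h', smul_zero, add_zero]
  rfl

theorem Φ_self_φ_add_ξ {E H M : Type*} [NormedAddCommGroup E] [NormedSpace ℝ E]
    [TopologicalSpace H] {I : ModelWithCorners ℝ E H}
    [TopologicalSpace M] [ChartedSpace H M] [IsManifold I ∞ M] {𝒮 : AlmostContactMetric I M}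
    (x : M) (v : TangentSpace I x) (c : ℝ) :
    𝒮.Φ x ![v, 𝒮.φ x v + c • 𝒮.ξ x] = 𝒮.g.inner x (𝒮.φ x v) (𝒮.φ x v) := by
  have h := 𝒮.Φ_ξ_right x v
  rw [AlmostContactMetric.Φ_apply] at h ⊢
  rw [map_add, map_smul, h, smul_zero, add_zero]

variable {E₁ : Type*} [NormedAddCommGroup E₁] [NormedSpace ℝ E₁]
  {H₁ : Type*} [TopologicalSpace H₁] {I₁ : ModelWithCorners ℝ E₁ H₁}
  {M₁ : Type*} [TopologicalSpace M₁] [ChartedSpace H₁ M₁] [IsManifold I₁ ∞ M₁]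
  {E₂ : Type*} [NormedAddCommGroup E₂] [NormedSpace ℝ E₂]
  {H₂ : Type*} [TopologicalSpace H₂] {I₂ : ModelWithCorners ℝ E₂ H₂}
  {M₂ : Type*} [TopologicalSpace M₂] [ChartedSpace H₂ M₂] [IsManifold I₂ ∞ M₂]
  {𝒮₁ : AlmostContactMetric I₁ M₁} {𝒮₂ : AlmostContactMetric I₂ M₂}

theorem tsukada_coeff {b : ℝ} (a : ℝ) (hb : b ≠ 0) :
    1 + -(a / b) * -(a / b) + -((a ^ 2 + b ^ 2) / b) * (1 / b) = 0 := by
  field_simp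
  ring

theorem tsukadaJ_Φ_fst (a b : ℝ) (z : M₁ × M₂)
    {P : E₁ × E₂ →L[ℝ] E₁ × E₂} (hP : P = tsukadaJ 𝒮₁ 𝒮₂ a b z) (v w : E₁ × E₂) :
    (𝒮₁.Φ z.1 : E₁ [⋀^Fin 2]→L[ℝ] ℝ) ![(P v).1, (P w).1] =
      (𝒮₁.Φ z.1 : E₁ [⋀^Fin 2]→L[ℝ] ℝ) ![v.1, w.1] := by
  have hv : P v = _ := hP ▸ tsukadaJ_apply 𝒮₁ 𝒮₂ a b z v
  have hw : P w = _ := hP ▸ tsukadaJ_apply 𝒮₁ 𝒮₂ a b z w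
  rw [hv, hw]
  exact (Φ_add_ξ z.1 _ _ _ _).trans (𝒮₁.Φ_φ_φ z.1 v.1 w.1)

theorem tsukadaJ_Φ_snd (a b : ℝ) (z : M₁ × M₂)
    {P : E₁ × E₂ →L[ℝ] E₁ × E₂} (hP : P = tsukadaJ 𝒮₁ 𝒮₂ a b z) (v w : E₁ × E₂) :
    (𝒮₂.Φ z.2 : E₂ [⋀^Fin 2]→L[ℝ] ℝ) ![(P v).2, (P w).2] =
      (𝒮₂.Φ z.2 : E₂ [⋀^Fin 2]→L[ℝ] ℝ) ![v.2, w.2] := by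
  have hv : P v = _ := hP ▸ tsukadaJ_apply 𝒮₁ 𝒮₂ a b z v
  have hw : P w = _ := hP ▸ tsukadaJ_apply 𝒮₁ 𝒮₂ a b z w
  rw [hv, hw]
  exact (Φ_add_ξ z.2 _ _ _ _).trans (𝒮₂.Φ_φ_φ z.2 v.2 w.2)

theorem prodOmega_toComplex (t : ℝ) :
    (prodOmega 𝒮₁ 𝒮₂ t).toComplex =
      (𝒮₁.Φ.pullback (Prod.fst : M₁ × M₂ → M₁) : Form (I₁.prod I₂) (M₁ × M₂) 2 ℝ).toComplex +
      (𝒮₂.Φ.pullback (Prod.snd : M₁ × M₂ → M₂) : Form (I₁.prod I₂) (M₁ × M₂) 2 ℝ).toComplex +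
      (t : ℂ) • ((oneForm 𝒮₁.η).pullback (Prod.fst : M₁ × M₂ → M₁) :
          Form (I₁.prod I₂) (M₁ × M₂) 1 ℝ).toComplex.wedge
        ((oneForm 𝒮₂.η).pullback (Prod.snd : M₁ × M₂ → M₂) :
          Form (I₁.prod I₂) (M₁ × M₂) 1 ℝ).toComplex := by
  rw [← Form.toComplex_wedge]
  funext z
  refine ContinuousAlternatingMap.ext fun v : Fin 2 → E₁ × E₂ => ?_
  refine (Complex.ofReal_add _ _).trans (congrArg₂ (· + ·) (Complex.ofReal_add _ _) ?_)
  exact Complex.ofReal_mul _ _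

variable [I₁.Boundaryless] [I₂.Boundaryless]

theorem tsukadaJ_sq (h₁ : 𝒮₁.IsSasakian) (h₂ : 𝒮₂.IsSasakian) (a : ℝ) {b : ℝ} (hb : b ≠ 0)
    (z : M₁ × M₂) {P : E₁ × E₂ →L[ℝ] E₁ × E₂} (hP : P = tsukadaJ 𝒮₁ 𝒮₂ a b z)
    (w : E₁ × E₂) : P (P w) = -w :=
  (h₁.contactJet z.1).product_sq (h₂.contactJet z.2) (tsukada_coeff a hb) (by ring)
    (fun w => hP ▸ tsukadaJ_apply 𝒮₁ 𝒮₂ a b z w) w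

theorem isComplexStructure_tsukadaJ [FiniteDimensional ℝ E₁] [FiniteDimensional ℝ E₂]
    (h₁ : 𝒮₁.IsSasakian) (h₂ : 𝒮₂.IsSasakian) (a : ℝ) {b : ℝ} (hb : b ≠ 0) :
    IsComplexStructure (tsukadaJ 𝒮₁ 𝒮₂ a b) where
  smooth := isSmooth_tsukadaJ a b
  sq z v := tsukadaJ_sq h₁ h₂ a hb z rfl v
  integrable z X Y hX hY :=
    (nijenhuis_eq_nijenhuisJet (isSmooth_tsukadaJ a b) hX hY).trans
      (nijenhuisJet_prod_eq_zero (h₁.contactJet z.1) (h₂.contactJet z.2) (tsukada_coeff a hb)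
        (by ring) (fun w => tsukadaJ_apply 𝒮₁ 𝒮₂ a b z w)
        (fun h w => fderiv_tsukadaJ_inChart a b h₁ h₂ z rfl rfl h w) _ _)

/-- The pullback of `η₁` to the product, as a complex valued covector of the model space. -/
def etaFst (𝒮₁ : AlmostContactMetric I₁ M₁) (z : M₁ × M₂) : E₁ × E₂ →L[ℝ] ℂ :=
  Complex.ofRealCLM ∘L (𝒮₁.η z.1 : E₁ →L[ℝ] ℝ) ∘L ContinuousLinearMap.fst ℝ E₁ E₂

/-- The pullback of `η₂` to the product, as a complex valued covector of the model space. -/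
def etaSnd (𝒮₂ : AlmostContactMetric I₂ M₂) (z : M₁ × M₂) : E₁ × E₂ →L[ℝ] ℂ :=
  Complex.ofRealCLM ∘L (𝒮₂.η z.2 : E₂ →L[ℝ] ℝ) ∘L ContinuousLinearMap.snd ℝ E₁ E₂

theorem oneForm_pullback_fst (z : M₁ × M₂) {α : AltForm (E₁ × E₂) 1}
    (hα : α = ((oneForm 𝒮₁.η).pullback (Prod.fst : M₁ × M₂ → M₁) :
      Form (I₁.prod I₂) (M₁ × M₂) 1 ℝ).toComplex z) : covector (etaFst 𝒮₁ z) = α := by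
  subst hα
  refine ContinuousAlternatingMap.ext fun v : Fin 1 → E₁ × E₂ => ?_
  exact congrArg Complex.ofReal (isChartLinear_fst.pullback_apply (I := I₁)
    (I' := I₁.prod I₂) (oneForm 𝒮₁.η) z v).symm

theorem oneForm_pullback_snd (z : M₁ × M₂) {α : AltForm (E₁ × E₂) 1}
    (hα : α = ((oneForm 𝒮₂.η).pullback (Prod.snd : M₁ × M₂ → M₂) :
      Form (I₁.prod I₂) (M₁ × M₂) 1 ℝ).toComplex z) : covector (etaSnd 𝒮₂ z) = α := by
  subst hα
  refine ContinuousAlternatingMap.ext fun v : Fin 1 → E₁ × E₂ => ?_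
  exact congrArg Complex.ofReal (isChartLinear_snd.pullback_apply (I := I₂)
    (I' := I₁.prod I₂) (oneForm 𝒮₂.η) z v).symm

theorem prodOmega_apply (t : ℝ) (z : M₁ × M₂) (v w : E₁ × E₂) :
    (prodOmega 𝒮₁ 𝒮₂ t z : (E₁ × E₂) [⋀^Fin 2]→L[ℝ] ℝ) ![v, w] =
      (𝒮₁.Φ z.1 : E₁ [⋀^Fin 2]→L[ℝ] ℝ) ![v.1, w.1] +
      (𝒮₂.Φ z.2 : E₂ [⋀^Fin 2]→L[ℝ] ℝ) ![v.2, w.2] +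
      t * ((𝒮₁.η z.1 : E₁ →L[ℝ] ℝ) v.1 * (𝒮₂.η z.2 : E₂ →L[ℝ] ℝ) w.2 -
        (𝒮₁.η z.1 : E₁ →L[ℝ] ℝ) w.1 * (𝒮₂.η z.2 : E₂ →L[ℝ] ℝ) v.2) := by
  have h0 := congrFun (prodOmega_toComplex (𝒮₁ := 𝒮₁) (𝒮₂ := 𝒮₂) t) z
  have h1 : (((prodOmega 𝒮₁ 𝒮₂ t z : (E₁ × E₂) [⋀^Fin 2]→L[ℝ] ℝ) ![v, w] : ℝ) : ℂ) = _ :=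
    congrArg (fun α : AltForm (E₁ × E₂) 2 => α ![v, w]) h0
  have e1 := isChartLinear_fst.pullback_apply (I := I₁) (I' := I₁.prod I₂) 𝒮₁.Φ z ![v, w]
  have e2 := isChartLinear_snd.pullback_apply (I := I₂) (I' := I₁.prod I₂) 𝒮₂.Φ z ![v, w]
  have s1 : (fun i => ContinuousLinearMap.fst ℝ E₁ E₂ (![v, w] i)) = ![v.1, w.1] := by
    ext i; fin_cases i <;> rfl
  have s2 : (fun i => ContinuousLinearMap.snd ℝ E₁ E₂ (![v, w] i)) = ![v.2, w.2] := by
    ext i; fin_cases i <;> rfl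
  rw [s1] at e1
  rw [s2] at e2
  have e3 := covector_mul_apply (etaFst 𝒮₁ z) (etaSnd 𝒮₂ z) v w
  rw [oneForm_pullback_fst (𝒮₁ := 𝒮₁) (I₂ := I₂) z rfl,
    oneForm_pullback_snd (𝒮₂ := 𝒮₂) (I₁ := I₁) z rfl] at e3
  rw [← Complex.ofReal_inj]
  refine h1.trans ?_
  rw [Complex.ofReal_add, Complex.ofReal_add, Complex.ofReal_mul]
  refine congrArg₂ (· + ·) (congrArg₂ (· + ·) (congrArg Complex.ofReal e1)
    (congrArg Complex.ofReal e2)) (congrArg (fun c : ℂ => (t : ℂ) * c) (e3.trans ?_))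
  rw [Complex.ofReal_sub, Complex.ofReal_mul, Complex.ofReal_mul]
  rfl

theorem isSmooth_prodOmega (h₁ : 𝒮₁.IsSasakian) (h₂ : 𝒮₂.IsSasakian) (t : ℝ) :
    (prodOmega 𝒮₁ 𝒮₂ t).IsSmooth := by
  refine Form.IsSmooth.of_toComplex ?_
  rw [prodOmega_toComplex]
  exact ((isChartLinear_fst.isSmooth_pullback h₁.isSmooth_Φ).toComplex.add
    (isChartLinear_snd.isSmooth_pullback h₂.isSmooth_Φ).toComplex).add
    (((isChartLinear_fst.isSmooth_pullback 𝒮₁.smooth_η).toComplex.wedge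
      (isChartLinear_snd.isSmooth_pullback 𝒮₂.smooth_η).toComplex).smul _)

/-- `J` acts on the span of `η₁` and `η₂`. -/
theorem tsukadaJ_η (h₁ : 𝒮₁.IsSasakian) (h₂ : 𝒮₂.IsSasakian) (a b : ℝ) (z : M₁ × M₂)
    {P : E₁ × E₂ →L[ℝ] E₁ × E₂} (hP : P = tsukadaJ 𝒮₁ 𝒮₂ a b z) (w : E₁ × E₂) :
    (𝒮₁.η z.1 : E₁ →L[ℝ] ℝ) (P w).1 = -(a / b) * (𝒮₁.η z.1 : E₁ →L[ℝ] ℝ) w.1 +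
        -((a ^ 2 + b ^ 2) / b) * (𝒮₂.η z.2 : E₂ →L[ℝ] ℝ) w.2 ∧
      (𝒮₂.η z.2 : E₂ →L[ℝ] ℝ) (P w).2 = a / b * (𝒮₂.η z.2 : E₂ →L[ℝ] ℝ) w.2 +
          1 / b * (𝒮₁.η z.1 : E₁ →L[ℝ] ℝ) w.1 := by
  have h : P w = _ := hP ▸ tsukadaJ_apply 𝒮₁ 𝒮₂ a b z w
  rw [h]
  constructor
  · exact (h₁.contactJet z.1).η_φ_add _ _
  · exact (h₂.contactJet z.2).η_φ_add _ _

theorem tsukadaJ_η_wedge (h₁ : 𝒮₁.IsSasakian) (h₂ : 𝒮₂.IsSasakian) (a : ℝ) {b : ℝ} (hb : b ≠ 0)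
    (z : M₁ × M₂) {P : E₁ × E₂ →L[ℝ] E₁ × E₂} (hP : P = tsukadaJ 𝒮₁ 𝒮₂ a b z)
    (v w : E₁ × E₂) :
    (𝒮₁.η z.1 : E₁ →L[ℝ] ℝ) (P v).1 * (𝒮₂.η z.2 : E₂ →L[ℝ] ℝ) (P w).2 -
        (𝒮₁.η z.1 : E₁ →L[ℝ] ℝ) (P w).1 * (𝒮₂.η z.2 : E₂ →L[ℝ] ℝ) (P v).2 =
      (𝒮₁.η z.1 : E₁ →L[ℝ] ℝ) v.1 * (𝒮₂.η z.2 : E₂ →L[ℝ] ℝ) w.2 -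
        (𝒮₁.η z.1 : E₁ →L[ℝ] ℝ) w.1 * (𝒮₂.η z.2 : E₂ →L[ℝ] ℝ) v.2 := by
  rw [(tsukadaJ_η h₁ h₂ a b z hP v).1, (tsukadaJ_η h₁ h₂ a b z hP v).2,
    (tsukadaJ_η h₁ h₂ a b z hP w).1, (tsukadaJ_η h₁ h₂ a b z hP w).2]
  field_simp
  ring

/-- With `x = η₁(v)` and `y = η₂(v)` the value is
`|φ₁ v₁|² + |φ₂ v₂|² + (t / b) ((x + a y)² + (b y)²)`. -/
theorem prodOmega_pos (h₁ : 𝒮₁.IsSasakian) (h₂ : 𝒮₂.IsSasakian) (a : ℝ) {b t : ℝ} (hb : b ≠ 0)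
    (htb : 0 < t / b) (z : M₁ × M₂) {P : E₁ × E₂ →L[ℝ] E₁ × E₂}
    (hP : P = tsukadaJ 𝒮₁ 𝒮₂ a b z) {v : E₁ × E₂} (hv : v ≠ 0) :
    0 < (prodOmega 𝒮₁ 𝒮₂ t z : (E₁ × E₂) [⋀^Fin 2]→L[ℝ] ℝ) ![v, P v] := by
  have e1 : (𝒮₁.Φ z.1 : E₁ [⋀^Fin 2]→L[ℝ] ℝ) ![v.1, (P v).1] =
      𝒮₁.g.inner z.1 (𝒮₁.φ z.1 v.1) (𝒮₁.φ z.1 v.1) := by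
    rw [show P v = _ from hP ▸ tsukadaJ_apply 𝒮₁ 𝒮₂ a b z v]
    exact Φ_self_φ_add_ξ z.1 v.1 _
  have e2 : (𝒮₂.Φ z.2 : E₂ [⋀^Fin 2]→L[ℝ] ℝ) ![v.2, (P v).2] =
      𝒮₂.g.inner z.2 (𝒮₂.φ z.2 v.2) (𝒮₂.φ z.2 v.2) := by
    rw [show P v = _ from hP ▸ tsukadaJ_apply 𝒮₁ 𝒮₂ a b z v]
    exact Φ_self_φ_add_ξ z.2 v.2 _
  have g1 : 0 ≤ 𝒮₁.g.inner z.1 (𝒮₁.φ z.1 v.1) (𝒮₁.φ z.1 v.1) := by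
    by_cases h : 𝒮₁.φ z.1 v.1 = 0
    · rw [h, map_zero]
    · exact (𝒮₁.g.pos z.1 _ h).le
  have g2 : 0 ≤ 𝒮₂.g.inner z.2 (𝒮₂.φ z.2 v.2) (𝒮₂.φ z.2 v.2) := by
    by_cases h : 𝒮₂.φ z.2 v.2 = 0
    · rw [h, map_zero]
    · exact (𝒮₂.g.pos z.2 _ h).le
  rw [prodOmega_apply, (tsukadaJ_η h₁ h₂ a b z hP v).1, (tsukadaJ_η h₁ h₂ a b z hP v).2, e1, e2]
  set x := (𝒮₁.η z.1 : E₁ →L[ℝ] ℝ) v.1 with hx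
  set y := (𝒮₂.η z.2 : E₂ →L[ℝ] ℝ) v.2 with hy
  have e3 : t * (x * (a / b * y + 1 / b * x) - (-(a / b) * x + -((a ^ 2 + b ^ 2) / b) * y) * y) =
      t / b * ((x + a * y) ^ 2 + (b * y) ^ 2) := by
    field_simp
    ring
  rw [e3]
  by_cases hφ₁ : 𝒮₁.φ z.1 v.1 = 0
  · by_cases hφ₂ : 𝒮₂.φ z.2 v.2 = 0
    · refine add_pos_of_nonneg_of_pos (add_nonneg g1 g2) (mul_pos htb ?_)
      by_contra hle
      have hsum : (x + a * y) ^ 2 + (b * y) ^ 2 = 0 :=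
        le_antisymm (not_lt.1 hle) (by positivity)
      have hy0 : y = 0 := by
        have : (b * y) ^ 2 = 0 := by nlinarith [sq_nonneg (x + a * y), sq_nonneg (b * y)]
        exact (mul_eq_zero.1 (pow_eq_zero_iff two_ne_zero |>.1 this)).resolve_left hb
      have hx0 : x = 0 := by
        rw [hy0] at hsum
        simpa using hsum
      -- a vector with `φ v = 0` and `η v = 0` is zero, as `φ² = -1 + η ⊗ ξ`
      have s1 := 𝒮₁.φ_sq z.1 v.1
      have s2 := 𝒮₂.φ_sq z.2 v.2
      rw [hφ₁, map_zero, show 𝒮₁.η z.1 v.1 = 0 from hx0, zero_smul, add_zero] at s1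
      rw [hφ₂, map_zero, show 𝒮₂.η z.2 v.2 = 0 from hy0, zero_smul, add_zero] at s2
      exact hv (Prod.ext (neg_eq_zero.1 s1.symm) (neg_eq_zero.1 s2.symm))
    · have := 𝒮₂.g.pos z.2 _ hφ₂
      positivity
  · have := 𝒮₁.g.pos z.1 _ hφ₁
    positivity

theorem isHermitianStructure_prod [FiniteDimensional ℝ E₁] [FiniteDimensional ℝ E₂]
    (h₁ : 𝒮₁.IsSasakian) (h₂ : 𝒮₂.IsSasakian) (a : ℝ) {b t : ℝ} (hb : b ≠ 0) (htb : 0 < t / b) :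
    IsHermitianStructure (tsukadaJ 𝒮₁ 𝒮₂ a b) (prodOmega 𝒮₁ 𝒮₂ t) where
  isComplexStructure := isComplexStructure_tsukadaJ h₁ h₂ a hb
  smooth := isSmooth_prodOmega h₁ h₂ t
  invariant z v w :=
    (prodOmega_apply t z _ _).trans ((congrArg₂ (· + ·)
      (congrArg₂ (· + ·) (tsukadaJ_Φ_fst a b z rfl v w) (tsukadaJ_Φ_snd a b z rfl v w))
      (congrArg (t * ·) (tsukadaJ_η_wedge h₁ h₂ a hb z rfl v w))).trans
        (prodOmega_apply t z v w).symm)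
  pos z _ hv := prodOmega_pos h₁ h₂ a hb htb z rfl hv

end ProductHermitian

/-! ### The form `∂∂̄ Ω ^ (m + 1)` of the product -/

section ProductDelDelbar

variable {E₁ : Type*} [NormedAddCommGroup E₁] [NormedSpace ℝ E₁]
  {H₁ : Type*} [TopologicalSpace H₁] {I₁ : ModelWithCorners ℝ E₁ H₁}
  {M₁ : Type*} [TopologicalSpace M₁] [ChartedSpace H₁ M₁] [IsManifold I₁ ∞ M₁] [I₁.Boundaryless]
  {E₂ : Type*} [NormedAddCommGroup E₂] [NormedSpace ℝ E₂]
  {H₂ : Type*} [TopologicalSpace H₂] {I₂ : ModelWithCorners ℝ E₂ H₂}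
  {M₂ : Type*} [TopologicalSpace M₂] [ChartedSpace H₂ M₂] [IsManifold I₂ ∞ M₂] [I₂.Boundaryless]
  (𝒮₁ : AlmostContactMetric I₁ M₁) (𝒮₂ : AlmostContactMetric I₂ M₂)

/-- The pullback of `Φ₁` to the product, complex valued. -/
def phiFst : Form (I₁.prod I₂) (M₁ × M₂) 2 ℂ :=
  (𝒮₁.Φ.pullback (Prod.fst : M₁ × M₂ → M₁) : Form (I₁.prod I₂) (M₁ × M₂) 2 ℝ).toComplex

/-- The pullback of `Φ₂` to the product, complex valued. -/
def phiSnd : Form (I₁.prod I₂) (M₁ × M₂) 2 ℂ :=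
  (𝒮₂.Φ.pullback (Prod.snd : M₁ × M₂ → M₂) : Form (I₁.prod I₂) (M₁ × M₂) 2 ℝ).toComplex

/-- The pullback of `η₁` to the product, as a complex valued form of degree one. -/
def etaFormFst : Form (I₁.prod I₂) (M₁ × M₂) 1 ℂ :=
  ((oneForm 𝒮₁.η).pullback (Prod.fst : M₁ × M₂ → M₁) :
    Form (I₁.prod I₂) (M₁ × M₂) 1 ℝ).toComplex

/-- The pullback of `η₂` to the product, as a complex valued form of degree one. -/
def etaFormSnd : Form (I₁.prod I₂) (M₁ × M₂) 1 ℂ :=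
  ((oneForm 𝒮₂.η).pullback (Prod.snd : M₁ × M₂ → M₂) :
    Form (I₁.prod I₂) (M₁ × M₂) 1 ℝ).toComplex

variable {𝒮₁ 𝒮₂}

theorem ringAt_etaFormFst (z : M₁ × M₂) :
    (etaFormFst (I₂ := I₂) 𝒮₁).ringAt z = toRing (covector (etaFst 𝒮₁ z)) :=
  congrArg (toRing (V := E₁ × E₂)) (oneForm_pullback_fst (𝒮₁ := 𝒮₁) (I₂ := I₂) z rfl).symm

theorem ringAt_etaFormSnd (z : M₁ × M₂) :
    (etaFormSnd (I₁ := I₁) 𝒮₂).ringAt z = toRing (covector (etaSnd 𝒮₂ z)) :=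
  congrArg (toRing (V := E₁ × E₂)) (oneForm_pullback_snd (𝒮₂ := 𝒮₂) (I₁ := I₁) z rfl).symm

theorem ringAt_phiFst (z : M₁ × M₂) : (phiFst (I₂ := I₂) 𝒮₁).ringAt z =
    pull (ContinuousLinearMap.fst ℝ E₁ E₂) (toRing (complexify (V := E₁) (𝒮₁.Φ z.1))) := by
  rw [pull_toRing]
  refine congrArg (toRing (V := E₁ × E₂)) (ContinuousAlternatingMap.ext fun v : Fin 2 → E₁ × E₂ => ?_)
  exact congrArg Complex.ofReal
    (isChartLinear_fst.pullback_apply (I := I₁) (I' := I₁.prod I₂) 𝒮₁.Φ z v)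

theorem ringAt_phiSnd (z : M₁ × M₂) : (phiSnd (I₁ := I₁) 𝒮₂).ringAt z =
    pull (ContinuousLinearMap.snd ℝ E₁ E₂) (toRing (complexify (V := E₂) (𝒮₂.Φ z.2))) := by
  rw [pull_toRing]
  refine congrArg (toRing (V := E₁ × E₂)) (ContinuousAlternatingMap.ext fun v : Fin 2 → E₁ × E₂ => ?_)
  exact congrArg Complex.ofReal
    (isChartLinear_snd.pullback_apply (I := I₂) (I' := I₁.prod I₂) 𝒮₂.Φ z v)

theorem ringAt_phiFst_pow {n₁ : ℕ} [FiniteDimensional ℝ E₁] (hE₁ : Module.finrank ℝ E₁ = 2 * n₁ + 1)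
    (z : M₁ × M₂) : (phiFst (I₂ := I₂) 𝒮₁).ringAt z ^ (n₁ + 1) = 0 := by
  rw [ringAt_phiFst, ← map_pow]
  exact (congrArg _ (toRing_pow_eq_zero (by omega) _)).trans (map_zero _)

theorem ringAt_phiSnd_pow {n₂ : ℕ} [FiniteDimensional ℝ E₂] (hE₂ : Module.finrank ℝ E₂ = 2 * n₂ + 1)
    (z : M₁ × M₂) : (phiSnd (I₁ := I₁) 𝒮₂).ringAt z ^ (n₂ + 1) = 0 := by
  rw [ringAt_phiSnd, ← map_pow]
  exact (congrArg _ (toRing_pow_eq_zero (by omega) _)).trans (map_zero _)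

theorem toComplex_d_eq_zero {E H M : Type*} [NormedAddCommGroup E] [NormedSpace ℝ E]
    [TopologicalSpace H] {I : ModelWithCorners ℝ E H} [TopologicalSpace M] [ChartedSpace H M]
    [IsManifold I ∞ M] [I.Boundaryless] {k : ℕ} {α : Form I M k ℝ} (hα : α.IsSmooth)
    (h : α.d = 0) (x : M) : α.toComplex.d.ringAt x = 0 := by
  rw [Form.toComplex_d fun x => hα.diffAt x, h]
  exact (congrArg (toRing (V := E)) (ContinuousAlternatingMap.ext fun _ => Complex.ofReal_zero)).trans
    (toRing_zero (V := E))

theorem ringAt_d_phiFst (h₁ : 𝒮₁.IsSasakian) (z : M₁ × M₂) :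
    (phiFst (I₂ := I₂) 𝒮₁).d.ringAt z = 0 := by
  refine toComplex_d_eq_zero (isChartLinear_fst.isSmooth_pullback h₁.isSmooth_Φ) ?_ z
  rw [isChartLinear_fst.pullback_d h₁.isSmooth_Φ, h₁.closed]
  rfl

theorem ringAt_d_phiSnd (h₂ : 𝒮₂.IsSasakian) (z : M₁ × M₂) :
    (phiSnd (I₁ := I₁) 𝒮₂).d.ringAt z = 0 := by
  refine toComplex_d_eq_zero (isChartLinear_snd.isSmooth_pullback h₂.isSmooth_Φ) ?_ z
  rw [isChartLinear_snd.pullback_d h₂.isSmooth_Φ, h₂.closed]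
  rfl

theorem etaFormFst_d (h₁ : 𝒮₁.IsSasakian) :
    (etaFormFst (I₂ := I₂) (M₂ := M₂) 𝒮₁).d = phiFst 𝒮₁ := by
  rw [etaFormFst, phiFst, Form.toComplex_d
    (isChartLinear_fst.isSmooth_pullback 𝒮₁.smooth_η).diffAt,
    isChartLinear_fst.pullback_d 𝒮₁.smooth_η, h₁.contact]

theorem etaFormSnd_d (h₂ : 𝒮₂.IsSasakian) :
    (etaFormSnd (I₁ := I₁) (M₁ := M₁) 𝒮₂).d = phiSnd 𝒮₂ := by
  rw [etaFormSnd, phiSnd, Form.toComplex_d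
    (isChartLinear_snd.isSmooth_pullback 𝒮₂.smooth_η).diffAt,
    isChartLinear_snd.pullback_d 𝒮₂.smooth_η, h₂.contact]

theorem hasType_phiFst (h₁ : 𝒮₁.IsSasakian) (h₂ : 𝒮₂.IsSasakian) (a : ℝ) {b : ℝ} (hb : b ≠ 0)
    (z : M₁ × M₂) : HasType (V := E₁ × E₂) (tsukadaJ 𝒮₁ 𝒮₂ a b z) 1 1
      ((phiFst (I₂ := I₂) 𝒮₁).ringAt z) := by
  refine hasType_two (V := E₁ × E₂) (tsukadaJ_sq h₁ h₂ a hb z rfl) fun v w => ?_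
  have e : ∀ v w : E₁ × E₂, (phiFst (I₂ := I₂) 𝒮₁ z : AltForm (E₁ × E₂) 2) ![v, w] =
      (((𝒮₁.Φ z.1 : E₁ [⋀^Fin 2]→L[ℝ] ℝ) ![v.1, w.1] : ℝ) : ℂ) := fun v w => by
    refine congrArg Complex.ofReal
      ((isChartLinear_fst.pullback_apply (I := I₁) (I' := I₁.prod I₂) 𝒮₁.Φ z ![v, w]).trans ?_)
    congr 1
    ext i; fin_cases i <;> rfl
  exact (e _ _).trans ((congrArg Complex.ofReal (tsukadaJ_Φ_fst a b z rfl v w)).trans (e v w).symm)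

theorem hasType_phiSnd (h₁ : 𝒮₁.IsSasakian) (h₂ : 𝒮₂.IsSasakian) (a : ℝ) {b : ℝ} (hb : b ≠ 0)
    (z : M₁ × M₂) : HasType (V := E₁ × E₂) (tsukadaJ 𝒮₁ 𝒮₂ a b z) 1 1
      ((phiSnd (I₁ := I₁) 𝒮₂).ringAt z) := by
  refine hasType_two (V := E₁ × E₂) (tsukadaJ_sq h₁ h₂ a hb z rfl) fun v w => ?_
  have e : ∀ v w : E₁ × E₂, (phiSnd (I₁ := I₁) 𝒮₂ z : AltForm (E₁ × E₂) 2) ![v, w] =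
      (((𝒮₂.Φ z.2 : E₂ [⋀^Fin 2]→L[ℝ] ℝ) ![v.2, w.2] : ℝ) : ℂ) := fun v w => by
    refine congrArg Complex.ofReal
      ((isChartLinear_snd.pullback_apply (I := I₂) (I' := I₁.prod I₂) 𝒮₂.Φ z ![v, w]).trans ?_)
    congr 1
    ext i; fin_cases i <;> rfl
  exact (e _ _).trans ((congrArg Complex.ofReal (tsukadaJ_Φ_snd a b z rfl v w)).trans (e v w).symm)

theorem hasType_eta_wedge (h₁ : 𝒮₁.IsSasakian) (h₂ : 𝒮₂.IsSasakian) (a : ℝ) {b : ℝ} (hb : b ≠ 0)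
    (z : M₁ × M₂) : HasType (V := E₁ × E₂) (tsukadaJ 𝒮₁ 𝒮₂ a b z) 1 1
      (((etaFormFst (I₂ := I₂) 𝒮₁).wedge (etaFormSnd (I₁ := I₁) 𝒮₂)).ringAt z) := by
  rw [Form.ringAt_wedge, ringAt_etaFormFst, ringAt_etaFormSnd, ← toRing_wedge]
  refine hasType_two (V := E₁ × E₂) (tsukadaJ_sq h₁ h₂ a hb z rfl) fun v w => ?_
  rw [covector_mul_apply, covector_mul_apply]
  have h := congrArg Complex.ofReal (tsukadaJ_η_wedge h₁ h₂ a hb z rfl v w)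
  rw [Complex.ofReal_sub, Complex.ofReal_sub, Complex.ofReal_mul, Complex.ofReal_mul,
    Complex.ofReal_mul, Complex.ofReal_mul] at h
  exact h

/-- The covector `η₁ + (a ± √-1 b) η₂` is an eigenvector of the transpose of `J`, with eigenvalue
`± √-1`. Both signs are covered by the square root `i` of `-1`. -/
theorem etaFst_add_smul_etaSnd_tsukadaJ (h₁ : 𝒮₁.IsSasakian) (h₂ : 𝒮₂.IsSasakian) (a : ℝ) {b : ℝ}
    (hb : b ≠ 0) (z : M₁ × M₂) {i : ℂ} (hi : i * i = -1) {P : E₁ × E₂ →L[ℝ] E₁ × E₂}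
    (hP : P = tsukadaJ 𝒮₁ 𝒮₂ a b z) (w : E₁ × E₂) :
    (etaFst 𝒮₁ z + (a + b * i : ℂ) • etaSnd 𝒮₂ z : E₁ × E₂ →L[ℝ] ℂ) (P w) =
      i * (etaFst 𝒮₁ z + (a + b * i : ℂ) • etaSnd 𝒮₂ z : E₁ × E₂ →L[ℝ] ℂ) w := by
  have e1 : etaFst 𝒮₁ z (P w) = _ := congrArg Complex.ofReal (tsukadaJ_η h₁ h₂ a b z hP w).1
  have e2 : etaSnd 𝒮₂ z (P w) = _ := congrArg Complex.ofReal (tsukadaJ_η h₁ h₂ a b z hP w).2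
  have f1 : etaFst 𝒮₁ z w = Complex.ofReal ((𝒮₁.η z.1 : E₁ →L[ℝ] ℝ) w.1) := rfl
  have f2 : etaSnd 𝒮₂ z w = Complex.ofReal ((𝒮₂.η z.2 : E₂ →L[ℝ] ℝ) w.2) := rfl
  rw [add_apply, add_apply, smul_apply, smul_apply, e1, e2, f1, f2]
  generalize (𝒮₁.η z.1 : E₁ →L[ℝ] ℝ) w.1 = x
  generalize (𝒮₂.η z.2 : E₂ →L[ℝ] ℝ) w.2 = y
  have hbC : (b : ℂ) ≠ 0 := by exact_mod_cast hb
  push_cast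
  simp only [smul_eq_mul]
  field_simp
  linear_combination (-(b : ℂ) ^ 2 * y) * hi

theorem hasType_eta_add_smul (h₁ : 𝒮₁.IsSasakian) (h₂ : 𝒮₂.IsSasakian) (a : ℝ) {b : ℝ}
    (hb : b ≠ 0) (z : M₁ × M₂) : HasType (V := E₁ × E₂) (tsukadaJ 𝒮₁ 𝒮₂ a b z) 1 0
      ((etaFormFst (I₂ := I₂) 𝒮₁).ringAt z +
        (a + b * Complex.I : ℂ) • (etaFormSnd (I₁ := I₁) 𝒮₂).ringAt z) := by
  rw [ringAt_etaFormFst, ringAt_etaFormSnd, ← covector_add_smul]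
  exact hasType_one_zero (V := E₁ × E₂)
    (etaFst_add_smul_etaSnd_tsukadaJ h₁ h₂ a hb z Complex.I_mul_I rfl)

theorem hasType_eta_sub_smul (h₁ : 𝒮₁.IsSasakian) (h₂ : 𝒮₂.IsSasakian) (a : ℝ) {b : ℝ}
    (hb : b ≠ 0) (z : M₁ × M₂) : HasType (V := E₁ × E₂) (tsukadaJ 𝒮₁ 𝒮₂ a b z) 0 1
      ((etaFormFst (I₂ := I₂) 𝒮₁).ringAt z +
        (a + b * -Complex.I : ℂ) • (etaFormSnd (I₁ := I₁) 𝒮₂).ringAt z) := by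
  rw [ringAt_etaFormFst, ringAt_etaFormSnd, ← covector_add_smul]
  exact hasType_zero_one (V := E₁ × E₂) (etaFst_add_smul_etaSnd_tsukadaJ h₁ h₂ a hb z
    (by rw [neg_mul_neg, Complex.I_mul_I]) rfl)

variable [FiniteDimensional ℝ E₁] [FiniteDimensional ℝ E₂]

/-- `∂∂̄ Ω ^ (m + 1)` is a nonzero multiple of
`(Φ₁² + 2 a Φ₁ Φ₂ + (a² + b²) Φ₂²) (Φ₁ + Φ₂) ^ m`. -/
theorem ringAt_del_delbar_prodOmega_pow (h₁ : 𝒮₁.IsSasakian) (h₂ : 𝒮₂.IsSasakian) (a : ℝ)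
    {b t : ℝ} (hb : b ≠ 0) (ht : t ≠ 0) (m : ℕ) (z : M₁ × M₂) :
    ∃ r : ℂ, r ≠ 0 ∧
      (del (tsukadaJ 𝒮₁ 𝒮₂ a b) (delbar (tsukadaJ 𝒮₁ 𝒮₂ a b)
        ((prodOmega 𝒮₁ 𝒮₂ t).toComplex.pow (m + 1)))).ringAt z =
      r • (((phiFst (I₂ := I₂) 𝒮₁).ringAt z ^ 2 +
        (2 * a : ℂ) • ((phiFst (I₂ := I₂) 𝒮₁).ringAt z * (phiSnd (I₁ := I₁) 𝒮₂).ringAt z) +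
        (a ^ 2 + b ^ 2 : ℂ) • (phiSnd (I₁ := I₁) 𝒮₂).ringAt z ^ 2) *
          ((phiFst (I₂ := I₂) 𝒮₁).ringAt z + (phiSnd (I₁ := I₁) 𝒮₂).ringAt z) ^ m) := by
  have hbC : (b : ℂ) ≠ 0 := by exact_mod_cast hb
  have htC : (t : ℂ) ≠ 0 := by exact_mod_cast ht
  have hc : (a + b * Complex.I : ℂ) - (a + b * -Complex.I) ≠ 0 := by
    rw [show (a + b * Complex.I : ℂ) - (a + b * -Complex.I) = 2 * b * Complex.I by ring]
    simp [hbC]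
  have key := ringAt_del_delbar_pow (J := tsukadaJ 𝒮₁ 𝒮₂ a b) (X := phiFst 𝒮₁) (Y := phiSnd 𝒮₂)
    (h₁ := etaFormFst 𝒮₁) (h₂ := etaFormSnd 𝒮₂) (t : ℂ) hc
    (isChartLinear_fst.isSmooth_pullback h₁.isSmooth_Φ).toComplex.diffAt
    (isChartLinear_snd.isSmooth_pullback h₂.isSmooth_Φ).toComplex.diffAt
    (isChartLinear_fst.isSmooth_pullback 𝒮₁.smooth_η).toComplex.diffAt
    (isChartLinear_snd.isSmooth_pullback 𝒮₂.smooth_η).toComplex.diffAt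
    (ringAt_d_phiFst h₁) (ringAt_d_phiSnd h₂)
    (fun x => by rw [etaFormFst_d h₁]) (fun x => by rw [etaFormSnd_d h₂])
    (hasType_phiFst h₁ h₂ a hb) (hasType_phiSnd h₁ h₂ a hb) (hasType_eta_add_smul h₁ h₂ a hb)
    (hasType_eta_sub_smul h₁ h₂ a hb) (hasType_eta_wedge h₁ h₂ a hb) m z
  refine ⟨-((m + 1 : ℂ) * (t / ((a + b * Complex.I) - (a + b * -Complex.I)))), ?_, (congrArg (fun Ω : Form (I₁.prod I₂) (M₁ × M₂) 2 ℂ =>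
    (del (tsukadaJ 𝒮₁ 𝒮₂ a b) (delbar (tsukadaJ 𝒮₁ 𝒮₂ a b) (Ω.pow (m + 1)))).ringAt z)
    (prodOmega_toComplex t)).trans (key.trans ?_)⟩
  · exact neg_ne_zero.2 (mul_ne_zero (by exact_mod_cast m.succ_ne_zero) (div_ne_zero htC hc))
  · have hs : (a + b * Complex.I : ℂ) + (a + b * -Complex.I) = 2 * a := by ring
    have hp : (a + b * Complex.I : ℂ) * (a + b * -Complex.I) = a ^ 2 + b ^ 2 := by
      linear_combination (-(b : ℂ) ^ 2) * Complex.I_mul_I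
    rw [hs, hp]

/-- The numerical criterion, in the exterior algebra of a tangent space of the product. -/
theorem ringAt_quadratic_eq_zero_iff (h₁ : 𝒮₁.IsSasakian) (h₂ : 𝒮₂.IsSasakian) (a : ℝ) {b t : ℝ}
    (hb : b ≠ 0) (htb : 0 < t / b) {n₁ n₂ : ℕ} (hN : 2 ≤ n₁ + n₂)
    (hE₁ : Module.finrank ℝ E₁ = 2 * n₁ + 1) (hE₂ : Module.finrank ℝ E₂ = 2 * n₂ + 1)
    (z : M₁ × M₂) {X Y O : FormRing (E₁ × E₂)} (hX : X = (phiFst (I₂ := I₂) 𝒮₁).ringAt z)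
    (hY : Y = (phiSnd (I₁ := I₁) 𝒮₂).ringAt z)
    (hO : O = (prodOmega 𝒮₁ 𝒮₂ t).toComplex.ringAt z) :
    ((X ^ 2 + (2 * a : ℂ) • (X * Y) + (a ^ 2 + b ^ 2 : ℂ) • Y ^ 2) * (X + Y) ^ (n₁ + n₂ - 2) = 0 ↔
      (n₁ : ℝ) * ((n₁ : ℝ) - 1) + 2 * a * (n₁ : ℝ) * (n₂ : ℝ)
        + (a ^ 2 + b ^ 2) * ((n₂ : ℝ) * ((n₂ : ℝ) - 1)) = 0) ∧
    ((X ^ 2 + (2 * a : ℂ) • (X * Y) + (a ^ 2 + b ^ 2 : ℂ) • Y ^ 2) * O ^ (n₁ + n₂ - 1) = 0 ↔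
      (n₁ : ℝ) * ((n₁ : ℝ) - 1) + 2 * a * (n₁ : ℝ) * (n₂ : ℝ)
        + (a ^ 2 + b ^ 2) * ((n₂ : ℝ) * ((n₂ : ℝ) - 1)) = 0) := by
  have cX : X ∈ Subalgebra.center ℂ (FormRing (E₁ × E₂)) := hX ▸ toRing_two_mem_center _
  have cY : Y ∈ Subalgebra.center ℂ (FormRing (E₁ × E₂)) := hY ▸ toRing_two_mem_center _
  set e : FormRing (E₁ × E₂) := toRing (covector (etaFst 𝒮₁ z)) * toRing (covector (etaSnd 𝒮₂ z))
    with he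
  have ce : e ∈ Subalgebra.center ℂ (FormRing (E₁ × E₂)) := by
    rw [he, ← toRing_wedge]
    exact toRing_two_mem_center _
  have hO' : O = X + Y + (t : ℂ) • e := by
    rw [hO, prodOmega_toComplex, Form.ringAt_add, Form.ringAt_add, Form.ringAt_smul,
      Form.ringAt_wedge, hX, hY, he, ← ringAt_etaFormFst (I₂ := I₂), ← ringAt_etaFormSnd (I₁ := I₁)]
    rfl
  have hΩ : O ^ (n₁ + n₂ + 1) ≠ 0 := by
    rw [hO]
    refine pow_complexify_ne_zero (V := E₁ × E₂) ?_ (prodOmega 𝒮₁ 𝒮₂ t z) fun v hv => ?_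
    · rw [Module.finrank_prod, hE₁, hE₂]
      ring
    · exact ⟨_, (prodOmega_pos h₁ h₂ a hb htb z rfl hv).ne'⟩
  have key := quadratic_mul_pow_eq_zero_iff (R := Subalgebra.center ℂ (FormRing (E₁ × E₂)))
    hN (x := ⟨X, cX⟩) (y := ⟨Y, cY⟩) (e := ⟨e, ce⟩) a (a ^ 2 + b ^ 2) t
    (Subtype.ext (by simpa [hX] using ringAt_phiFst_pow hE₁ z))
    (Subtype.ext (by simpa [hY] using ringAt_phiSnd_pow hE₂ z))
    (Subtype.ext (covector_mul_mul_self _ _))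
    (fun h => hΩ (by rw [hO']; exact congrArg Subtype.val h))
  have hcast : ((n₁ * (n₁ - 1) + 2 * a * n₁ * n₂ + (a ^ 2 + b ^ 2) * (n₂ * (n₂ - 1)) : ℂ) = 0) ↔
      ((n₁ : ℝ) * ((n₁ : ℝ) - 1) + 2 * a * (n₁ : ℝ) * (n₂ : ℝ)
        + (a ^ 2 + b ^ 2) * ((n₂ : ℝ) * ((n₂ : ℝ) - 1)) = 0) := by
    exact_mod_cast Iff.rfl
  rw [hcast] at key
  rw [hO']
  exact ⟨Subtype.ext_iff.symm.trans key.1, Subtype.ext_iff.symm.trans key.2⟩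

end ProductDelDelbar

end SasakianProduct

end

theorem mainTheorem9
    {n₁ n₂ : ℕ} (hn : 6 < 2 * (n₁ + n₂ + 1))
    {E₁ : Type*} [NormedAddCommGroup E₁] [NormedSpace ℝ E₁] [FiniteDimensional ℝ E₁]
    (hE₁ : Module.finrank ℝ E₁ = 2 * n₁ + 1)
    {E₂ : Type*} [NormedAddCommGroup E₂] [NormedSpace ℝ E₂] [FiniteDimensional ℝ E₂]
    (hE₂ : Module.finrank ℝ E₂ = 2 * n₂ + 1)
    {M₁ : Type*} [TopologicalSpace M₁] [ChartedSpace E₁ M₁] [IsManifold 𝓘(ℝ, E₁) ∞ M₁]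
    [Nonempty M₁]
    {M₂ : Type*} [TopologicalSpace M₂] [ChartedSpace E₂ M₂] [IsManifold 𝓘(ℝ, E₂) ∞ M₂]
    [Nonempty M₂]
    (𝒮₁ : AlmostContactMetric 𝓘(ℝ, E₁) M₁) (h𝒮₁ : 𝒮₁.IsSasakian)
    (𝒮₂ : AlmostContactMetric 𝓘(ℝ, E₂) M₂) (h𝒮₂ : 𝒮₂.IsSasakian)
    (a b t : ℝ) (hb : b ≠ 0) (htb : 0 < t / b) :
    IsHermitianStructure (tsukadaJ 𝒮₁ 𝒮₂ a b) (prodOmega 𝒮₁ 𝒮₂ t) ∧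
    (IsGauduchon (n₁ + n₂ + 1) 1 (tsukadaJ 𝒮₁ 𝒮₂ a b) (prodOmega 𝒮₁ 𝒮₂ t) ↔
      IsAsthenoKahler (n₁ + n₂ + 1) (tsukadaJ 𝒮₁ 𝒮₂ a b) (prodOmega 𝒮₁ 𝒮₂ t)) ∧
    (IsAsthenoKahler (n₁ + n₂ + 1) (tsukadaJ 𝒮₁ 𝒮₂ a b) (prodOmega 𝒮₁ 𝒮₂ t) ↔
      (n₁ : ℝ) * ((n₁ : ℝ) - 1) + 2 * a * (n₁ : ℝ) * (n₂ : ℝ)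
        + (a ^ 2 + b ^ 2) * ((n₂ : ℝ) * ((n₂ : ℝ) - 1)) = 0) := by
  have hN : 2 ≤ n₁ + n₂ := by omega
  have ht : t ≠ 0 := fun h => by simp [h] at htb
  -- both conditions are equivalent to the numerical one, as they are so at each point
  have key : (IsGauduchon (n₁ + n₂ + 1) 1 (tsukadaJ 𝒮₁ 𝒮₂ a b) (prodOmega 𝒮₁ 𝒮₂ t) ↔
      (n₁ : ℝ) * ((n₁ : ℝ) - 1) + 2 * a * (n₁ : ℝ) * (n₂ : ℝ)
        + (a ^ 2 + b ^ 2) * ((n₂ : ℝ) * ((n₂ : ℝ) - 1)) = 0) ∧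
      (IsAsthenoKahler (n₁ + n₂ + 1) (tsukadaJ 𝒮₁ 𝒮₂ a b) (prodOmega 𝒮₁ 𝒮₂ t) ↔
      (n₁ : ℝ) * ((n₁ : ℝ) - 1) + 2 * a * (n₁ : ℝ) * (n₂ : ℝ)
        + (a ^ 2 + b ^ 2) * ((n₂ : ℝ) * ((n₂ : ℝ) - 1)) = 0) := by
    constructor
    · rw [IsGauduchon, Form.ringAt_eq_zero]
      refine (forall_congr' fun z => ?_).trans (forall_const (M₁ × M₂))
      obtain ⟨r, hr, h⟩ := ringAt_del_delbar_prodOmega_pow h𝒮₁ h𝒮₂ a hb ht 0 z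
      rw [pow_zero, mul_one] at h
      rw [Form.ringAt_wedge, Form.ringAt_pow, h, smul_mul_assoc, smul_eq_zero_iff_right hr]
      exact (ringAt_quadratic_eq_zero_iff h𝒮₁ h𝒮₂ a hb htb hN hE₁ hE₂ z rfl rfl rfl).2
    · rw [IsAsthenoKahler, Form.ringAt_eq_zero]
      refine (forall_congr' fun z => ?_).trans (forall_const (M₁ × M₂))
      obtain ⟨r, hr, h⟩ := ringAt_del_delbar_prodOmega_pow h𝒮₁ h𝒮₂ a hb ht (n₁ + n₂ - 2) z
      rw [show n₁ + n₂ + 1 - 2 = n₁ + n₂ - 2 + 1 by omega, h, smul_eq_zero_iff_right hr]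
      exact (ringAt_quadratic_eq_zero_iff h𝒮₁ h𝒮₂ a hb htb hN hE₁ hE₂ z rfl rfl rfl).1
  exact ⟨isHermitianStructure_prod h𝒮₁ h𝒮₂ a hb htb, key.1.trans key.2.symm, key.2⟩
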